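/- Let $\{d(n)\}_{n\in\mathbb Z}$ and $\{z(n)\}_{n\in\mathbb Z}$ be complex second-order cyclostationary processes of period $P\ge 1$ (i.e. $\mathbb E|d(n)|^2<\infty$ and $r_d(n,m)=\mathbb E[d(n+m)d^*(n)]$ is $P$-periodic in $n$; same for $z$), mutually uncorrelated ($\mathbb E[d(n)z^*(n')]=0$ for all $n,n'$), one of which is white with positive power, and let $x(n)=d(n)+z(n)$. Assume that the cyclic spectra exist as integrable densities: for $(a,b)\in\{(d,d),(x,x),(d,x)\}$ and $k\in\mathbb Z$, $S_{AB}^{(k/P)}\in L^1[0,1)$ satisfies $\frac1P\sum_{n=0}^{P-1}\mathbb E[a(n+m)b^*(n)]e^{-i2\pi kn/P}=\int_0^1S_{AB}^{(k/P)}(f)e^{i2\pi fm}\,df$ for all $m\in\mathbb Z$. For $\sigma\in[0,1/P)$ and $0\le r,c<P$ put $[\mathbf S_{AB}(\sigma)]_{r,c}=S_{AB}^{((r-c)/P)}(\sigma+r/P)$, $\mathbf S_D=\mathbf S_{DD}$, $\mathbf S_X=\mathbf S_{XX}$. Write $x(n)=\sum_{q=0}^{P-1}\int_0^{1/P}e^{i2\pi(\sigma+q/P)n}\,d\nu_x^{(q)}(\sigma)$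 for the spectral representation of $x$, where $\mathbb E[d\nu_x^{(r)}(\sigma)\,d\nu_x^{(c)*}(\sigma')]=[\mathbf S_X(\sigma)]_{r,c}\,\delta(\sigma-\sigma')\,d\sigma\,d\sigma'$. The asymptotic error power of an estimate $\hat d$ is $\mathrm{MSE}_{\mathrm{nc}}=\lim_{N\to\infty}\frac{1}{N-1}\sum_{n=-N/2}^{N/2-1}\mathbb E|d(n)-\hat d(n)|^2$ ($N$ even). A FRESH filter, with responses $W_q(f)$, $0\le q<P$, produces $d\nu_{\hat d}^{(p)}(\sigma)=\sum_{q}W_q^*(\sigma+p/P)\,d\nu_x^{(p+q\bmod P)}(\sigma)$. The cyclic Wiener filter (CWF) is the FRESH filter of least $\mathrm{MSE}_{\mathrm{nc}}$. Let $\mathbf B(\sigma)=[\mathbf b^{(0)}(\sigma),\dots,\mathbf b^{(P-1)}(\sigma)]$ be any unitary matrix, measurable in $\sigma$, whose columns are, for almost every $\sigma$, eigenvectors of $\mathbf S_X(\sigma)$ (a KL basis of $x$). Let $\phi^{(p)}(n,\sigma)=\sum_qb^{(p)}(q,\sigma)e^{i2\pi(\sigma+q/P)n}$, and let $d\xi_x^{(p)}$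 be the orthogonal increments, of density the eigenvalue of $\mathbf b^{(p)}(\sigma)$, with $x(n)=\sum_p\int_0^{1/P}\phi^{(p)}(n,\sigma)\,d\xi_x^{(p)}(\sigma)$. A scalar filter in the KL domain produces $d\xi_{\hat d}^{(p)}(\sigma)=\mathcal W_p^*(\sigma)\,d\xi_x^{(p)}(\sigma)$; the KL Wiener filter is the scalar filter of least $\mathrm{MSE}_{\mathrm{nc}}$. Put $\mathcal S_D^{(p)},\mathcal S_X^{(p)},\mathcal S_{DX}^{(p)}=[\mathbf B^H\mathbf S_{\bullet}\mathbf B]_{p,p}$ with $\bullet=D,X,DX$. Then, up to null sets of $\sigma$: 1. the CWF exists, is unique, and is given by $W_q(\sigma+p/P)=[\mathbf S_X^{-1}(\sigma)\mathbf S_{DX}^H(\sigma)]_{p+q\bmod P,\,p}$; at every $n$ its output has mean square error no larger than that of any finite linear combination of the $x(m)$, $m\in\mathbb Z$; 2. $\mathbf B$ is also an eigenbasis of $\mathbf S_D$; the KL Wiener filter exists, is unique, and is the scalar Wiener filter applied pointwise, $\mathcal W_p=\mathcal S_{DX}^{(p)*}/\mathcal S_X^{(p)}$; 3. the CWF and the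 KL Wiener filter are equivalent: they have the same output process $\{\hat d(n)\}$ (almost surely for each $n$), hence the same least error power $\mathrm{MMSE}_{\mathrm{nc}}$; 4. with $|\gamma_p|^2=|\mathcal S_{DX}^{(p)}|^2/(\mathcal S_X^{(p)}\mathcal S_D^{(p)})$ (and $0$ where $\mathcal S_D^{(p)}=0$) and $\mathbf C_{DX}=\mathbf S_D^{-1/2}\mathbf S_{DX}\mathbf S_X^{-1/2}$ (with the pseudo-inverse of $\mathbf S_D$ where it is singular), and all the integrands being integrable, $$\mathrm{MMSE}_{\mathrm{nc}}=\sum_{p=0}^{P-1}\int_0^{1/P}\mathcal S_D^{(p)}(\sigma)\bigl(1-|\gamma_p(\sigma)|^2\bigr)\,d\sigma=\int_0^{1/P}\operatorname{tr}\bigl[\mathbf S_D(\sigma)\bigl(\mathbf I-\mathbf C_{DX}(\sigma)\mathbf C_{DX}^H(\sigma)\bigr)\bigr]\,d\sigma;$$ 5. if $z$ is white with power $P_z>0$, then $\mathrm{MMSE}_{\mathrm{nc}}=P_z\int_0^{1/P}\operatorname{tr}\bigl[\mathbf S_D(\sigma)\bigl(\mathbf S_D(\sigma)+P_z\mathbf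 I\bigr)^{-1}\bigr]\,d\sigma$. -/

import Mathlib

open MeasureTheory Filter Topology
open scoped Matrix ComplexConjugate

noncomputable section

/-- The exponential `exp(2 π i t)`. -/
def cexp2pi (t : ℝ) : ℂ := Complex.exp (2 * Real.pi * Complex.I * (t : ℂ))

/-- Lebesgue measure on the spectral sub-band `[0, 1/P)`. -/
def band (P : ℕ) : Measure ℝ := volume.restrict (Set.Ico (0 : ℝ) (1 / (P : ℝ)))

section Processes

variable {Ω : Type*} [MeasurableSpace Ω]

/-- Correlation function `r_{xy}(n, m) = E[x(n+m) y(n)^*]` with time `n` and lag `m`. -/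
def corr (μ : Measure Ω) (x y : ℤ → Ω → ℂ) (n m : ℤ) : ℂ :=
  ∫ ω, x (n + m) ω * conj (y n ω) ∂μ

/-- A second-order process whose autocorrelation is `P`-periodic in time. -/
def IsCyclostationary (μ : Measure Ω) (P : ℕ) (x : ℤ → Ω → ℂ) : Prop :=
  (∀ n, MemLp (x n) 2 μ) ∧
    ∀ n m l : ℤ, corr μ x x (n + l * (P : ℤ)) m = corr μ x x n m

/-- A second-order white process of power `p`. -/
def IsWhite (μ : Measure Ω) (p : ℝ) (x : ℤ → Ω → ℂ) : Prop :=
  (∀ n, MemLp (x n) 2 μ) ∧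
    ∀ n m : ℤ, corr μ x x n m = if m = 0 then (p : ℂ) else 0

/-- `S k` is the cyclic (cross-)spectrum at the cycle frequency `k / P`: the spectral density
whose Fourier coefficients are the cyclic correlations
`(1/P) ∑_{n < P} r(n, m) exp(-2 π i k n / P)`. It is unique up to null sets, and is given by
`S k f = (1/P) ∑_{n < P} ∑_m r(n, m) exp(-2 π i (k n / P + f m))` whenever the series over `m`
converges absolutely. -/
def IsCyclicSpectrum (P : ℕ) (r : ℤ → ℤ → ℂ) (S : ℤ → ℝ → ℂ) : Prop :=
  (∀ k, IntegrableOn (S k) (Set.Ico (0 : ℝ) 1)) ∧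
    ∀ k m : ℤ,
      (1 / (P : ℂ)) * ∑ n ∈ Finset.range P, r (n : ℤ) m * cexp2pi (-((k : ℝ) * (n : ℝ) / (P : ℝ)))
        = ∫ f in Set.Ico (0 : ℝ) 1, S k f * cexp2pi (f * (m : ℝ))

/-- The cyclic PSD matrix, `[S(σ)]_{r,c} = S^{((r-c)/P)}(σ + r/P)`. -/
def cycMat (P : ℕ) (S : ℤ → ℝ → ℂ) (σ : ℝ) : Matrix (Fin P) (Fin P) ℂ :=
  Matrix.of fun r c => S ((r.val : ℤ) - (c.val : ℤ)) (σ + (r.val : ℝ) / (P : ℝ))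

/-- Let the process `x` have a spectral representation
`x(n) = ∫ ∑_q e(n,σ)_q dζ^{(q)}(σ)` over `[0, 1/P)`, with
`E[dζ^{(r)}(σ) dζ^{(c)}(σ')^*] = K(σ)_{r,c} δ(σ-σ') dσ dσ'`.
This says `Y = ∫ ∑_q h(σ)_q dζ^{(q)}(σ)`. As usual, the integral is the isometric extension of
`∑_n c_n e(n,·) ↦ ∑_n c_n x(n)`: finite combinations of the `e(n,·)` tend to `h` in the
`L²` seminorm `∫ ∑_{r,c} h_r K_{r,c} h_c^* dσ`, and those of the `x(n)` tend to `Y` in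
mean square. -/
def HasSpectralIntegral (μ : Measure Ω) (P : ℕ) (x : ℤ → Ω → ℂ)
    (e : ℤ → ℝ → Fin P → ℂ) (K : ℝ → Matrix (Fin P) (Fin P) ℂ)
    (h : ℝ → Fin P → ℂ) (Y : Ω → ℂ) : Prop :=
  AEStronglyMeasurable h (band P) ∧ MemLp Y 2 μ ∧
    ∃ c : ℕ → (ℤ →₀ ℂ),
      Tendsto (fun k => ∫⁻ σ, ENNReal.ofReal
          ((h σ - (c k).sum fun n a => a • e n σ) ⬝ᵥ
            (K σ *ᵥ star (h σ - (c k).sum fun n a => a • e n σ))).re ∂(band P))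
        atTop (𝓝 0) ∧
      Tendsto (fun k => eLpNorm (Y - (c k).sum fun n a => a • x n) 2 μ) atTop (𝓝 0)

/-- The Fourier basis split into `P` sub-bands: `exp(2 π i (σ + q/P) n)`. -/
def clBasis (P : ℕ) (n : ℤ) (σ : ℝ) (q : Fin P) : ℂ :=
  cexp2pi ((σ + (q.val : ℝ) / (P : ℝ)) * (n : ℝ))

/-- `Y = ∫ ∑_q h_q(σ) dν_x^{(q)}(σ)` in the Cramér–Loève domain, where
`x(n) = ∑_q ∫ exp(2 π i (σ + q/P) n) dν_x^{(q)}(σ)` and `SX` is the cyclic PSD matrix of `x`. -/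
def HasCLIntegral (μ : Measure Ω) (P : ℕ) (x : ℤ → Ω → ℂ)
    (SX : ℝ → Matrix (Fin P) (Fin P) ℂ) (h : ℝ → Fin P → ℂ) (Y : Ω → ℂ) : Prop :=
  HasSpectralIntegral μ P x (clBasis P) SX h Y

/-- The columns `b^{(p)}(σ)` of `B σ` are an orthonormal eigenbasis of the cyclic PSD matrix
`M σ`, depending measurably on `σ`. -/
def IsKLBasis (P : ℕ) (M B : ℝ → Matrix (Fin P) (Fin P) ℂ) : Prop :=
  (∀ i j, AEMeasurable (fun σ => B σ i j) (band P)) ∧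
    ∀ᵐ σ ∂(band P), B σ ∈ Matrix.unitaryGroup (Fin P) ℂ ∧
      ∃ ev : Fin P → ℝ, ∀ p, M σ *ᵥ (B σ)ᵀ p = (ev p : ℂ) • (B σ)ᵀ p

/-- The diagonal entry `b^{(p)}(σ)^H M(σ) b^{(p)}(σ)`. If `M` is a cyclic PSD matrix and `B` an
eigenbasis of it, this is the eigenvalue of `b^{(p)}(σ)`, that is, the KL spectrum; for a
cross-spectral matrix it is the KL cross-spectrum. -/
def klSpec (P : ℕ) (M B : ℝ → Matrix (Fin P) (Fin P) ℂ) (p : Fin P) (σ : ℝ) : ℂ :=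
  ((B σ)ᴴ * M σ * B σ) p p

/-- KL eigenfunctions `φ^{(p)}(n,σ) = ∑_q b^{(p)}(q,σ) exp(2 π i (σ + q/P) n)`. -/
def klBasis (P : ℕ) (B : ℝ → Matrix (Fin P) (Fin P) ℂ) (n : ℤ) (σ : ℝ) (p : Fin P) : ℂ :=
  ∑ q, B σ q p * clBasis P n σ q

/-- `Y = ∫ ∑_p h_p(σ) dξ_x^{(p)}(σ)` in the Karhunen–Loève domain, where
`x(n) = ∑_p ∫ φ^{(p)}(n,σ) dξ_x^{(p)}(σ)` and the increments `dξ_x^{(p)}` are orthogonal with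
densities the KL spectrum of `x`. -/
def HasKLIntegral (μ : Measure Ω) (P : ℕ) (x : ℤ → Ω → ℂ)
    (SX B : ℝ → Matrix (Fin P) (Fin P) ℂ) (h : ℝ → Fin P → ℂ) (Y : Ω → ℂ) : Prop :=
  HasSpectralIntegral μ P x (klBasis P B)
    (fun σ => Matrix.diagonal fun p => klSpec P SX B p σ) h Y

/-- `dhat` is the output, for input `x`, of the FRESH filter with branch responses `W_q(f)`:
`dν_dhat^{(p)}(σ) = ∑_q W_q(σ + p/P)^* dν_x^{(p+q mod P)}(σ)`, collected here by `j = p + q`. -/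
def IsFreshOutput (μ : Measure Ω) (P : ℕ) [NeZero P] (x : ℤ → Ω → ℂ)
    (SX : ℝ → Matrix (Fin P) (Fin P) ℂ) (W : Fin P → ℝ → ℂ) (dhat : ℤ → Ω → ℂ) : Prop :=
  ∀ n, HasCLIntegral μ P x SX
    (fun σ j => ∑ p : Fin P, clBasis P n σ p * conj (W (j - p) (σ + (p.val : ℝ) / (P : ℝ))))
    (dhat n)

/-- `dhat` is the output, for input `x`, of the scalar filter `W_p(σ)` in the KL domain:
`dξ_dhat^{(p)}(σ) = W_p(σ)^* dξ_x^{(p)}(σ)`. -/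
def IsKLOutput (μ : Measure Ω) (P : ℕ) (x : ℤ → Ω → ℂ)
    (SX B : ℝ → Matrix (Fin P) (Fin P) ℂ) (W : Fin P → ℝ → ℂ) (dhat : ℤ → Ω → ℂ) : Prop :=
  ∀ n, HasKLIntegral μ P x SX B (fun σ p => klBasis P B n σ p * conj (W p σ)) (dhat n)

/-- Average error power over `N₁ ≤ n ≤ N₂`. -/
def mse (μ : Measure Ω) (d dhat : ℤ → Ω → ℂ) (N₁ N₂ : ℤ) : ℝ :=
  1 / ((N₂ : ℝ) - (N₁ : ℝ)) * ∑ n ∈ Finset.Icc N₁ N₂, ∫ ω, ‖d n ω - dhat n ω‖ ^ 2 ∂μ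

/-- `L` is the asymptotic average error power, the limit of `mse (-N/2) (N/2 - 1)` over even
`N = 2 K`. -/
def HasMSE (μ : Measure Ω) (d dhat : ℤ → Ω → ℂ) (L : ℝ) : Prop :=
  Tendsto (fun K : ℕ => mse μ d dhat (-(K : ℤ)) ((K : ℤ) - 1)) atTop (𝓝 L)

/-- Error powers achieved by FRESH filters. -/
def freshMSEs (μ : Measure Ω) (P : ℕ) [NeZero P] (d x : ℤ → Ω → ℂ)
    (SX : ℝ → Matrix (Fin P) (Fin P) ℂ) : Set ℝ :=
  {L | ∃ W dhat, IsFreshOutput μ P x SX W dhat ∧ HasMSE μ d dhat L}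

/-- Error powers achieved by scalar filters in the KL domain. -/
def klMSEs (μ : Measure Ω) (P : ℕ) (d x : ℤ → Ω → ℂ)
    (SX B : ℝ → Matrix (Fin P) (Fin P) ℂ) : Set ℝ :=
  {L | ∃ W dhat, IsKLOutput μ P x SX B W dhat ∧ HasMSE μ d dhat L}

/-- The cyclic Wiener filter: a FRESH filter of least error power. -/
def IsCyclicWiener (μ : Measure Ω) (P : ℕ) [NeZero P] (d x : ℤ → Ω → ℂ)
    (SX : ℝ → Matrix (Fin P) (Fin P) ℂ) (W : Fin P → ℝ → ℂ) : Prop :=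
  ∃ dhat L, IsFreshOutput μ P x SX W dhat ∧ HasMSE μ d dhat L ∧
    IsLeast (freshMSEs μ P d x SX) L

/-- The KL Wiener filter: a scalar filter in the KL domain of least error power. -/
def IsKLWiener (μ : Measure Ω) (P : ℕ) (d x : ℤ → Ω → ℂ)
    (SX B : ℝ → Matrix (Fin P) (Fin P) ℂ) (W : Fin P → ℝ → ℂ) : Prop :=
  ∃ dhat L, IsKLOutput μ P x SX B W dhat ∧ HasMSE μ d dhat L ∧
    IsLeast (klMSEs μ P d x SX B) L

end Processes

/-- Squared spectral coherence `|γ_p|² = |S_DX^{(p)}|² / (S_X^{(p)} S_D^{(p)})` in the KL domain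
(zero where the denominator vanishes). -/
def klCohSq (P : ℕ) (SD SX SDX B : ℝ → Matrix (Fin P) (Fin P) ℂ) (p : Fin P) (σ : ℝ) : ℝ :=
  ‖klSpec P SDX B p σ‖ ^ 2 / ((klSpec P SX B p σ).re * (klSpec P SD B p σ).re)

/-- `A^{-1/2}` for a positive semidefinite matrix (of the pseudo-inverse, if `A` is singular). -/
def invSqrt {P : ℕ} (A : Matrix (Fin P) (Fin P) ℂ) : Matrix (Fin P) (Fin P) ℂ :=
  cfc (fun t : ℝ => (Real.sqrt t)⁻¹) A

/-- Coherence matrix `C_DX = S_D^{-1/2} S_DX S_X^{-1/2}`. -/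
def cohMat {P : ℕ} (SD SDX SX : Matrix (Fin P) (Fin P) ℂ) : Matrix (Fin P) (Fin P) ℂ :=
  invSqrt SD * SDX * invSqrt SX

end

noncomputable section

open scoped ENNReal ComplexOrder

/-! Since signal and noise are uncorrelated, `d` and `x` have the same cross-correlation as `d` with
itself, and the correlation of `x` is the sum of those of `d` and `z`. Fourier coefficients
determine an integrable function, so almost everywhere `S_DX = S_D` and `S_X = S_D + S_Z`. Both
summands are positive semidefinite, and the white one is a scalar matrix `p • 1`. This yields the
three facts on which everything rests (`IsWhitePair`): `S_X ≥ p`, so `S_X` is invertible; `S_D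
S_X⁻¹` is bounded although `S_D` is only integrable; and each eigenvector of `S_X` is an eigenvector
of `S_D`.

Periodicity in time turns correlations into moments `∫ eₙ S eₘ^*` over one sub-band, with `eₙ =
clBasis P n` (`IsCyclicSpectrum.moment`). Hence `∑ cₙ x(n) ↦ ∑ cₙ eₙ` is an isometry for the
seminorm with weight `S_X` (`eLpNorm_combo`), and linear estimation becomes a problem at each `σ`.
Completing the square there and passing to limits shows that the estimate of `d(n)` with integrand
`u` has error `minErr n + ‖u - gₙ‖²`, where `gₙ = (S_D S_X⁻¹)ᵀ eₙ` (`eLpNorm_sub_sq`). The transpose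
appears because the forms `u ⬝ᵥ K *ᵥ star v` conjugate their right argument. As `gₙ` is bounded, it
is the integrand of a random variable (`exists_hasCLIntegral`).

A filter of either kind acts through a matrix response `M`, with `u = M eₙ`. The vector `eₙ₊ₚ` is a
unimodular multiple of `eₙ`, so the errors are `P`-periodic and the error power is their mean over a
period (`hasMSE`). The vectors of one period form an orthogonal basis of `ℂ^P`. Therefore only `M =
(S_D S_X⁻¹)ᵀ` has no excess error (`ae_eq_wienerMat`), and the least power is `∫ tr (S_D - S_D S_X⁻¹
S_D)` (`minPower_eq`).

FRESH filters realize every matrix response (`exists_freshMat_eq`); scalar KL filters realize those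
that are diagonal in KL coordinates, and the optimal response is one of them. Both optimal filters
thus have the same response and the same output, and the error formulas are this one trace written
in different ways. -/

theorem cexp2pi_add (s t : ℝ) : cexp2pi (s + t) = cexp2pi s * cexp2pi t := by
  simp only [cexp2pi, ← Complex.exp_add]
  push_cast
  ring_nf

theorem conj_cexp2pi (t : ℝ) : conj (cexp2pi t) = cexp2pi (-t) := by
  have h2 : (starRingEnd ℂ) 2 = 2 := Complex.conj_ofNat 2
  simp only [cexp2pi, ← Complex.exp_conj]
  simp [h2]

theorem norm_cexp2pi (t : ℝ) : ‖cexp2pi t‖ = 1 := by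
  rw [cexp2pi, Complex.norm_exp]
  simp

theorem cexp2pi_zero : cexp2pi 0 = 1 := by simp [cexp2pi]

theorem cexp2pi_intCast (n : ℤ) : cexp2pi n = 1 := by
  rw [cexp2pi, Complex.exp_eq_one_iff]
  exact ⟨n, by push_cast; ring⟩

theorem continuous_cexp2pi : Continuous cexp2pi := by
  unfold cexp2pi
  fun_prop

/-! ### Density of trigonometric polynomials and uniqueness of Fourier coefficients -/

/-- The trigonometric polynomial with coefficients `c`. -/
def trigPoly (c : ℤ →₀ ℂ) (t : ℝ) : ℂ := c.sum fun n a => a * cexp2pi (t * n)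

theorem continuous_trigPoly (c : ℤ →₀ ℂ) : Continuous (trigPoly c) := by
  unfold trigPoly Finsupp.sum
  exact continuous_finsetSum _ fun n _ =>
    continuous_const.mul (continuous_cexp2pi.comp (continuous_id.mul continuous_const))

theorem norm_trigPoly_le (c : ℤ →₀ ℂ) (t : ℝ) : ‖trigPoly c t‖ ≤ c.sum fun _ a => ‖a‖ := by
  refine (norm_sum_le _ _).trans (Finset.sum_le_sum fun n _ => ?_)
  rw [norm_mul, norm_cexp2pi, mul_one]

/-- Trigonometric polynomials are dense in `L^p` of a finite measure on `[0, 1)`. -/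
theorem exists_trigPoly_eLpNorm_sub_le (ρ : Measure ℝ) [IsFiniteMeasure ρ]
    (hρ : ∀ᵐ t ∂ρ, t ∈ Set.Ico (0 : ℝ) 1) {p : ℝ≥0∞} [Fact (1 ≤ p)] (hp : p ≠ ∞)
    (H : ℝ → ℂ) (hH : Measurable H) (C : ℝ) (hC : ∀ t, ‖H t‖ ≤ C) {ε : ℝ≥0∞} (hε : ε ≠ 0) :
    ∃ c : ℤ →₀ ℂ, eLpNorm (fun t => H t - trigPoly c t) p ρ ≤ ε := by
  have : Fact (0 < (1 : ℝ)) := ⟨one_pos⟩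
  let ι : ℝ → AddCircle (1 : ℝ) := fun t => (t : AddCircle (1 : ℝ))
  have hι : Measurable ι := AddCircle.measurable_mk'
  let ρ' := ρ.map ι
  have : IsFiniteMeasure ρ' := inferInstance
  -- On the circle the characters span a dense subspace of the continuous functions, which are dense
  -- in `L^p` of the finite measure `ρ'`. The function and the measure are therefore carried there
  -- from the fundamental domain `[0, 1)`.
  let H' : AddCircle (1 : ℝ) → ℂ := fun x => H (AddCircle.equivIco 1 0 x)
  have hH' : Measurable H' := by
    have h := (AddCircle.measurableEquivIco (1 : ℝ) 0).measurable
    exact hH.comp (measurable_subtype_coe.comp h)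
  have hmem : MemLp H' p ρ' :=
    MemLp.of_bound hH'.aestronglyMeasurable C (Eventually.of_forall fun x => hC _)
  have hd := (ContinuousMap.toLp_denseRange (p := p) ℂ ρ' ℂ hp).topologicalClosure_map_submodule
    (span_fourier_closure_eq_top (T := (1 : ℝ)))
  have hcl : hmem.toLp H' ∈ closure (((Submodule.span ℂ (Set.range (@fourier (1 : ℝ)))).map
      (ContinuousMap.toLp p ρ' ℂ).toLinearMap : Submodule ℂ (Lp ℂ p ρ')) : Set (Lp ℂ p ρ')) := by
    rw [← Submodule.topologicalClosure_coe]
    have : hmem.toLp H' ∈ (⊤ : Submodule ℂ (Lp ℂ p ρ')) := trivial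
    rw [← hd] at this
    exact this
  obtain ⟨y, hy, hdist⟩ := EMetric.mem_closure_iff.1 hcl ε (pos_iff_ne_zero.2 hε)
  obtain ⟨f, hf, rfl⟩ := hy
  obtain ⟨c, rfl⟩ := Finsupp.mem_span_range_iff_exists_finsupp.1 hf
  refine ⟨c, le_trans (le_of_eq ?_) hdist.le⟩
  set F := c.sum fun i a => a • fourier (T := (1 : ℝ)) i
  have h1 : edist (hmem.toLp H') (ContinuousMap.toLp p ρ' ℂ F) = eLpNorm (H' - ⇑F) p ρ' := by
    rw [Lp.edist_def]
    refine eLpNorm_congr_ae ?_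
    exact hmem.coeFn_toLp.sub (ContinuousMap.coeFn_toLp ρ' F)
  change _ = edist (hmem.toLp H') (ContinuousMap.toLp p ρ' ℂ F)
  rw [h1, eLpNorm_map_measure ((hH'.sub F.continuous.measurable).aestronglyMeasurable)
    hι.aemeasurable]
  refine eLpNorm_congr_ae ?_
  filter_upwards [hρ] with t ht
  have ht' : t ∈ Set.Ico (0 : ℝ) (0 + 1) := by simpa using ht
  simp only [Function.comp, Pi.sub_apply, H', ι, AddCircle.equivIco_coe_eq ht', F, trigPoly]
  congr 1
  simp only [Finsupp.sum, ContinuousMap.coe_sum, ContinuousMap.coe_smul, Finset.sum_apply,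
    Pi.smul_apply, fourier_coe_apply, smul_eq_mul, cexp2pi]
  refine Finset.sum_congr rfl fun n _ => ?_
  push_cast
  ring_nf

/-- An integrable function on `[0, 1)` is determined by its Fourier coefficients. -/
theorem ae_eq_zero_of_fourier_eq_zero (F : ℝ → ℂ) (hF : IntegrableOn F (Set.Ico (0 : ℝ) 1))
    (h0 : ∀ n : ℤ, ∫ f in Set.Ico (0 : ℝ) 1, F f * cexp2pi (f * n) = 0) :
    F =ᵐ[volume.restrict (Set.Ico (0 : ℝ) 1)] 0 := by
  refine Integrable.ae_eq_zero_of_forall_setIntegral_eq_zero hF fun s hs _ => ?_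
  set ν := volume.restrict (Set.Ico (0 : ℝ) 1) with hν
  -- With `|F|` absorbed into the measure, approximating the indicator of `s` in `L¹(ρ)` bounds `∫ F
  -- (1_s - T)` directly; `F` itself is only integrable.
  let ρ : Measure ℝ := ν.withDensity fun t => ‖F t‖ₑ
  have : IsFiniteMeasure ρ := isFiniteMeasure_withDensity hF.2.ne
  have hρ : ∀ᵐ t ∂ρ, t ∈ Set.Ico (0 : ℝ) 1 :=
    (withDensity_absolutelyContinuous ν _).ae_le (ae_restrict_mem measurableSet_Ico)
  let H : ℝ → ℂ := s.indicator fun _ => 1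
  have hH : Measurable H := measurable_const.indicator hs
  have hHb : ∀ t, ‖H t‖ ≤ 1 := fun t => by
    by_cases ht : t ∈ s <;> simp [H, ht]
  have hFT : ∀ c : ℤ →₀ ℂ, Integrable (fun t => F t * trigPoly c t) ν := fun c =>
    Integrable.mul_bdd (c := c.sum fun _ a => ‖a‖) hF (continuous_trigPoly c).aestronglyMeasurable
      (Eventually.of_forall fun t => norm_trigPoly_le c t)
  have hFH : Integrable (fun t => F t * H t) ν :=
    Integrable.mul_bdd (c := 1) hF hH.aestronglyMeasurable (Eventually.of_forall hHb)
  have hT0 : ∀ c : ℤ →₀ ℂ, ∫ t, F t * trigPoly c t ∂ν = 0 := fun c => by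
    simp only [trigPoly, Finsupp.sum, Finset.mul_sum]
    rw [integral_finsetSum]
    · refine Finset.sum_eq_zero fun n _ => ?_
      have : ∀ t, F t * (c n * cexp2pi (t * n)) = c n * (F t * cexp2pi (t * n)) := fun t => by ring
      simp only [this]
      rw [integral_const_mul, h0, mul_zero]
    · intro n _
      refine Integrable.mul_bdd (c := ‖c n‖) hF ?_ (Eventually.of_forall fun t => ?_)
      · exact (continuous_const.mul (continuous_cexp2pi.comp
          (continuous_id.mul continuous_const))).aestronglyMeasurable
      · rw [norm_mul, norm_cexp2pi, mul_one]
  have key : ∫ t in s, F t ∂ν = ∫ t, F t * H t ∂ν := by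
    rw [← integral_indicator hs]
    congr 1 with t
    by_cases ht : t ∈ s <;> simp [H, ht]
  rw [key, ← enorm_eq_zero]
  by_contra hne
  obtain ⟨ε, hε0, hεlt⟩ := exists_between (pos_iff_ne_zero.2 hne)
  have : Fact ((1 : ℝ≥0∞) ≤ 1) := ⟨le_rfl⟩
  obtain ⟨c, hc⟩ := exists_trigPoly_eLpNorm_sub_le ρ hρ (p := 1) ENNReal.one_ne_top H hH 1 hHb
    hε0.ne'
  refine absurd hεlt (not_lt.2 ?_)
  calc ‖∫ t, F t * H t ∂ν‖ₑ = ‖∫ t, F t * (H t - trigPoly c t) ∂ν‖ₑ := by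
        simp only [mul_sub]
        rw [integral_sub hFH (hFT c), hT0, sub_zero]
    _ ≤ ∫⁻ t, ‖F t * (H t - trigPoly c t)‖ₑ ∂ν := enorm_integral_le_lintegral_enorm _
    _ = ∫⁻ t, ‖F t‖ₑ * ‖H t - trigPoly c t‖ₑ ∂ν := by simp only [enorm_mul]
    _ = eLpNorm (fun t => H t - trigPoly c t) 1 ρ := by
        rw [eLpNorm_one_eq_lintegral_enorm, lintegral_withDensity_eq_lintegral_mul₀
          hF.1.enorm (g := fun t => ‖H t - trigPoly c t‖ₑ)
          (hH.sub (continuous_trigPoly c).measurable).enorm.aemeasurable]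
        rfl
    _ ≤ ε := hc

/-! ### Discrete Fourier inversion for periodic sequences -/

theorem cexp2pi_eq_one_iff (t : ℝ) : cexp2pi t = 1 ↔ ∃ n : ℤ, t = n := by
  constructor
  · intro h
    rw [cexp2pi, Complex.exp_eq_one_iff] at h
    obtain ⟨n, hn⟩ := h
    refine ⟨n, ?_⟩
    have h2 : (2 * Real.pi * Complex.I : ℂ) ≠ 0 := by
      simp [Real.pi_ne_zero]
    have : (t : ℂ) = n := mul_left_cancel₀ h2 (by rw [hn]; ring)
    exact_mod_cast this
  · rintro ⟨n, rfl⟩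
    exact cexp2pi_intCast n

theorem cexp2pi_natCast_mul (k : ℕ) (t : ℝ) : cexp2pi (k * t) = cexp2pi t ^ k := by
  simp only [cexp2pi, ← Complex.exp_nat_mul]
  push_cast
  ring_nf

theorem cexp2pi_add_intCast (t : ℝ) (n : ℤ) : cexp2pi (t + n) = cexp2pi t := by
  rw [cexp2pi_add, cexp2pi_intCast, mul_one]

/-- Orthogonality of the characters of `ℤ / P`. -/
theorem sum_range_cexp2pi (P : ℕ) [NeZero P] (l : ℤ) :
    ∑ k ∈ Finset.range P, cexp2pi (k * (l / P)) = if (P : ℤ) ∣ l then (P : ℂ) else 0 := by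
  have hP : (P : ℝ) ≠ 0 := Nat.cast_ne_zero.2 (NeZero.ne P)
  simp only [cexp2pi_natCast_mul]
  split_ifs with h
  · obtain ⟨j, rfl⟩ := h
    have : cexp2pi ((((P : ℤ) * j : ℤ) : ℝ) / P) = 1 := by
      rw [cexp2pi_eq_one_iff]
      exact ⟨j, by push_cast; field_simp⟩
    simp only [this, one_pow, Finset.sum_const, Finset.card_range, nsmul_eq_mul, mul_one]
  · have h1 : cexp2pi ((l : ℝ) / P) ≠ 1 := by
      rw [Ne, cexp2pi_eq_one_iff]
      rintro ⟨n, hn⟩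
      refine h ⟨n, ?_⟩
      rw [div_eq_iff hP] at hn
      have : (l : ℝ) = ((P * n : ℤ) : ℝ) := by rw [hn]; push_cast; ring
      exact_mod_cast this
    rw [geom_sum_eq h1, ← cexp2pi_natCast_mul, mul_div_cancel₀ _ hP, cexp2pi_intCast]
    simp

theorem periodic_eq_of_dvd {α : Type*} {P : ℕ} {r : ℤ → α}
    (hr : ∀ n l : ℤ, r (n + l * P) = r n) {m n : ℤ} (h : (P : ℤ) ∣ m - n) : r m = r n := by
  obtain ⟨l, hl⟩ := h
  rw [← hr n l]
  congr 1
  linarith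

/-- Exactly one `j < P` is congruent to `m`. This is the delta left after summing the characters in
the inversion formula. -/
theorem sum_range_dvd_sub {α : Type*} [AddCommMonoid α] (P : ℕ) [NeZero P] (r : ℤ → α)
    (hr : ∀ n l : ℤ, r (n + l * P) = r n) (m : ℤ) :
    ∑ j ∈ Finset.range P, (if (P : ℤ) ∣ m - j then r j else 0) = r m := by
  have hP : (0 : ℤ) < P := by exact_mod_cast Nat.pos_of_ne_zero (NeZero.ne P)
  have h0 := Int.emod_nonneg m hP.ne'
  have h1 := Int.emod_lt_of_pos m hP
  rw [Finset.sum_eq_single (m % P).toNat]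
  · have hd : (P : ℤ) ∣ m - (m % P).toNat := by
      rw [Int.toNat_of_nonneg h0]
      exact Int.dvd_self_sub_emod
    rw [if_pos hd]
    exact (periodic_eq_of_dvd hr hd).symm
  · intro j hj hne
    rw [if_neg]
    intro hd
    apply hne
    have hj' : (j : ℤ) < P := by exact_mod_cast Finset.mem_range.1 hj
    have h2 : m % P = (j : ℤ) % P := Int.emod_eq_emod_iff_emod_sub_eq_zero.2
      (Int.emod_eq_zero_of_dvd hd)
    rw [Int.emod_eq_of_lt (by positivity) hj'] at h2
    rw [h2]; simp
  · intro h
    exfalso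
    apply h
    rw [Finset.mem_range]
    omega

/-- Inversion of the discrete Fourier transform of a `P`-periodic sequence. -/
theorem dft_inversion (P : ℕ) [NeZero P] (r : ℤ → ℂ) (hr : ∀ n l : ℤ, r (n + l * P) = r n)
    (m : ℤ) :
    r m = ∑ k ∈ Finset.range P, cexp2pi ((k : ℝ) * m / P) *
      ((1 / (P : ℂ)) * ∑ j ∈ Finset.range P, r j * cexp2pi (-((k : ℝ) * j / P))) := by
  have hP : (P : ℂ) ≠ 0 := Nat.cast_ne_zero.2 (NeZero.ne P)
  calc r m = ∑ j ∈ Finset.range P, (if (P : ℤ) ∣ m - j then r j else 0) :=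
        (sum_range_dvd_sub P r hr m).symm
    _ = ∑ j ∈ Finset.range P, (1 / (P : ℂ)) * r j *
          ∑ k ∈ Finset.range P, cexp2pi (k * (((m - j : ℤ) : ℝ) / P)) := by
        refine Finset.sum_congr rfl fun j _ => ?_
        rw [sum_range_cexp2pi]
        split_ifs
        · field_simp
        · simp
    _ = _ := by
        simp only [Finset.mul_sum]
        rw [Finset.sum_comm]
        refine Finset.sum_congr rfl fun k _ => Finset.sum_congr rfl fun j _ => ?_
        have : (k : ℝ) * (((m - j : ℤ) : ℝ) / P) = (k : ℝ) * m / P + -((k : ℝ) * j / P) := by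
          push_cast; ring
        rw [this, cexp2pi_add]
        ring

/-! ### Splitting `[0, 1)` into `P` sub-bands -/

theorem ae_band_shift (P : ℕ) [NeZero P] {p : ℝ → Prop}
    (h : ∀ᵐ f ∂(volume.restrict (Set.Ico (0 : ℝ) 1)), p f) (q : Fin P) :
    ∀ᵐ σ ∂(band P), p (σ + (q.val : ℝ) / P) := by
  have hP : (0 : ℝ) < P := Nat.cast_pos.2 (Nat.pos_of_ne_zero (NeZero.ne P))
  rw [ae_restrict_iff' measurableSet_Ico] at h
  rw [band, ae_restrict_iff' measurableSet_Ico]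
  have h2 := (measurePreserving_add_right (volume : Measure ℝ)
    ((q.val : ℝ) / P)).quasiMeasurePreserving.ae h
  filter_upwards [h2] with σ hσ hmem
  refine hσ ⟨add_nonneg hmem.1 (by positivity), ?_⟩
  have hq : (q.val : ℝ) + 1 ≤ P := by exact_mod_cast q.2
  calc σ + (q.val : ℝ) / P < 1 / P + q.val / P := by linarith [hmem.2]
    _ = ((q.val : ℝ) + 1) / P := by ring
    _ ≤ 1 := (div_le_one hP).2 hq

theorem integrableOn_shift (P : ℕ) [NeZero P] {F : ℝ → ℂ}
    (hF : IntegrableOn F (Set.Ico (0 : ℝ) 1)) (q : Fin P) :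
    Integrable (fun σ => F (σ + (q.val : ℝ) / P)) (band P) := by
  have hP : (0 : ℝ) < P := Nat.cast_pos.2 (Nat.pos_of_ne_zero (NeZero.ne P))
  have h1 : Integrable ((Set.Ico (0 : ℝ) 1).indicator F) := hF.integrable_indicator measurableSet_Ico
  have h2 := (h1.comp_add_right ((q.val : ℝ) / P)).mono_measure
    (Measure.restrict_le_self (s := Set.Ico (0 : ℝ) (1 / P)))
  refine h2.congr ?_
  have h3 : ∀ᵐ f ∂(volume.restrict (Set.Ico (0 : ℝ) 1)),
      (Set.Ico (0 : ℝ) 1).indicator F f = F f := by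
    filter_upwards [ae_restrict_mem measurableSet_Ico] with f hf using Set.indicator_of_mem hf F
  exact ae_band_shift P h3 q

/-- An integral over `[0, 1)` is the sum of the integrals over the `P` sub-bands. -/
theorem integral_eq_sum_band (P : ℕ) [NeZero P] {F : ℝ → ℂ}
    (hF : IntegrableOn F (Set.Ico (0 : ℝ) 1)) :
    ∫ f in Set.Ico (0 : ℝ) 1, F f = ∑ q : Fin P, ∫ σ, F (σ + (q.val : ℝ) / P) ∂(band P) := by
  have hP : (0 : ℝ) < P := Nat.cast_pos.2 (Nat.pos_of_ne_zero (NeZero.ne P))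
  have hii : IntervalIntegrable F volume 0 1 := by
    rw [intervalIntegrable_iff_integrableOn_Ico_of_le zero_le_one]; exact hF
  rw [integral_Ico_eq_integral_Ioc, ← intervalIntegral.integral_of_le zero_le_one]
  have h1 := intervalIntegral.sum_integral_adjacent_intervals (f := F) (μ := volume)
    (a := fun k : ℕ => (k : ℝ) / P) (n := P) (fun k hk => by
      refine hii.mono_set ?_
      have hk1 : (k : ℝ) + 1 ≤ P := by exact_mod_cast hk
      rw [Set.uIcc_of_le zero_le_one, Set.uIcc_of_le (by push_cast; gcongr; linarith)]
      refine Set.Icc_subset_Icc (by positivity) ?_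
      push_cast
      exact (div_le_one hP).2 hk1)
  simp only [Nat.cast_zero, zero_div, div_self hP.ne'] at h1
  rw [← h1, ← Fin.sum_univ_eq_sum_range
    (fun k => ∫ x in (k : ℝ) / P..((k + 1 : ℕ) : ℝ) / P, F x)]
  refine Finset.sum_congr rfl fun q _ => ?_
  rw [band, integral_Ico_eq_integral_Ioc, ← intervalIntegral.integral_of_le (by positivity),
    intervalIntegral.integral_comp_add_right]
  congr 1
  · simp
  · push_cast; ring

/-! ### Uniqueness and periodicity of cyclic spectra -/

namespace IsCyclicSpectrum

variable {P : ℕ} {r r' : ℤ → ℤ → ℂ} {S S' : ℤ → ℝ → ℂ}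

theorem sub (h : IsCyclicSpectrum P r S) (h' : IsCyclicSpectrum P r' S') :
    IsCyclicSpectrum P (fun n m => r n m - r' n m) (fun k f => S k f - S' k f) := by
  refine ⟨fun k => (h.1 k).sub (h'.1 k), fun k m => ?_⟩
  have hb : ∀ {F : ℝ → ℂ}, IntegrableOn F (Set.Ico (0 : ℝ) 1) →
      IntegrableOn (fun f => F f * cexp2pi (f * m)) (Set.Ico (0 : ℝ) 1) := fun hF =>
    Integrable.mul_bdd (c := 1) hF (continuous_cexp2pi.comp
      (continuous_id.mul continuous_const)).aestronglyMeasurable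
      (Eventually.of_forall fun f => (norm_cexp2pi _).le)
  simp only [sub_mul, Finset.sum_sub_distrib, mul_sub]
  rw [h.2, h'.2, integral_sub (hb (h.1 k)) (hb (h'.1 k))]

/-- The cyclic spectrum is unique up to null sets. -/
theorem ae_unique (h : IsCyclicSpectrum P r S) (h' : IsCyclicSpectrum P r' S')
    (hr : ∀ (n : ℕ) (m : ℤ), n < P → r n m = r' n m) (k : ℤ) :
    ∀ᵐ f ∂(volume.restrict (Set.Ico (0 : ℝ) 1)), S k f = S' k f := by
  have hs := h.sub h'
  have h0 := ae_eq_zero_of_fourier_eq_zero _ (hs.1 k) fun m => by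
    rw [← hs.2 k m, Finset.sum_eq_zero, mul_zero]
    intro n hn
    simp only [hr n m (Finset.mem_range.1 hn), sub_self, zero_mul]
  filter_upwards [h0] with f hf using sub_eq_zero.1 hf

/-- Adding `l P` to the cycle index changes the exponential by `exp(-2πi l n) = 1`. Together with
uniqueness this identifies spectra at congruent cycle indices, which is needed because `cycMat` uses
negative differences `r - c` while Fourier inversion runs over `0 ≤ k < P`. -/
theorem shift [NeZero P] (h : IsCyclicSpectrum P r S) (l : ℤ) :
    IsCyclicSpectrum P r (fun k => S (k + l * P)) := by
  have hP : (P : ℝ) ≠ 0 := Nat.cast_ne_zero.2 (NeZero.ne P)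
  refine ⟨fun k => h.1 _, fun k m => ?_⟩
  rw [← h.2]
  congr 1
  refine Finset.sum_congr rfl fun n _ => ?_
  congr 1
  rw [← cexp2pi_add_intCast _ (-(l * n))]
  congr 1
  push_cast
  field_simp
  ring

theorem ae_eq_of_dvd [NeZero P] (h : IsCyclicSpectrum P r S) {k k' : ℤ} (hk : (P : ℤ) ∣ k - k') :
    ∀ᵐ f ∂(volume.restrict (Set.Ico (0 : ℝ) 1)), S k f = S k' f := by
  obtain ⟨l, hl⟩ := hk
  have := (h.shift l).ae_unique h (fun _ _ _ => rfl) k'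
  have hk' : k' + l * P = k := by linarith
  simpa only [hk'] using this

theorem integrable_cycMat [NeZero P] (h : IsCyclicSpectrum P r S) (i j : Fin P) :
    Integrable (fun σ => cycMat P S σ i j) (band P) :=
  integrableOn_shift P (h.1 _) i

theorem cycMat_ae_eq [NeZero P] (h : IsCyclicSpectrum P r S) (h' : IsCyclicSpectrum P r' S')
    (hr : ∀ (n : ℕ) (m : ℤ), n < P → r n m = r' n m) :
    ∀ᵐ σ ∂(band P), cycMat P S σ = cycMat P S' σ := by
  have : ∀ i j : Fin P, ∀ᵐ σ ∂(band P), cycMat P S σ i j = cycMat P S' σ i j := fun i j =>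
    ae_band_shift P (h.ae_unique h' hr _) i
  filter_upwards [ae_all_iff.2 fun i => ae_all_iff.2 fun j => this i j] with σ hσ
  ext i j
  exact hσ i j

end IsCyclicSpectrum

/-! ### Correlations as moments of the cyclic spectral matrix -/

theorem star_clBasis (P : ℕ) (n : ℤ) (σ : ℝ) (q : Fin P) :
    star (clBasis P n σ) q = cexp2pi (-((σ + (q.val : ℝ) / (P : ℝ)) * (n : ℝ))) :=
  conj_cexp2pi _

/-- Subtraction in `Fin P` wraps around; the entries of `cycMat` are indexed by the integer
difference. -/
theorem dvd_fin_sub (P : ℕ) [NeZero P] (q c : Fin P) :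
    (P : ℤ) ∣ ((q - c : Fin P).val : ℤ) - ((q.val : ℤ) - (c.val : ℤ)) := by
  have hc := c.2
  rw [Fin.val_sub]
  push_cast [Nat.cast_sub hc.le]
  have := Int.emod_add_mul_ediv ((P : ℤ) - c.val + q.val) P
  exact ⟨1 - ((P : ℤ) - c.val + q.val) / P, by linarith⟩

/-- The correlations of two jointly cyclostationary processes are the moments of their cyclic
spectral matrix against the split Fourier basis. -/
theorem IsCyclicSpectrum.moment {P : ℕ} [NeZero P] {r : ℤ → ℤ → ℂ} {S : ℤ → ℝ → ℂ}
    (h : IsCyclicSpectrum P r S) (hr : ∀ n m l : ℤ, r (n + l * P) m = r n m) (n m : ℤ) :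
    r m (n - m) = ∫ σ, clBasis P n σ ⬝ᵥ (cycMat P S σ *ᵥ star (clBasis P m σ)) ∂(band P) := by
  have hP : (P : ℝ) ≠ 0 := Nat.cast_ne_zero.2 (NeZero.ne P)
  have hint : ∀ k : ℤ, IntegrableOn (fun f => cexp2pi ((k : ℝ) * m / P) *
      (S k f * cexp2pi (f * ((n - m : ℤ) : ℝ)))) (Set.Ico (0 : ℝ) 1) := fun k => by
    refine Integrable.const_mul ?_ _
    exact Integrable.mul_bdd (c := 1) (h.1 k) (continuous_cexp2pi.comp
      (continuous_id.mul continuous_const)).aestronglyMeasurable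
      (Eventually.of_forall fun f => (norm_cexp2pi _).le)
  -- Inversion in the time variable expresses `r` by its cyclic correlations; each is then written
  -- as a Fourier integral and split over the sub-bands.
  have h1 : r m (n - m) = ∑ k : Fin P, ∑ q : Fin P, ∫ σ, cexp2pi ((k.val : ℝ) * m / P) *
      (S (k.val : ℤ) (σ + (q.val : ℝ) / P) *
        cexp2pi ((σ + (q.val : ℝ) / P) * ((n - m : ℤ) : ℝ))) ∂(band P) := by
    rw [dft_inversion P (fun j => r j (n - m)) (fun j l => hr j (n - m) l) m,
      ← Fin.sum_univ_eq_sum_range (fun k : ℕ => cexp2pi ((k : ℝ) * m / P) *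
      ((1 / (P : ℂ)) * ∑ j ∈ Finset.range P, r j (n - m) * cexp2pi (-((k : ℝ) * j / P))))]
    refine Finset.sum_congr rfl fun k _ => ?_
    have h2 := h.2 k.val (n - m)
    rw [Int.cast_natCast] at h2
    rw [h2, ← integral_const_mul]
    have := integral_eq_sum_band P (hint k.val)
    simpa only [Int.cast_natCast] using this
  have hae : ∀ᵐ σ ∂(band P), ∀ q c : Fin P,
      S ((q - c : Fin P).val : ℤ) (σ + (q.val : ℝ) / P) =
        S ((q.val : ℤ) - (c.val : ℤ)) (σ + (q.val : ℝ) / P) := by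
    refine ae_all_iff.2 fun q => ae_all_iff.2 fun c => ae_band_shift P (h.ae_eq_of_dvd ?_) q
    exact dvd_fin_sub P q c
  have hterm : ∀ k q : Fin P, Integrable (fun σ => cexp2pi ((k.val : ℝ) * m / P) *
      (S (k.val : ℤ) (σ + (q.val : ℝ) / P) *
        cexp2pi ((σ + (q.val : ℝ) / P) * ((n - m : ℤ) : ℝ)))) (band P) := fun k q => by
    simpa only [Int.cast_natCast] using integrableOn_shift P (hint k.val) q
  rw [h1, Finset.sum_comm]
  -- In row `q` the substitution `k = q - c` turns the sum over cycle frequencies into a sum over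
  -- columns `c`.
  have h3 : ∀ q : Fin P, ∑ k : Fin P, ∫ σ, cexp2pi ((k.val : ℝ) * m / P) *
      (S (k.val : ℤ) (σ + (q.val : ℝ) / P) *
        cexp2pi ((σ + (q.val : ℝ) / P) * ((n - m : ℤ) : ℝ))) ∂(band P)
      = ∫ σ, ∑ c : Fin P, cexp2pi (((q - c : Fin P).val : ℝ) * m / P) *
      (S ((q - c : Fin P).val : ℤ) (σ + (q.val : ℝ) / P) *
        cexp2pi ((σ + (q.val : ℝ) / P) * ((n - m : ℤ) : ℝ))) ∂(band P) := fun q => by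
    rw [integral_finsetSum _ fun c _ => hterm (q - c) q]
    exact (Equiv.sum_comp (Equiv.subLeft q) (fun k : Fin P => ∫ σ, cexp2pi ((k.val : ℝ) * m / P) *
      (S (k.val : ℤ) (σ + (q.val : ℝ) / P) *
        cexp2pi ((σ + (q.val : ℝ) / P) * ((n - m : ℤ) : ℝ))) ∂(band P))).symm
  rw [Finset.sum_congr rfl fun q _ => h3 q, ← integral_finsetSum _ fun q _ =>
    integrable_finsetSum _ fun c _ => hterm (q - c) q]
  refine integral_congr_ae ?_
  filter_upwards [hae] with σ hσ
  simp only [dotProduct, Matrix.mulVec, Finset.mul_sum, star_clBasis, clBasis, cycMat,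
    Matrix.of_apply, hσ]
  refine Finset.sum_congr rfl fun q _ => Finset.sum_congr rfl fun c _ => ?_
  obtain ⟨l, hl⟩ : (P : ℤ) ∣ ((q - c : Fin P).val : ℤ) - ((q.val : ℤ) - (c.val : ℤ)) :=
    dvd_fin_sub P q c
  have hl' : ((q - c : Fin P).val : ℝ) = (q.val : ℝ) - c.val + P * l := by
    have : (((q - c : Fin P).val : ℤ) : ℝ) = (((q.val : ℤ) - (c.val : ℤ) + P * l : ℤ) : ℝ) := by
      congr 1; linarith
    push_cast at this
    exact this
  -- Modulo integers, `(q - c) m / P + (σ + q/P)(n - m) = (σ + q/P) n - (σ + c/P) m`. The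
  -- wrap-around of `q - c` contributes the integer `l m`.
  have he : cexp2pi (((q - c : Fin P).val : ℝ) * m / P) *
      cexp2pi ((σ + (q.val : ℝ) / P) * ((n - m : ℤ) : ℝ)) =
      cexp2pi ((σ + (q.val : ℝ) / P) * n) * cexp2pi (-((σ + (c.val : ℝ) / P) * m)) := by
    rw [← cexp2pi_add, ← cexp2pi_add, ← cexp2pi_add_intCast _ (-(l * m))]
    congr 1
    rw [hl']
    push_cast
    field_simp
    ring
  calc _ = S ((q.val : ℤ) - (c.val : ℤ)) (σ + (q.val : ℝ) / P) *
      (cexp2pi (((q - c : Fin P).val : ℝ) * m / P) *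
      cexp2pi ((σ + (q.val : ℝ) / P) * ((n - m : ℤ) : ℝ))) := by ring
    _ = _ := by rw [he]; ring

/-! ### Vector trigonometric polynomials in weighted spaces -/

instance isFiniteMeasure_band (P : ℕ) : IsFiniteMeasure (band P) := by
  unfold band
  infer_instance

/-- The vector trigonometric polynomial `∑ₙ cₙ e(n, σ)` in the split Fourier basis. -/
def trigVec (P : ℕ) (c : ℤ →₀ ℂ) (σ : ℝ) : Fin P → ℂ := c.sum fun n a => a • clBasis P n σ

theorem trigVec_apply (P : ℕ) (c : ℤ →₀ ℂ) (σ : ℝ) (q : Fin P) :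
    trigVec P c σ q = trigPoly c (σ + (q.val : ℝ) / P) := by
  simp [trigVec, trigPoly, Finsupp.sum, Finset.sum_apply, clBasis]

theorem continuous_clBasis (P : ℕ) (n : ℤ) : Continuous (clBasis P n) := by
  refine continuous_pi fun q => ?_
  exact continuous_cexp2pi.comp (by fun_prop)

theorem norm_clBasis_le (P : ℕ) (n : ℤ) (σ : ℝ) : ‖clBasis P n σ‖ ≤ 1 :=
  (pi_norm_le_iff_of_nonneg zero_le_one).2 fun _ => (norm_cexp2pi _).le

theorem continuous_trigVec (P : ℕ) (c : ℤ →₀ ℂ) : Continuous (trigVec P c) := by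
  refine continuous_pi fun q => ?_
  simp only [trigVec_apply]
  exact (continuous_trigPoly c).comp (by fun_prop)

theorem norm_trigVec_le (P : ℕ) (c : ℤ →₀ ℂ) (σ : ℝ) :
    ‖trigVec P c σ‖ ≤ c.sum fun _ a => ‖a‖ := by
  refine (pi_norm_le_iff_of_nonneg (Finset.sum_nonneg fun _ _ => norm_nonneg _)).2 fun q => ?_
  rw [trigVec_apply]
  exact norm_trigPoly_le c _

theorem eLpNorm_two_sq {α E : Type*} [MeasurableSpace α] [NormedAddCommGroup E] (μ : Measure α)
    (f : α → E) : eLpNorm f 2 μ ^ 2 = ∫⁻ x, ‖f x‖ₑ ^ 2 ∂μ := by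
  have h := eLpNorm_nnreal_pow_eq_lintegral (f := f) (μ := μ) (p := 2) two_ne_zero
  simp only [NNReal.coe_ofNat, ENNReal.coe_ofNat] at h
  exact_mod_cast h

/-- A vector function on the sub-band comes from a scalar function on the band. -/
theorem sum_indicator_subband {P : ℕ} [NeZero P] (h : ℝ → Fin P → ℂ) {σ : ℝ}
    (hσ : σ ∈ Set.Ico (0 : ℝ) (1 / P)) (q : Fin P) :
    ∑ j : Fin P, (Set.Ico (0 : ℝ) (1 / P)).indicator (fun s => h s j)
      (σ + (q.val : ℝ) / P - (j.val : ℝ) / P) = h σ q := by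
  have hP : (0 : ℝ) < P := Nat.cast_pos.2 (Nat.pos_of_ne_zero (NeZero.ne P))
  rw [Finset.sum_eq_single q]
  · rw [add_sub_cancel_right, Set.indicator_of_mem hσ]
  · intro j _ hj
    refine Set.indicator_of_notMem (fun hmem => hj ?_) _
    have h1 : (j.val : ℝ) < q.val + 1 := by
      have := hmem.1
      have h2 : (j.val : ℝ) / P < q.val / P + 1 / P := by linarith [hσ.2]
      rw [← add_div, div_lt_div_iff_of_pos_right hP] at h2
      exact h2
    have h2 : (q.val : ℝ) < j.val + 1 := by
      have := hmem.2
      have h2 : (q.val : ℝ) / P < j.val / P + 1 / P := by linarith [hσ.1]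
      rw [← add_div, div_lt_div_iff_of_pos_right hP] at h2
      exact h2
    ext
    have h1' : j.val < q.val + 1 := by exact_mod_cast h1
    have h2' : q.val < j.val + 1 := by exact_mod_cast h2
    omega
  · simp

/-- Bounded measurable vector functions on the sub-band are weighted `L¹` and `L²` limits of
vector trigonometric polynomials. -/
theorem exists_tendsto_trigVec (P : ℕ) [NeZero P] {w : ℝ → ℝ} (hw : Integrable w (band P))
    {h : ℝ → Fin P → ℂ} (hh : Measurable h) {C : ℝ} (hC : ∀ σ, ‖h σ‖ ≤ C) :
    ∃ c : ℕ → ℤ →₀ ℂ,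
      Tendsto (fun k => ∫⁻ σ, ‖w σ‖ₑ * ‖h σ - trigVec P (c k) σ‖ₑ ∂(band P)) atTop (𝓝 0) ∧
      Tendsto (fun k => ∫⁻ σ, ‖w σ‖ₑ * ‖h σ - trigVec P (c k) σ‖ₑ ^ 2 ∂(band P))
        atTop (𝓝 0) := by
  have hP : (0 : ℝ) < P := Nat.cast_pos.2 (Nat.pos_of_ne_zero (NeZero.ne P))
  let ν : Measure ℝ := (band P).withDensity fun σ => ‖w σ‖ₑ
  have : IsFiniteMeasure ν := isFiniteMeasure_withDensity hw.2.ne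
  -- The `P` translates of the weighted measure fill `[0, 1)`, and `H` glues the coordinates of `h`
  -- accordingly. One scalar approximation of `H` in `L²(ρ)` then approximates all coordinates with
  -- the same coefficients.
  let ρ : Measure ℝ := ∑ q : Fin P, ν.map (fun σ => σ + (q.val : ℝ) / P)
  have hν : ∀ᵐ σ ∂ν, σ ∈ Set.Ico (0 : ℝ) (1 / P) :=
    (withDensity_absolutelyContinuous _ _).ae_le (ae_restrict_mem measurableSet_Ico)
  have hρfin : IsFiniteMeasure ρ := by
    have (q : Fin P) : IsFiniteMeasure (ν.map (fun σ => σ + (q.val : ℝ) / P)) := inferInstance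
    infer_instance
  have hρ : ∀ᵐ t ∂ρ, t ∈ Set.Ico (0 : ℝ) 1 := by
    rw [ae_iff, Measure.finsetSum_apply]
    refine Finset.sum_eq_zero fun q _ => ?_
    rw [← ae_iff]
    refine (ae_map_iff (p := fun t : ℝ => t ∈ Set.Ico (0 : ℝ) 1)
      (measurable_id.add_const _).aemeasurable measurableSet_Ico).2 ?_
    filter_upwards [hν] with σ hσ
    refine ⟨add_nonneg hσ.1 (by positivity), ?_⟩
    have hq : (q.val : ℝ) + 1 ≤ P := by exact_mod_cast q.2
    calc σ + (q.val : ℝ) / P < 1 / P + q.val / P := by linarith [hσ.2]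
      _ = ((q.val : ℝ) + 1) / P := by ring
      _ ≤ 1 := (div_le_one hP).2 hq
  let I : Set ℝ := Set.Ico (0 : ℝ) (1 / P)
  let H : ℝ → ℂ := fun t => ∑ q : Fin P, I.indicator (fun σ => h σ q) (t - (q.val : ℝ) / P)
  have hH : Measurable H := by
    refine Finset.measurable_fun_sum _ fun q _ => ?_
    exact (((measurable_pi_apply q).comp hh).indicator measurableSet_Ico).comp
      (measurable_id.sub_const _)
  have hHb : ∀ t, ‖H t‖ ≤ P * C := fun t => by
    have hC0 : 0 ≤ C := (norm_nonneg _).trans (hC 0)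
    refine (norm_sum_le _ _).trans ?_
    calc _ ≤ ∑ _q : Fin P, C := Finset.sum_le_sum fun q _ => ?_
      _ = P * C := by simp
    refine (norm_indicator_le_norm_self _ _).trans ((norm_le_pi_norm _ q).trans (hC _))
  have hHeq : ∀ σ ∈ I, ∀ q : Fin P, H (σ + (q.val : ℝ) / P) = h σ q := fun σ hσ q =>
    sum_indicator_subband h hσ q
  have : Fact ((1 : ℝ≥0∞) ≤ 2) := ⟨one_le_two⟩
  have hex : ∀ k : ℕ, ∃ c : ℤ →₀ ℂ,
      eLpNorm (fun t => H t - trigPoly c t) 2 ρ ≤ ((k : ℝ≥0∞))⁻¹ := fun k =>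
    exists_trigPoly_eLpNorm_sub_le ρ hρ (by simp) H hH _ hHb (by simp)
  choose c hc using hex
  have hD : ∀ k, Measurable fun t => H t - trigPoly (c k) t := fun k =>
    hH.sub (continuous_trigPoly _).measurable
  have h2 : Tendsto (fun k => eLpNorm (fun t => H t - trigPoly (c k) t) 2 ρ) atTop (𝓝 0) :=
    tendsto_of_tendsto_of_tendsto_of_le_of_le tendsto_const_nhds
      ENNReal.tendsto_inv_nat_nhds_zero (fun _ => zero_le) hc
  have hle : ∀ (k j : ℕ), ∫⁻ σ, ‖w σ‖ₑ * ‖h σ - trigVec P (c k) σ‖ₑ ^ j ∂(band P)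
      ≤ ∫⁻ t, ‖H t - trigPoly (c k) t‖ₑ ^ j ∂ρ := fun k j => by
    have hm : AEMeasurable (fun σ => ‖h σ - trigVec P (c k) σ‖ₑ ^ j) (band P) :=
      ((hh.sub (continuous_trigVec P _).measurable).enorm.pow_const j).aemeasurable
    have e1 : ∫⁻ σ, ‖w σ‖ₑ * ‖h σ - trigVec P (c k) σ‖ₑ ^ j ∂(band P)
        = ∫⁻ σ, ‖h σ - trigVec P (c k) σ‖ₑ ^ j ∂ν :=
      (lintegral_withDensity_eq_lintegral_mul₀ hw.1.enorm hm).symm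
    rw [e1, lintegral_finsetSum_measure]
    have e2 : ∀ q : Fin P, ∫⁻ t, ‖H t - trigPoly (c k) t‖ₑ ^ j ∂(ν.map fun σ => σ + (q.val : ℝ) / P)
        = ∫⁻ σ, ‖h σ q - trigVec P (c k) σ q‖ₑ ^ j ∂ν := fun q => by
      rw [lintegral_map ((hD k).enorm.pow_const j) (by fun_prop)]
      refine lintegral_congr_ae ?_
      filter_upwards [hν] with σ hσ
      rw [hHeq σ hσ q, trigVec_apply]
    simp only [e2]
    rw [← lintegral_finsetSum _ fun q _ => ?_]
    · refine lintegral_mono fun σ => ?_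
      -- The norm on `Fin P → ℂ` is the supremum norm, so it equals one coordinate and is at most
      -- the sum over all of them.
      obtain ⟨q, hq⟩ : ∃ q, ‖h σ - trigVec P (c k) σ‖ = ‖(h σ - trigVec P (c k) σ) q‖ := by
        obtain ⟨q, hq⟩ := Finite.exists_max fun q => ‖(h σ - trigVec P (c k) σ) q‖
        exact ⟨q, le_antisymm ((pi_norm_le_iff_of_nonneg (norm_nonneg _)).2 hq)
          (norm_le_pi_norm _ q)⟩
      have hq' : ‖h σ - trigVec P (c k) σ‖ₑ = ‖h σ q - trigVec P (c k) σ q‖ₑ := by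
        rw [← ofReal_norm, hq, ofReal_norm]
        rfl
      rw [hq']
      exact Finset.single_le_sum (f := fun q => ‖h σ q - trigVec P (c k) σ q‖ₑ ^ j)
        (fun _ _ => zero_le) (Finset.mem_univ q)
    · have := ((measurable_pi_apply q).comp (hh.sub (continuous_trigVec P (c k)).measurable))
      exact this.enorm.pow_const j
  refine ⟨c, ?_, ?_⟩
  -- Since `ρ` is finite, `L²(ρ)` convergence implies `L¹(ρ)` convergence.
  · have h1 : Tendsto (fun k => eLpNorm (fun t => H t - trigPoly (c k) t) 2 ρ *
        ρ Set.univ ^ (1 / (1 : ℝ≥0∞).toReal - 1 / (2 : ℝ≥0∞).toReal)) atTop (𝓝 0) := by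
      rw [← zero_mul (ρ Set.univ ^ (1 / (1 : ℝ≥0∞).toReal - 1 / (2 : ℝ≥0∞).toReal))]
      refine ENNReal.Tendsto.mul_const h2 (Or.inr ?_)
      exact ENNReal.rpow_ne_top_of_nonneg (by norm_num) (measure_ne_top _ _)
    refine tendsto_of_tendsto_of_tendsto_of_le_of_le tendsto_const_nhds h1
      (fun _ => zero_le) fun k => ?_
    have := hle k 1
    simp only [pow_one] at this
    refine this.trans ?_
    rw [← eLpNorm_one_eq_lintegral_enorm]
    exact eLpNorm_le_eLpNorm_mul_rpow_measure_univ one_le_two (hD k).aestronglyMeasurable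
  · have h3 : Tendsto (fun k => eLpNorm (fun t => H t - trigPoly (c k) t) 2 ρ ^ 2) atTop (𝓝 0) := by
      have := ENNReal.Tendsto.pow (n := 2) h2
      simpa using this
    refine tendsto_of_tendsto_of_tendsto_of_le_of_le tendsto_const_nhds h3
      (fun _ => zero_le) fun k => ?_
    change _ ≤ eLpNorm (fun t => H t - trigPoly (c k) t) 2 ρ ^ 2
    rw [eLpNorm_two_sq]
    exact hle k 2

/-! ### Positivity of spectral matrices from their moments -/

/-- The sum of the moduli of the entries of a matrix. -/
def entrySum {P : ℕ} (K : Matrix (Fin P) (Fin P) ℂ) : ℝ := ∑ i, ∑ j, ‖K i j‖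

theorem entrySum_nonneg {P : ℕ} (K : Matrix (Fin P) (Fin P) ℂ) : 0 ≤ entrySum K :=
  Finset.sum_nonneg fun _ _ => Finset.sum_nonneg fun _ _ => norm_nonneg _

/-- `entrySum` serves as a scalar weight dominating the form, so that approximation in scalar
weighted spaces controls matrix-weighted integrals. -/
theorem norm_dotProduct_mulVec_le {P : ℕ} (K : Matrix (Fin P) (Fin P) ℂ) (u v : Fin P → ℂ) :
    ‖u ⬝ᵥ (K *ᵥ star v)‖ ≤ entrySum K * (‖u‖ * ‖v‖) := by
  simp only [dotProduct, Matrix.mulVec, Finset.mul_sum, entrySum, Finset.sum_mul]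
  refine (norm_sum_le _ _).trans (Finset.sum_le_sum fun i _ => (norm_sum_le _ _).trans
    (Finset.sum_le_sum fun j _ => ?_))
  rw [norm_mul, norm_mul, Pi.star_apply, norm_star]
  calc ‖u i‖ * (‖K i j‖ * ‖v j‖) = ‖K i j‖ * (‖u i‖ * ‖v j‖) := by ring
    _ ≤ _ := by gcongr <;> exact norm_le_pi_norm _ _

theorem integrable_entrySum {P : ℕ} {K : ℝ → Matrix (Fin P) (Fin P) ℂ}
    (hK : ∀ i j, Integrable (fun σ => K σ i j) (band P)) :
    Integrable (fun σ => entrySum (K σ)) (band P) :=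
  integrable_finsetSum _ fun i _ => integrable_finsetSum _ fun j _ => (hK i j).norm

theorem aestronglyMeasurable_dotProduct_mulVec {P : ℕ} {K : ℝ → Matrix (Fin P) (Fin P) ℂ}
    (hK : ∀ i j, AEStronglyMeasurable (fun σ => K σ i j) (band P)) {u v : ℝ → Fin P → ℂ}
    (hu : AEStronglyMeasurable u (band P)) (hv : AEStronglyMeasurable v (band P)) :
    AEStronglyMeasurable (fun σ => u σ ⬝ᵥ (K σ *ᵥ star (v σ))) (band P) := by
  have hu' (i) : AEStronglyMeasurable (fun σ => u σ i) (band P) :=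
    (continuous_apply i).comp_aestronglyMeasurable hu
  have hv' (i) : AEStronglyMeasurable (fun σ => v σ i) (band P) :=
    (continuous_apply i).comp_aestronglyMeasurable hv
  simp only [dotProduct, Matrix.mulVec, Pi.star_apply]
  refine Finset.aestronglyMeasurable_fun_sum _ fun i _ => (hu' i).mul ?_
  exact Finset.aestronglyMeasurable_fun_sum _ fun j _ => (hK i j).mul
    (continuous_star.comp_aestronglyMeasurable (hv' j))

theorem integrable_dotProduct_mulVec {P : ℕ} {K : ℝ → Matrix (Fin P) (Fin P) ℂ}
    (hK : ∀ i j, Integrable (fun σ => K σ i j) (band P)) {u v : ℝ → Fin P → ℂ}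
    (hu : AEStronglyMeasurable u (band P)) (hv : AEStronglyMeasurable v (band P)) {A B : ℝ}
    (hA : ∀ᵐ σ ∂(band P), ‖u σ‖ ≤ A) (hB : ∀ᵐ σ ∂(band P), ‖v σ‖ ≤ B) :
    Integrable (fun σ => u σ ⬝ᵥ (K σ *ᵥ star (v σ))) (band P) := by
  refine ((integrable_entrySum hK).mul_const (A * B)).mono'
    (aestronglyMeasurable_dotProduct_mulVec (fun i j => (hK i j).1) hu hv) ?_
  filter_upwards [hA, hB] with σ h1 h2
  refine (norm_dotProduct_mulVec_le _ _ _).trans ?_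
  refine mul_le_mul_of_nonneg_left ?_ (entrySum_nonneg _)
  exact mul_le_mul h1 h2 (norm_nonneg _) ((norm_nonneg _).trans h1)

/-- A complex matrix whose Hermitian form is nonnegative is positive semidefinite. -/
theorem posSemidef_of_form_nonneg {P : ℕ} {K : Matrix (Fin P) (Fin P) ℂ}
    (h : ∀ v : Fin P → ℂ, 0 ≤ (v ⬝ᵥ (K *ᵥ star v)).re ∧ (v ⬝ᵥ (K *ᵥ star v)).im = 0) :
    K.PosSemidef := by
  have h' : ∀ v : Fin P → ℂ, 0 ≤ (star v ⬝ᵥ (K *ᵥ v)).re ∧ (star v ⬝ᵥ (K *ᵥ v)).im = 0 := fun v => by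
    simpa using h (star v)
  -- Over `ℂ`, a quadratic form with real values comes from a Hermitian matrix.
  refine Matrix.PosSemidef.of_dotProduct_mulVec_nonneg ?_ fun x => ?_
  · rw [← Matrix.isSymmetric_toEuclideanLin_iff, LinearMap.isSymmetric_iff_inner_map_self_real]
    intro v
    have hv := (h' (WithLp.ofLp v)).2
    rw [Complex.conj_eq_iff_im, ← inner_conj_symm, Complex.conj_im, neg_eq_zero,
      EuclideanSpace.inner_eq_star_dotProduct, dotProduct_comm]
    exact hv
  · rw [Complex.nonneg_iff]
    exact ⟨(h' x).1, (h' x).2.symm⟩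

/-- If a matrix function has nonnegative moments against all vector trigonometric polynomials,
then it is positive semidefinite almost everywhere. -/
theorem ae_posSemidef_of_moments {P : ℕ} [NeZero P] {K : ℝ → Matrix (Fin P) (Fin P) ℂ}
    (hK : ∀ i j, Integrable (fun σ => K σ i j) (band P))
    (h : ∀ c : ℤ →₀ ℂ,
      0 ≤ (∫ σ, trigVec P c σ ⬝ᵥ (K σ *ᵥ star (trigVec P c σ)) ∂(band P)).re ∧
      (∫ σ, trigVec P c σ ⬝ᵥ (K σ *ᵥ star (trigVec P c σ)) ∂(band P)).im = 0) :
    ∀ᵐ σ ∂(band P), (K σ).PosSemidef := by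
  have hw := integrable_entrySum hK
  have hset : ∀ (v : Fin P → ℂ) (A : Set ℝ), MeasurableSet A →
      0 ≤ (∫ σ in A, v ⬝ᵥ (K σ *ᵥ star v) ∂(band P)).re ∧
        (∫ σ in A, v ⬝ᵥ (K σ *ᵥ star v) ∂(band P)).im = 0 := fun v A hA => by
    -- Localizing: the moment of `v 1_A` is the integral of the form at `v` over `A`, and it is a
    -- limit of moments of trigonometric polynomials.
    let g : ℝ → Fin P → ℂ := A.indicator fun _ => v
    have hg : Measurable g := measurable_const.indicator hA
    have hgb : ∀ σ, ‖g σ‖ ≤ ‖v‖ := fun σ => norm_indicator_le_norm_self _ σ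
    obtain ⟨c, hc1, hc2⟩ := exists_tendsto_trigVec P hw hg hgb
    have hlim : Tendsto (fun k => ∫ σ, trigVec P (c k) σ ⬝ᵥ (K σ *ᵥ star (trigVec P (c k) σ))
        ∂(band P)) atTop (𝓝 (∫ σ, g σ ⬝ᵥ (K σ *ᵥ star (g σ)) ∂(band P))) := by
      refine tendsto_integral_of_L1 _
        (aestronglyMeasurable_dotProduct_mulVec (fun i j => (hK i j).1) hg.aestronglyMeasurable
          hg.aestronglyMeasurable) ?_ ?_
      · refine Eventually.of_forall fun k => integrable_dotProduct_mulVec hK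
          (continuous_trigVec P _).aestronglyMeasurable
          (continuous_trigVec P _).aestronglyMeasurable
          (Eventually.of_forall fun σ => norm_trigVec_le P _ σ)
          (Eventually.of_forall fun σ => norm_trigVec_le P _ σ)
      -- Expanding about `u = g σ`, the forms at `t` and `u` differ by two cross terms, which give
      -- `2 ‖v‖` times the `L¹` error because `‖u‖ ≤ ‖v‖`, and one square term, which gives the `L²`
      -- error.
      · have hb : Tendsto (fun k => 2 * ‖v‖ₑ *
            ∫⁻ σ, ‖entrySum (K σ)‖ₑ * ‖g σ - trigVec P (c k) σ‖ₑ ∂(band P) +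
            ∫⁻ σ, ‖entrySum (K σ)‖ₑ * ‖g σ - trigVec P (c k) σ‖ₑ ^ 2 ∂(band P)) atTop (𝓝 0) := by
          have := (ENNReal.Tendsto.const_mul (a := 2 * ‖v‖ₑ) hc1 (Or.inr (by finiteness))).add hc2
          simpa using this
        refine tendsto_of_tendsto_of_tendsto_of_le_of_le tendsto_const_nhds hb
          (fun _ => zero_le) fun k => ?_
        have hwm : AEMeasurable (fun σ => ‖entrySum (K σ)‖ₑ) (band P) := hw.1.enorm
        have hdm : Measurable (fun σ => ‖g σ - trigVec P (c k) σ‖ₑ) :=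
          (hg.sub (continuous_trigVec P _).measurable).enorm
        have hm1 : AEMeasurable (fun σ => ‖entrySum (K σ)‖ₑ * ‖g σ - trigVec P (c k) σ‖ₑ)
          (band P) := hwm.mul hdm.aemeasurable
        have hm2 : AEMeasurable (fun σ => ‖entrySum (K σ)‖ₑ * ‖g σ - trigVec P (c k) σ‖ₑ ^ 2)
          (band P) := hwm.mul (hdm.pow_const 2).aemeasurable
        rw [← lintegral_const_mul'' _ hm1, ← lintegral_add_right' _ hm2]
        refine lintegral_mono fun σ => ?_
        set u := g σ
        set t := trigVec P (c k) σ
        have hreal : ‖t ⬝ᵥ (K σ *ᵥ star t) - u ⬝ᵥ (K σ *ᵥ star u)‖ ≤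
            2 * ‖v‖ * (entrySum (K σ) * ‖u - t‖) + entrySum (K σ) * ‖u - t‖ ^ 2 := by
          have e : t ⬝ᵥ (K σ *ᵥ star t) - u ⬝ᵥ (K σ *ᵥ star u) =
              (u - t) ⬝ᵥ (K σ *ᵥ star (u - t)) - u ⬝ᵥ (K σ *ᵥ star (u - t))
                - (u - t) ⬝ᵥ (K σ *ᵥ star u) := by
            simp only [star_sub, Matrix.mulVec_sub, sub_dotProduct, dotProduct_sub]
            ring
          rw [e]
          have i1 := norm_dotProduct_mulVec_le (K σ) (u - t) (u - t)
          have i2 := norm_dotProduct_mulVec_le (K σ) u (u - t)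
          have i3 := norm_dotProduct_mulVec_le (K σ) (u - t) u
          have i4 := norm_sub_le ((u - t) ⬝ᵥ (K σ *ᵥ star (u - t)) - u ⬝ᵥ (K σ *ᵥ star (u - t)))
            ((u - t) ⬝ᵥ (K σ *ᵥ star u))
          have i5 := norm_sub_le ((u - t) ⬝ᵥ (K σ *ᵥ star (u - t))) (u ⬝ᵥ (K σ *ᵥ star (u - t)))
          have hE := mul_nonneg (entrySum_nonneg (K σ)) (norm_nonneg (u - t))
          have i6 := mul_le_mul_of_nonneg_left (hgb σ) hE
          nlinarith
        rw [← ofReal_norm]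
        refine (ENNReal.ofReal_le_ofReal hreal).trans (le_of_eq ?_)
        have hE := entrySum_nonneg (K σ)
        rw [ENNReal.ofReal_add (by positivity) (by positivity), ENNReal.ofReal_mul (by positivity),
          ENNReal.ofReal_mul (by positivity), ENNReal.ofReal_mul hE, ENNReal.ofReal_mul hE,
          ENNReal.ofReal_pow (norm_nonneg _), ofReal_norm, ofReal_norm,
          Real.enorm_eq_ofReal hE]
        simp
    have heq : ∫ σ, g σ ⬝ᵥ (K σ *ᵥ star (g σ)) ∂(band P)
        = ∫ σ in A, v ⬝ᵥ (K σ *ᵥ star v) ∂(band P) := by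
      rw [← integral_indicator hA]
      congr 1 with σ
      by_cases hσ : σ ∈ A <;> simp [g, hσ]
    rw [← heq]
    constructor
    · exact ge_of_tendsto' ((Complex.continuous_re.tendsto _).comp hlim) fun k => (h (c k)).1
    · refine tendsto_nhds_unique ((Complex.continuous_im.tendsto _).comp hlim) ?_
      refine tendsto_const_nhds.congr fun k => ((h (c k)).2).symm
  have hv : ∀ v : Fin P → ℂ, ∀ᵐ σ ∂(band P),
      0 ≤ (v ⬝ᵥ (K σ *ᵥ star v)).re ∧ (v ⬝ᵥ (K σ *ᵥ star v)).im = 0 := fun v => by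
    have hi : Integrable (fun σ => v ⬝ᵥ (K σ *ᵥ star v)) (band P) :=
      integrable_dotProduct_mulVec hK aestronglyMeasurable_const aestronglyMeasurable_const
        (Eventually.of_forall fun _ => le_rfl) (Eventually.of_forall fun _ => le_rfl)
    have h1 := ae_nonneg_of_forall_setIntegral_nonneg hi.re fun A hA _ => by
      have := (hset v A hA).1
      have e := integral_re (hi.integrableOn (s := A))
      simp only [RCLike.re_to_complex] at e ⊢
      rw [e]; exact this
    have h2 := Integrable.ae_eq_zero_of_forall_setIntegral_eq_zero hi.im fun A hA _ => by
      have := (hset v A hA).2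
      have e := integral_im (hi.integrableOn (s := A))
      simp only [RCLike.im_to_complex] at e ⊢
      rw [e]; exact this
    filter_upwards [h1, h2] with σ a b using ⟨a, b⟩
  -- The exceptional null set depends on `v`. A countable dense family of vectors gives a common
  -- one, and continuity in `v` does the rest.
  have hdense : ∀ᵐ σ ∂(band P), ∀ k : ℕ,
      0 ≤ (TopologicalSpace.denseSeq (Fin P → ℂ) k ⬝ᵥ
        (K σ *ᵥ star (TopologicalSpace.denseSeq (Fin P → ℂ) k))).re ∧
      (TopologicalSpace.denseSeq (Fin P → ℂ) k ⬝ᵥ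
        (K σ *ᵥ star (TopologicalSpace.denseSeq (Fin P → ℂ) k))).im = 0 :=
    ae_all_iff.2 fun k => hv _
  filter_upwards [hdense] with σ hσ
  refine posSemidef_of_form_nonneg fun v => ?_
  have hcont : Continuous fun v : Fin P → ℂ => v ⬝ᵥ (K σ *ᵥ star v) := by
    simp only [dotProduct, Matrix.mulVec, Pi.star_apply]
    fun_prop
  have hcl : IsClosed {v : Fin P → ℂ | 0 ≤ (v ⬝ᵥ (K σ *ᵥ star v)).re ∧
      (v ⬝ᵥ (K σ *ᵥ star v)).im = 0} :=
    (isClosed_le continuous_const (Complex.continuous_re.comp hcont)).inter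
      (isClosed_eq (Complex.continuous_im.comp hcont) continuous_const)
  exact hcl.closure_subset_iff.2 (Set.range_subset_iff.2 hσ)
    (TopologicalSpace.denseRange_denseSeq _ v)

/-! ### Hermitian forms and a bound on inverses -/

section LinearAlgebra

variable {P : ℕ}

/-- The Hermitian form `Re ∑_{r,c} u_r K_{r,c} u_c^*`. -/
def quad (K : Matrix (Fin P) (Fin P) ℂ) (u : Fin P → ℂ) : ℝ := (u ⬝ᵥ (K *ᵥ star u)).re

theorem star_form (K : Matrix (Fin P) (Fin P) ℂ) (u v : Fin P → ℂ) :
    star (u ⬝ᵥ (K *ᵥ star v)) = v ⬝ᵥ (Kᴴ *ᵥ star u) := by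
  rw [← Matrix.star_dotProduct_star, Matrix.star_mulVec, star_star, ← Matrix.dotProduct_mulVec]

theorem re_form_comm {K : Matrix (Fin P) (Fin P) ℂ} (hK : K.IsHermitian) (u v : Fin P → ℂ) :
    (u ⬝ᵥ (K *ᵥ star v)).re = (v ⬝ᵥ (K *ᵥ star u)).re := by
  have h := congrArg Complex.re (star_form K u v)
  rw [hK.eq] at h
  simpa using h

theorem quad_nonneg {K : Matrix (Fin P) (Fin P) ℂ} (hK : K.PosSemidef) (u : Fin P → ℂ) :
    0 ≤ quad K u := by
  have := hK.re_dotProduct_nonneg (star u)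
  simpa [quad] using this

theorem quad_sub {K : Matrix (Fin P) (Fin P) ℂ} (hK : K.IsHermitian) (u v : Fin P → ℂ) :
    quad K (u - v) = quad K u - 2 * (u ⬝ᵥ (K *ᵥ star v)).re + quad K v := by
  have h := re_form_comm hK u v
  simp only [quad, star_sub, Matrix.mulVec_sub, sub_dotProduct, dotProduct_sub, Complex.sub_re]
  linarith

theorem quad_sub_matrix (K L : Matrix (Fin P) (Fin P) ℂ) (u : Fin P → ℂ) :
    quad (K - L) u = quad K u - quad L u := by
  simp [quad, Matrix.sub_mulVec, dotProduct_sub]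

theorem quad_smul_one (p : ℝ) (u : Fin P → ℂ) :
    quad ((p : ℂ) • (1 : Matrix (Fin P) (Fin P) ℂ)) u = p * ∑ i, ‖u i‖ ^ 2 := by
  rw [quad, Matrix.smul_mulVec, Matrix.one_mulVec, dotProduct_smul, smul_eq_mul,
    Complex.re_ofReal_mul, dotProduct, Complex.re_sum]
  congr 1
  refine Finset.sum_congr rfl fun i _ => ?_
  rw [Pi.star_apply, ← starRingEnd_apply, Complex.mul_conj, Complex.ofReal_re,
    Complex.normSq_eq_norm_sq]

theorem quad_zero (K : Matrix (Fin P) (Fin P) ℂ) : quad K 0 = 0 := by simp [quad]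

theorem quad_neg (K : Matrix (Fin P) (Fin P) ℂ) (u : Fin P → ℂ) : quad K (-u) = quad K u := by
  simp [quad, Matrix.mulVec_neg]

theorem quad_smul (K : Matrix (Fin P) (Fin P) ℂ) (a : ℂ) (u : Fin P → ℂ) :
    quad K (a • u) = ‖a‖ ^ 2 * quad K u := by
  have : a * star a = ((‖a‖ ^ 2 : ℝ) : ℂ) := by
    rw [← starRingEnd_apply, Complex.mul_conj, Complex.normSq_eq_norm_sq]
  rw [quad, star_smul, Matrix.mulVec_smul, smul_dotProduct, dotProduct_smul, smul_smul, this,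
    smul_eq_mul, Complex.re_ofReal_mul, quad]

theorem quad_eq_zero {K : Matrix (Fin P) (Fin P) ℂ} (hK : K.PosDef) {u : Fin P → ℂ}
    (h : quad K u = 0) : u = 0 := by
  by_contra hu
  have hu' : star u ≠ 0 := fun h => hu (star_eq_zero.1 h)
  have := hK.re_dotProduct_pos hu'
  simp only [star_star] at this
  exact this.ne' h

open scoped MatrixOrder in
theorem exists_eq_conjTranspose_mul_self {K : Matrix (Fin P) (Fin P) ℂ} (hK : K.PosSemidef) :
    ∃ B : Matrix (Fin P) (Fin P) ℂ, K = Bᴴ * B :=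
  CStarAlgebra.nonneg_iff_eq_star_mul_self.mp hK.nonneg

/-- The triangle inequality for the seminorm of a positive semidefinite matrix. -/
theorem sqrt_quad_add_le {K : Matrix (Fin P) (Fin P) ℂ} (hK : K.PosSemidef) (u v : Fin P → ℂ) :
    √(quad K (u + v)) ≤ √(quad K u) + √(quad K v) := by
  -- For `K = Bᴴ B`, `√(quad K u)` is the Euclidean norm of `B *ᵥ star u`.
  obtain ⟨B, rfl⟩ := exists_eq_conjTranspose_mul_self hK
  have h : ∀ u : Fin P → ℂ, √(quad (Bᴴ * B) u) = ‖WithLp.toLp 2 (B *ᵥ star u)‖ := fun u => by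
    rw [EuclideanSpace.norm_eq]
    congr 1
    rw [quad, ← Matrix.mulVec_mulVec, Matrix.dotProduct_mulVec, Matrix.vecMul_conjTranspose,
      dotProduct, Complex.re_sum]
    refine Finset.sum_congr rfl fun i _ => ?_
    rw [Pi.star_apply, mul_comm, Complex.star_def, Complex.mul_conj, Complex.ofReal_re,
      Complex.normSq_eq_norm_sq]
  rw [h, h, h, star_add, Matrix.mulVec_add, WithLp.toLp_add]
  exact norm_add_le _ _

theorem posDef_of_sub_posSemidef {X : Matrix (Fin P) (Fin P) ℂ} {p : ℝ} (hp : 0 < p)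
    (hX : (X - (p : ℂ) • 1).PosSemidef) : X.PosDef := by
  have h1 : ((p : ℂ) • (1 : Matrix (Fin P) (Fin P) ℂ)).PosDef :=
    Matrix.PosDef.one.smul (by exact_mod_cast hp)
  have := h1.add_posSemidef hX
  rwa [add_sub_cancel] at this

/-- Let `v` be column `j` of `X⁻¹`, so `X v` is the `j`-th unit vector. Then `X ≥ p` gives `p ∑
|vᵢ|² ≤ Re (star vⱼ) ≤ |vⱼ|`. Coordinate `j` yields `p |vⱼ| ≤ 1`, hence `(p |vᵢ|)² ≤ p |vⱼ| ≤ 1`.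
Only the lower bound on `X` enters, so the estimate is uniform in `σ`. -/
theorem norm_inv_apply_le {X : Matrix (Fin P) (Fin P) ℂ} {p : ℝ} (hp : 0 < p)
    (hX : (X - (p : ℂ) • 1).PosSemidef) (i j : Fin P) : ‖X⁻¹ i j‖ ≤ p⁻¹ := by
  have hdet := (Matrix.isUnit_iff_isUnit_det _).1 (posDef_of_sub_posSemidef hp hX).isUnit
  set v : Fin P → ℂ := X⁻¹ *ᵥ Pi.single j 1 with hv
  have hXv : X *ᵥ v = Pi.single j 1 := by
    rw [hv, Matrix.mulVec_mulVec, Matrix.mul_nonsing_inv _ hdet, Matrix.one_mulVec]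
  have h0 := quad_nonneg hX (star v)
  rw [quad_sub_matrix, quad_smul_one, quad, star_star, hXv, dotProduct_single, mul_one] at h0
  have hvi : ∀ i, X⁻¹ i j = v i := fun i => by simp [hv]
  have h1 : ∀ i, ‖v i‖ ^ 2 ≤ ∑ i, ‖(star v) i‖ ^ 2 := fun i => by
    have := Finset.single_le_sum (f := fun i => ‖(star v) i‖ ^ 2) (fun _ _ => by positivity)
      (Finset.mem_univ i)
    simpa using this
  have h2 : (star v j).re ≤ ‖v j‖ := by
    have := Complex.re_le_norm (star v j)
    rwa [Pi.star_apply, norm_star] at this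
  simp only [Pi.star_apply, norm_star] at h0
  have h3 : ∀ i, p * ‖v i‖ ^ 2 ≤ ‖v j‖ := fun i => by
    have := mul_le_mul_of_nonneg_left (h1 i) hp.le
    simp only [Pi.star_apply, norm_star] at this
    rw [Pi.star_apply] at h2
    linarith
  have h4 : p * ‖v j‖ ≤ 1 := by
    rcases eq_or_lt_of_le (norm_nonneg (v j)) with h | h
    · rw [← h]; simp
    · have := h3 j
      by_contra hc
      push Not at hc
      nlinarith
  rw [hvi, ← one_div, le_div_iff₀ hp]
  by_contra hc
  push Not at hc
  have h5 := h3 i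
  have h6 : 1 < p * ‖v i‖ := by linarith
  have h7 : p * (p * ‖v i‖ ^ 2) ≤ p * ‖v j‖ := mul_le_mul_of_nonneg_left h5 hp.le
  nlinarith

end LinearAlgebra

/-! ### Pointwise Wiener theory when one component is white -/

/-- The spectral matrices of a signal and of an observation, the signal being uncorrelated with
the noise, when one of signal and noise is white of power `p`. -/
structure IsWhitePair {P : ℕ} (p : ℝ) (A X : Matrix (Fin P) (Fin P) ℂ) : Prop where
  pos : 0 < p
  posSemidef : A.PosSemidef
  sub_posSemidef : (X - A).PosSemidef
  white : A = (p : ℂ) • 1 ∨ X - A = (p : ℂ) • 1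

namespace IsWhitePair

variable {P : ℕ} {p : ℝ} {A X : Matrix (Fin P) (Fin P) ℂ}

/-- Removing the white component from `X` leaves the other component, which is positive
semidefinite. -/
theorem sub_smul_posSemidef (h : IsWhitePair p A X) : (X - (p : ℂ) • 1).PosSemidef := by
  rcases h.white with hw | hw
  · rw [← hw]; exact h.sub_posSemidef
  · rw [← hw, sub_sub_cancel]; exact h.posSemidef

theorem posDef (h : IsWhitePair p A X) : X.PosDef :=
  posDef_of_sub_posSemidef h.pos h.sub_smul_posSemidef

theorem isUnit_det (h : IsWhitePair p A X) : IsUnit X.det :=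
  (Matrix.isUnit_iff_isUnit_det _).1 h.posDef.isUnit

theorem commute (h : IsWhitePair p A X) : Commute A X := by
  rcases h.white with hw | hw
  · rw [hw]
    exact (Commute.one_left X).smul_left _
  · have : X = A + (p : ℂ) • 1 := by rw [← hw]; abel
    rw [this]
    exact (Commute.refl A).add_right ((Commute.one_right A).smul_right _)

theorem mul_inv_comm (h : IsWhitePair p A X) : A * X⁻¹ = X⁻¹ * A := by
  have h1 : X⁻¹ * (A * X) * X⁻¹ = X⁻¹ * (X * A) * X⁻¹ := by rw [h.commute.eq]
  rw [mul_assoc, mul_assoc, Matrix.mul_nonsing_inv _ h.isUnit_det, mul_one, ← mul_assoc X⁻¹ X,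
    Matrix.nonsing_inv_mul _ h.isUnit_det, one_mul] at h1
  exact h1.symm

/-- For a white signal `A X⁻¹ = p X⁻¹`, with entries at most 1; for white noise `A X⁻¹ = 1 - p X⁻¹`,
whence the 2. This makes the Wiener response bounded, so that its output exists and the error
spectrum is integrable. -/
theorem norm_mul_inv_apply_le (h : IsWhitePair p A X) (i j : Fin P) : ‖(A * X⁻¹) i j‖ ≤ 2 := by
  have hb : ‖((p : ℂ) • X⁻¹) i j‖ ≤ 1 := by
    rw [Matrix.smul_apply, norm_smul, Complex.norm_real, Real.norm_of_nonneg h.pos.le]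
    have := mul_le_mul_of_nonneg_left (norm_inv_apply_le h.pos h.sub_smul_posSemidef i j) h.pos.le
    rwa [mul_inv_cancel₀ h.pos.ne'] at this
  rcases h.white with hw | hw
  · rw [hw, Matrix.smul_mul, one_mul]
    linarith
  · have e : A * X⁻¹ = 1 - (p : ℂ) • X⁻¹ := by
      have : A = X - (p : ℂ) • 1 := by rw [← hw]; abel
      rw [this, Matrix.sub_mul, Matrix.mul_nonsing_inv _ h.isUnit_det, Matrix.smul_mul, one_mul]
    rw [e, Matrix.sub_apply]
    refine (norm_sub_le _ _).trans ?_
    have : ‖(1 : Matrix (Fin P) (Fin P) ℂ) i j‖ ≤ 1 := by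
      rw [Matrix.one_apply]; split_ifs <;> simp
    linarith

/-- Completing the square: the error of the linear estimate `t` of the component `e` of the
signal exceeds the least error by the squared distance of `t` from the Wiener estimate. -/
theorem completing_square (h : IsWhitePair p A X) (e t : Fin P → ℂ) :
    quad A e - 2 * (e ⬝ᵥ (A *ᵥ star t)).re + quad X t =
      quad (A - A * X⁻¹ * A) e + quad X (t - (A * X⁻¹)ᵀ *ᵥ e) := by
  have hA := h.posSemidef.isHermitian
  have hX := h.posDef.isHermitian
  set g := (A * X⁻¹)ᵀ *ᵥ e with hg
  have hg' : g = e ᵥ* (A * X⁻¹) := by rw [hg, Matrix.mulVec_transpose]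
  -- The normal equations: `g` reproduces, against `X`, the correlation of the signal component with
  -- the observation.
  have h1 : ∀ v, g ⬝ᵥ (X *ᵥ v) = e ⬝ᵥ (A *ᵥ v) := fun v => by
    rw [hg', ← Matrix.dotProduct_mulVec, Matrix.mulVec_mulVec, mul_assoc,
      Matrix.nonsing_inv_mul _ h.isUnit_det, mul_one]
  have h2 : star g = (X⁻¹ * A) *ᵥ star e := by
    rw [hg', Matrix.star_vecMul, Matrix.conjTranspose_mul, Matrix.conjTranspose_nonsing_inv, hA.eq,
      hX.eq]
  rw [quad_sub hX, quad_sub_matrix, re_form_comm hX t g, h1]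
  have h3 : quad X g = quad (A * X⁻¹ * A) e := by
    rw [quad, h1, h2, Matrix.mulVec_mulVec, quad, mul_assoc]
  rw [h3]
  ring

/-- With `R = A X⁻¹`, the least error is the distortion of the signal `(1 - R) A (1 - R)ᴴ` plus the
filtered noise `R (X - A) Rᴴ`. -/
theorem sub_mul_inv_mul_posSemidef (h : IsWhitePair p A X) :
    (A - A * X⁻¹ * A).PosSemidef := by
  have hA := h.posSemidef.isHermitian
  have hX := h.posDef.isHermitian
  have h1 := h.posSemidef.mul_mul_conjTranspose_same (1 - A * X⁻¹)
  have h2 := h.sub_posSemidef.mul_mul_conjTranspose_same (A * X⁻¹)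
  have h3 := h1.add h2
  have e : (1 - A * X⁻¹) * A * (1 - A * X⁻¹)ᴴ + A * X⁻¹ * (X - A) * (A * X⁻¹)ᴴ =
      A - A * X⁻¹ * A := by
    have hc : (A * X⁻¹)ᴴ = X⁻¹ * A := by
      rw [Matrix.conjTranspose_mul, Matrix.conjTranspose_nonsing_inv, hA.eq, hX.eq]
    have hu : A * X⁻¹ * X = A := by
      rw [mul_assoc, Matrix.nonsing_inv_mul _ h.isUnit_det, mul_one]
    rw [Matrix.conjTranspose_sub, Matrix.conjTranspose_one, hc, Matrix.mul_sub (A * X⁻¹), hu]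
    noncomm_ring
  rwa [e] at h3

end IsWhitePair

/-! ### Measurability of matrix functions -/

section Measurability

variable {α : Type*} [MeasurableSpace α] {ν : Measure α} {P : ℕ}

/-- Inversion is not continuous at singular matrices, but `det⁻¹ • adjugate` is measurable
everywhere. -/
theorem aemeasurable_matrix_inv {M : α → Matrix (Fin P) (Fin P) ℂ}
    (hM : ∀ i j, AEMeasurable (fun σ => M σ i j) ν) (i j : Fin P) :
    AEMeasurable (fun σ => (M σ)⁻¹ i j) ν := by
  have hpi : AEMeasurable (fun σ => fun i j => M σ i j) ν :=
    aemeasurable_pi_iff.2 fun i => aemeasurable_pi_iff.2 fun j => hM i j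
  have hc : Continuous fun A : Fin P → Fin P → ℂ => Matrix.of A :=
    continuous_matrix fun i j => (continuous_apply j).comp (continuous_apply i)
  have hdet : Measurable fun A : Fin P → Fin P → ℂ => (Matrix.of A).det :=
    hc.matrix_det.measurable
  have hadj : Measurable fun A : Fin P → Fin P → ℂ => (Matrix.of A).adjugate i j :=
    (hc.matrix_adjugate.matrix_elem i j).measurable
  have h : Measurable fun A : Fin P → Fin P → ℂ => (Matrix.of A)⁻¹ i j := by
    simp only [Matrix.inv_def, Matrix.smul_apply, Ring.inverse_eq_inv', smul_eq_mul]
    exact hdet.inv.mul hadj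
  exact h.comp_aemeasurable hpi

theorem aemeasurable_matrix_mul {M N : α → Matrix (Fin P) (Fin P) ℂ}
    (hM : ∀ i j, AEMeasurable (fun σ => M σ i j) ν)
    (hN : ∀ i j, AEMeasurable (fun σ => N σ i j) ν) (i j : Fin P) :
    AEMeasurable (fun σ => (M σ * N σ) i j) ν := by
  simp only [Matrix.mul_apply]
  exact Finset.aemeasurable_fun_sum _ fun k _ => (hM i k).mul (hN k j)

theorem aestronglyMeasurable_mulVec {M : α → Matrix (Fin P) (Fin P) ℂ}
    (hM : ∀ i j, AEMeasurable (fun σ => M σ i j) ν) {u : α → Fin P → ℂ}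
    (hu : AEStronglyMeasurable u ν) : AEStronglyMeasurable (fun σ => M σ *ᵥ u σ) ν := by
  refine (aemeasurable_pi_iff.2 fun i => ?_).aestronglyMeasurable
  simp only [Matrix.mulVec, dotProduct]
  exact Finset.aemeasurable_fun_sum _ fun k _ =>
    (hM i k).mul (aemeasurable_pi_iff.1 hu.aemeasurable k)

theorem norm_mulVec_le {M : Matrix (Fin P) (Fin P) ℂ} {C : ℝ} (hC : 0 ≤ C)
    (hM : ∀ i j, ‖M i j‖ ≤ C) (u : Fin P → ℂ) : ‖M *ᵥ u‖ ≤ P * (C * ‖u‖) := by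
  refine (pi_norm_le_iff_of_nonneg (by positivity)).2 fun i => ?_
  refine (norm_sum_le Finset.univ fun j => M i j * u j).trans ?_
  calc ∑ j, ‖M i j * u j‖ ≤ ∑ _j : Fin P, C * ‖u‖ := Finset.sum_le_sum fun j _ => by
        rw [norm_mul]
        exact mul_le_mul (hM i j) (norm_le_pi_norm u j) (norm_nonneg _) hC
    _ = P * (C * ‖u‖) := by simp

end Measurability

/-! ### The matrix-weighted `L²` seminorm -/

/-- Convergence of a seminorm from convergence of the error. -/
theorem ENNReal.tendsto_of_le_add {a : ℝ≥0∞} {u b : ℕ → ℝ≥0∞} (h1 : ∀ k, u k ≤ a + b k)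
    (h2 : ∀ k, a ≤ u k + b k) (hb : Tendsto b atTop (𝓝 0)) : Tendsto u atTop (𝓝 a) := by
  have l1 : Tendsto (fun k => a + b k) atTop (𝓝 a) := by
    simpa using tendsto_const_nhds.add hb
  have l2 : Tendsto (fun k => a - b k) atTop (𝓝 a) := by
    simpa using ENNReal.Tendsto.sub (tendsto_const_nhds (x := a)) hb (Or.inr ENNReal.zero_ne_top)
  exact tendsto_of_tendsto_of_tendsto_of_le_of_le l2 l1
    (fun k => tsub_le_iff_right.2 (h2 k)) h1

theorem eLpNorm_two_sq_eq_ofReal {α E : Type*} [MeasurableSpace α] [NormedAddCommGroup E]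
    {μ : Measure α} {f : α → E} (hf : MemLp f 2 μ) :
    eLpNorm f 2 μ ^ 2 = ENNReal.ofReal (∫ x, ‖f x‖ ^ 2 ∂μ) := by
  rw [eLpNorm_two_sq, ofReal_integral_eq_lintegral_ofReal
    ((memLp_two_iff_integrable_sq_norm hf.1).1 hf) (Eventually.of_forall fun _ => by positivity)]
  refine lintegral_congr fun x => ?_
  rw [ENNReal.ofReal_pow (norm_nonneg _), ofReal_norm]

theorem integral_sub_two_mul_add {α : Type*} [MeasurableSpace α] {μ : Measure α} {f g k : α → ℝ}
    (hf : Integrable f μ) (hg : Integrable g μ) (hk : Integrable k μ) :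
    ∫ a, f a ∂μ - 2 * ∫ a, g a ∂μ + ∫ a, k a ∂μ = ∫ a, (f a - 2 * g a + k a) ∂μ := by
  rw [integral_add (f := fun a => f a - 2 * g a) (hf.sub (hg.const_mul 2)) hk,
    integral_sub hf (hg.const_mul 2), integral_const_mul]

section KernelNorm

variable {P : ℕ}

/-- The seminorm of `L²` with the matrix weight `K`. -/
def kernelNorm (K : ℝ → Matrix (Fin P) (Fin P) ℂ) (h : ℝ → Fin P → ℂ) : ℝ≥0∞ :=
  eLpNorm (fun σ => √(quad (K σ) (h σ))) 2 (band P)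

/-- No positivity is needed, because `√` and `ENNReal.ofReal` both send negative numbers to zero.
The right side is the quantity in `HasSpectralIntegral`. -/
theorem kernelNorm_sq (K : ℝ → Matrix (Fin P) (Fin P) ℂ) (h : ℝ → Fin P → ℂ) :
    kernelNorm K h ^ 2 = ∫⁻ σ, ENNReal.ofReal (quad (K σ) (h σ)) ∂(band P) := by
  rw [kernelNorm, eLpNorm_two_sq]
  refine lintegral_congr fun σ => ?_
  rw [← ofReal_norm, ← ENNReal.ofReal_pow (norm_nonneg _), Real.norm_eq_abs, sq_abs]
  rcases le_total 0 (quad (K σ) (h σ)) with hq | hq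
  · rw [Real.sq_sqrt hq]
  · rw [Real.sqrt_eq_zero_of_nonpos hq, ENNReal.ofReal_of_nonpos hq]
    simp

theorem aestronglyMeasurable_quad {K : ℝ → Matrix (Fin P) (Fin P) ℂ}
    (hK : ∀ i j, AEStronglyMeasurable (fun σ => K σ i j) (band P)) {u : ℝ → Fin P → ℂ}
    (hu : AEStronglyMeasurable u (band P)) :
    AEStronglyMeasurable (fun σ => quad (K σ) (u σ)) (band P) :=
  Complex.continuous_re.comp_aestronglyMeasurable (aestronglyMeasurable_dotProduct_mulVec hK hu hu)

theorem integrable_quad {K : ℝ → Matrix (Fin P) (Fin P) ℂ}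
    (hK : ∀ i j, Integrable (fun σ => K σ i j) (band P)) {u : ℝ → Fin P → ℂ}
    (hu : AEStronglyMeasurable u (band P)) {C : ℝ} (hC : ∀ᵐ σ ∂(band P), ‖u σ‖ ≤ C) :
    Integrable (fun σ => quad (K σ) (u σ)) (band P) :=
  (integrable_dotProduct_mulVec hK hu hu hC hC).re

theorem kernelNorm_add_le {K : ℝ → Matrix (Fin P) (Fin P) ℂ}
    (hK : ∀ i j, AEStronglyMeasurable (fun σ => K σ i j) (band P))
    (hpos : ∀ᵐ σ ∂(band P), (K σ).PosSemidef) {u v : ℝ → Fin P → ℂ}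
    (hu : AEStronglyMeasurable u (band P)) (hv : AEStronglyMeasurable v (band P)) :
    kernelNorm K (fun σ => u σ + v σ) ≤ kernelNorm K u + kernelNorm K v := by
  refine le_trans ?_ (eLpNorm_add_le
    (Real.continuous_sqrt.comp_aestronglyMeasurable (aestronglyMeasurable_quad hK hu))
    (Real.continuous_sqrt.comp_aestronglyMeasurable (aestronglyMeasurable_quad hK hv)) one_le_two)
  refine eLpNorm_mono_ae ?_
  filter_upwards [hpos] with σ hσ
  simp only [Pi.add_apply]
  rw [Real.norm_of_nonneg (Real.sqrt_nonneg _), Real.norm_of_nonneg (by positivity)]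
  exact sqrt_quad_add_le hσ _ _

theorem kernelNorm_sub_comm (K : ℝ → Matrix (Fin P) (Fin P) ℂ) (u v : ℝ → Fin P → ℂ) :
    kernelNorm K (fun σ => u σ - v σ) = kernelNorm K (fun σ => v σ - u σ) := by
  unfold kernelNorm
  congr 1 with σ
  rw [← quad_neg, neg_sub]

theorem kernelNorm_sub_le {K : ℝ → Matrix (Fin P) (Fin P) ℂ}
    (hK : ∀ i j, AEStronglyMeasurable (fun σ => K σ i j) (band P))
    (hpos : ∀ᵐ σ ∂(band P), (K σ).PosSemidef) {u v w : ℝ → Fin P → ℂ}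
    (hu : AEStronglyMeasurable u (band P)) (hv : AEStronglyMeasurable v (band P))
    (hw : AEStronglyMeasurable w (band P)) :
    kernelNorm K (fun σ => u σ - w σ) ≤
      kernelNorm K (fun σ => u σ - v σ) + kernelNorm K (fun σ => v σ - w σ) := by
  have := kernelNorm_add_le hK hpos (u := fun σ => u σ - v σ) (v := fun σ => v σ - w σ)
    (hu.sub hv) (hv.sub hw)
  simpa only [sub_add_sub_cancel] using this

end KernelNorm

/-! ### Second moments of finite linear combinations -/

section LinearCombinations

variable {Ω : Type*}

/-- A finite linear combination of the values of a process. -/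
def combo (x : ℤ → Ω → ℂ) (c : ℤ →₀ ℂ) : Ω → ℂ := c.sum fun n a => a • x n

theorem combo_apply (x : ℤ → Ω → ℂ) (c : ℤ →₀ ℂ) (ω : Ω) :
    combo x c ω = c.sum fun n a => a * x n ω := by
  simp [combo, Finsupp.sum, Finset.sum_apply]

theorem combo_sub (x : ℤ → Ω → ℂ) (c c' : ℤ →₀ ℂ) : combo x (c - c') = combo x c - combo x c' :=
  Finsupp.sum_sub_index fun _ _ _ => sub_smul _ _ _

theorem trigVec_sub (P : ℕ) (c c' : ℤ →₀ ℂ) (σ : ℝ) :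
    trigVec P (c - c') σ = trigVec P c σ - trigVec P c' σ :=
  Finsupp.sum_sub_index fun _ _ _ => sub_smul _ _ _

variable [MeasurableSpace Ω] {μ : Measure Ω}

theorem memLp_combo {x : ℤ → Ω → ℂ} (hx : ∀ n, MemLp (x n) 2 μ) (c : ℤ →₀ ℂ) :
    MemLp (combo x c) 2 μ :=
  memLp_finsetSum' _ fun n _ => (hx n).const_smul _

theorem integrable_mul_conj {f g : Ω → ℂ} (hf : MemLp f 2 μ) (hg : MemLp g 2 μ) :
    Integrable (fun ω => f ω * conj (g ω)) μ :=
  hf.integrable_mul hg.star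

theorem integral_mul_conj_combo {f : Ω → ℂ} {x : ℤ → Ω → ℂ} (hf : MemLp f 2 μ)
    (hx : ∀ n, MemLp (x n) 2 μ) (c : ℤ →₀ ℂ) :
    ∫ ω, f ω * conj (combo x c ω) ∂μ = c.sum fun n a => conj a * ∫ ω, f ω * conj (x n ω) ∂μ := by
  simp only [combo_apply, Finsupp.sum, map_sum, map_mul, Finset.mul_sum]
  rw [integral_finsetSum]
  · refine Finset.sum_congr rfl fun n _ => ?_
    rw [← integral_const_mul]
    congr 1 with ω
    ring
  · intro n _
    refine ((integrable_mul_conj hf (hx n)).const_mul (conj (c n))).congr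
      (Eventually.of_forall fun ω => ?_)
    simp only
    ring

theorem integral_combo_mul_conj {f : Ω → ℂ} {x : ℤ → Ω → ℂ} (hf : MemLp f 2 μ)
    (hx : ∀ n, MemLp (x n) 2 μ) (c : ℤ →₀ ℂ) :
    ∫ ω, combo x c ω * conj (f ω) ∂μ = c.sum fun n a => a * ∫ ω, x n ω * conj (f ω) ∂μ := by
  simp only [combo_apply, Finsupp.sum, Finset.sum_mul]
  rw [integral_finsetSum]
  · refine Finset.sum_congr rfl fun n _ => ?_
    rw [← integral_const_mul]
    congr 1 with ω
    ring
  · intro n _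
    refine ((integrable_mul_conj (hx n) hf).const_mul (c n)).congr
      (Eventually.of_forall fun ω => ?_)
    simp only
    ring

theorem integral_norm_sub_sq {f g : Ω → ℂ} (hf : MemLp f 2 μ) (hg : MemLp g 2 μ) :
    ∫ ω, ‖f ω - g ω‖ ^ 2 ∂μ = (∫ ω, f ω * conj (f ω) ∂μ).re - 2 * (∫ ω, f ω * conj (g ω) ∂μ).re
      + (∫ ω, g ω * conj (g ω) ∂μ).re := by
  have i1 := (integrable_mul_conj hf hf).re
  have i2 := (integrable_mul_conj hf hg).re
  have i3 := (integrable_mul_conj hg hg).re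
  have e1 := integral_re (integrable_mul_conj hf hf)
  have e2 := integral_re (integrable_mul_conj hf hg)
  have e3 := integral_re (integrable_mul_conj hg hg)
  simp only [RCLike.re_to_complex] at i1 i2 i3 e1 e2 e3
  rw [← e1, ← e2, ← e3, integral_sub_two_mul_add i1 i2 i3]
  congr 1 with ω
  rw [← Complex.normSq_eq_norm_sq, Complex.normSq_sub]
  simp only [Complex.mul_conj, Complex.ofReal_re]
  ring

end LinearCombinations

/-! ### Spectral isometry, estimation errors and spectral integrals -/

/-- A signal `d` and an observation `x` described by their spectral matrices, the signal being
uncorrelated with the noise, and one of signal and noise being white of power `p`. -/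
structure IsSpectralModel {Ω : Type*} [MeasurableSpace Ω] (μ : Measure Ω) (P : ℕ) (p : ℝ)
    (d x : ℤ → Ω → ℂ) (D X : ℝ → Matrix (Fin P) (Fin P) ℂ) : Prop where
  memLp_signal : ∀ n, MemLp (d n) 2 μ
  memLp_obs : ∀ n, MemLp (x n) 2 μ
  integrable_signal : ∀ i j, Integrable (fun σ => D σ i j) (band P)
  integrable_obs : ∀ i j, Integrable (fun σ => X σ i j) (band P)
  moment_signal : ∀ n, ∫ ω, d n ω * conj (d n ω) ∂μ =
    ∫ σ, clBasis P n σ ⬝ᵥ (D σ *ᵥ star (clBasis P n σ)) ∂(band P)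
  moment_cross : ∀ n m, ∫ ω, d n ω * conj (x m ω) ∂μ =
    ∫ σ, clBasis P n σ ⬝ᵥ (D σ *ᵥ star (clBasis P m σ)) ∂(band P)
  moment_obs : ∀ n m, ∫ ω, x n ω * conj (x m ω) ∂μ =
    ∫ σ, clBasis P n σ ⬝ᵥ (X σ *ᵥ star (clBasis P m σ)) ∂(band P)
  white : ∀ᵐ σ ∂(band P), IsWhitePair p (D σ) (X σ)

theorem integral_form_trigVec {P : ℕ} {K : ℝ → Matrix (Fin P) (Fin P) ℂ}
    (hK : ∀ i j, Integrable (fun σ => K σ i j) (band P)) {u : ℝ → Fin P → ℂ}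
    (hu : AEStronglyMeasurable u (band P)) {C : ℝ} (hC : ∀ᵐ σ ∂(band P), ‖u σ‖ ≤ C)
    (c : ℤ →₀ ℂ) :
    ∫ σ, u σ ⬝ᵥ (K σ *ᵥ star (trigVec P c σ)) ∂(band P) =
      c.sum fun m a => conj a * ∫ σ, u σ ⬝ᵥ (K σ *ᵥ star (clBasis P m σ)) ∂(band P) := by
  have h : ∀ σ, u σ ⬝ᵥ (K σ *ᵥ star (trigVec P c σ)) =
      ∑ m ∈ c.support, conj (c m) * (u σ ⬝ᵥ (K σ *ᵥ star (clBasis P m σ))) := fun σ => by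
    simp only [trigVec, Finsupp.sum, star_sum, star_smul, Matrix.mulVec_sum, Matrix.mulVec_smul,
      dotProduct_sum, dotProduct_smul, smul_eq_mul]
    rfl
  simp only [h]
  rw [integral_finsetSum]
  · refine Finset.sum_congr rfl fun m _ => ?_
    rw [integral_const_mul]
  · intro m _
    exact (integrable_dotProduct_mulVec hK hu (continuous_clBasis P m).aestronglyMeasurable hC
      (Eventually.of_forall fun σ => norm_clBasis_le P m σ)).const_mul _

theorem integral_form_trigVec_left {P : ℕ} {K : ℝ → Matrix (Fin P) (Fin P) ℂ}
    (hK : ∀ i j, Integrable (fun σ => K σ i j) (band P)) {u : ℝ → Fin P → ℂ}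
    (hu : AEStronglyMeasurable u (band P)) {C : ℝ} (hC : ∀ᵐ σ ∂(band P), ‖u σ‖ ≤ C)
    (c : ℤ →₀ ℂ) :
    ∫ σ, trigVec P c σ ⬝ᵥ (K σ *ᵥ star (u σ)) ∂(band P) =
      c.sum fun m a => a * ∫ σ, clBasis P m σ ⬝ᵥ (K σ *ᵥ star (u σ)) ∂(band P) := by
  have h : ∀ σ, trigVec P c σ ⬝ᵥ (K σ *ᵥ star (u σ)) =
      ∑ m ∈ c.support, c m * (clBasis P m σ ⬝ᵥ (K σ *ᵥ star (u σ))) := fun σ => by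
    simp only [trigVec, Finsupp.sum, sum_dotProduct, smul_dotProduct, smul_eq_mul]
  simp only [h]
  rw [integral_finsetSum]
  · refine Finset.sum_congr rfl fun m _ => ?_
    rw [integral_const_mul]
  · intro m _
    exact (integrable_dotProduct_mulVec hK (continuous_clBasis P m).aestronglyMeasurable hu
      (Eventually.of_forall fun σ => norm_clBasis_le P m σ) hC).const_mul _

theorem integral_combo_mul_conj_combo {Ω : Type*} [MeasurableSpace Ω] {μ : Measure Ω} {P : ℕ}
    {x : ℤ → Ω → ℂ} {K : ℝ → Matrix (Fin P) (Fin P) ℂ} (hx : ∀ n, MemLp (x n) 2 μ)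
    (hK : ∀ i j, Integrable (fun σ => K σ i j) (band P))
    (hm : ∀ n m, ∫ ω, x n ω * conj (x m ω) ∂μ =
      ∫ σ, clBasis P n σ ⬝ᵥ (K σ *ᵥ star (clBasis P m σ)) ∂(band P)) (c c' : ℤ →₀ ℂ) :
    ∫ ω, combo x c ω * conj (combo x c' ω) ∂μ =
      ∫ σ, trigVec P c σ ⬝ᵥ (K σ *ᵥ star (trigVec P c' σ)) ∂(band P) := by
  rw [integral_combo_mul_conj (memLp_combo hx c') hx, integral_form_trigVec_left hK
    (continuous_trigVec P c').aestronglyMeasurable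
    (Eventually.of_forall fun σ => norm_trigVec_le P c' σ)]
  refine Finset.sum_congr rfl fun n _ => ?_
  dsimp only
  rw [integral_mul_conj_combo (hx n) hx, integral_form_trigVec hK
    (continuous_clBasis P n).aestronglyMeasurable
    (Eventually.of_forall fun σ => norm_clBasis_le P n σ)]
  simp only [hm]

namespace IsSpectralModel

variable {Ω : Type*} [MeasurableSpace Ω] {μ : Measure Ω} {P : ℕ} {p : ℝ}
  {d x : ℤ → Ω → ℂ} {D X : ℝ → Matrix (Fin P) (Fin P) ℂ}

theorem posSemidef_obs (h : IsSpectralModel μ P p d x D X) :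
    ∀ᵐ σ ∂(band P), (X σ).PosSemidef := by
  filter_upwards [h.white] with σ hσ using hσ.posDef.posSemidef

/-- The spectral isometry: both squared norms are the same combination of the moments of `x`. -/
theorem eLpNorm_combo (h : IsSpectralModel μ P p d x D X) (c : ℤ →₀ ℂ) :
    eLpNorm (combo x c) 2 μ = kernelNorm X (trigVec P c) := by
  refine (ENNReal.pow_right_strictMono (n := 2) two_ne_zero).injective ?_
  have hc := memLp_combo h.memLp_obs c
  have hi := integrable_dotProduct_mulVec h.integrable_obs
    (continuous_trigVec P c).aestronglyMeasurable (continuous_trigVec P c).aestronglyMeasurable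
    (Eventually.of_forall fun σ => norm_trigVec_le P c σ)
    (Eventually.of_forall fun σ => norm_trigVec_le P c σ)
  rw [eLpNorm_two_sq_eq_ofReal hc, kernelNorm_sq, ← ofReal_integral_eq_lintegral_ofReal]
  · congr 1
    have h0 := integral_norm_sub_sq hc (MemLp.zero (ε := ℂ) (p := 2) (μ := μ))
    simp only [Pi.zero_apply, sub_zero, map_zero, mul_zero, integral_zero, Complex.zero_re,
      add_zero] at h0
    rw [h0, integral_combo_mul_conj_combo h.memLp_obs h.integrable_obs h.moment_obs]
    exact (integral_re hi).symm
  · exact hi.re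
  · filter_upwards [h.posSemidef_obs] with σ hσ using quad_nonneg hσ _

/-- The matrix of the optimal filter. -/
def wienerMat (D X : ℝ → Matrix (Fin P) (Fin P) ℂ) (σ : ℝ) : Matrix (Fin P) (Fin P) ℂ :=
  (D σ * (X σ)⁻¹)ᵀ

/-- The spectral matrix of the least error. -/
def errMat (D X : ℝ → Matrix (Fin P) (Fin P) ℂ) (σ : ℝ) : Matrix (Fin P) (Fin P) ℂ :=
  D σ - D σ * (X σ)⁻¹ * D σ

/-- The least mean square error at time `n`. -/
def minErr (D X : ℝ → Matrix (Fin P) (Fin P) ℂ) (n : ℤ) : ℝ :=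
  ∫ σ, quad (errMat D X σ) (clBasis P n σ) ∂(band P)

theorem aemeasurable_wienerMat (h : IsSpectralModel μ P p d x D X) (i j : Fin P) :
    AEMeasurable (fun σ => wienerMat D X σ i j) (band P) :=
  aemeasurable_matrix_mul (fun i j => (h.integrable_signal i j).1.aemeasurable)
    (aemeasurable_matrix_inv fun i j => (h.integrable_obs i j).1.aemeasurable) j i

theorem aestronglyMeasurable_wiener (h : IsSpectralModel μ P p d x D X) (n : ℤ) :
    AEStronglyMeasurable (fun σ => wienerMat D X σ *ᵥ clBasis P n σ) (band P) :=
  aestronglyMeasurable_mulVec h.aemeasurable_wienerMat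
    (continuous_clBasis P n).aestronglyMeasurable

theorem norm_wiener_le (h : IsSpectralModel μ P p d x D X) (n : ℤ) :
    ∀ᵐ σ ∂(band P), ‖wienerMat D X σ *ᵥ clBasis P n σ‖ ≤ P * (2 * 1) := by
  filter_upwards [h.white] with σ hσ
  refine (norm_mulVec_le zero_le_two (fun i j => hσ.norm_mul_inv_apply_le j i) _).trans ?_
  gcongr
  exact norm_clBasis_le P n σ

/-- In `(D X⁻¹) D` the first factor is bounded, so the product is integrable although `D` need not
be square integrable. -/
theorem integrable_errMat (h : IsSpectralModel μ P p d x D X) (i j : Fin P) :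
    Integrable (fun σ => errMat D X σ i j) (band P) := by
  simp only [errMat, Matrix.sub_apply, Matrix.mul_apply (M := D _ * (X _)⁻¹)]
  refine (h.integrable_signal i j).sub (integrable_finsetSum _ fun k _ => ?_)
  refine Integrable.bdd_mul (c := 2) (h.integrable_signal k j)
    (h.aemeasurable_wienerMat k i).aestronglyMeasurable ?_
  filter_upwards [h.white] with σ hσ using hσ.norm_mul_inv_apply_le i k

theorem integrable_quad_errMat (h : IsSpectralModel μ P p d x D X) (n : ℤ) :
    Integrable (fun σ => quad (errMat D X σ) (clBasis P n σ)) (band P) :=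
  integrable_quad h.integrable_errMat (continuous_clBasis P n).aestronglyMeasurable
    (Eventually.of_forall fun σ => norm_clBasis_le P n σ)

theorem minErr_nonneg (h : IsSpectralModel μ P p d x D X) (n : ℤ) : 0 ≤ minErr D X n := by
  refine integral_nonneg_of_ae ?_
  filter_upwards [h.white] with σ hσ using quad_nonneg hσ.sub_mul_inv_mul_posSemidef _

/-- The error of a finite linear estimate. -/
theorem eLpNorm_sub_combo_sq (h : IsSpectralModel μ P p d x D X) (n : ℤ) (c : ℤ →₀ ℂ) :
    eLpNorm (d n - combo x c) 2 μ ^ 2 = ENNReal.ofReal (minErr D X n) +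
      kernelNorm X (fun σ => trigVec P c σ - wienerMat D X σ *ᵥ clBasis P n σ) ^ 2 := by
  have hc := memLp_combo h.memLp_obs c
  have me := (continuous_clBasis P n).aestronglyMeasurable (μ := band P)
  have mt := (continuous_trigVec P c).aestronglyMeasurable (μ := band P)
  have be : ∀ᵐ σ ∂(band P), ‖clBasis P n σ‖ ≤ 1 :=
    Eventually.of_forall fun σ => norm_clBasis_le P n σ
  have bt : ∀ᵐ σ ∂(band P), ‖trigVec P c σ‖ ≤ c.sum fun _ a => ‖a‖ :=
    Eventually.of_forall fun σ => norm_trigVec_le P c σ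
  have i1 := integrable_dotProduct_mulVec h.integrable_signal me me be be
  have i2 := integrable_dotProduct_mulVec h.integrable_signal me mt be bt
  have i3 := integrable_dotProduct_mulVec h.integrable_obs mt mt bt bt
  have iq : Integrable (fun σ => quad (X σ)
      (trigVec P c σ - wienerMat D X σ *ᵥ clBasis P n σ)) (band P) := by
    refine integrable_quad h.integrable_obs (mt.sub (h.aestronglyMeasurable_wiener n))
      (C := (c.sum fun _ a => ‖a‖) + P * (2 * 1)) ?_
    filter_upwards [bt, h.norm_wiener_le n] with σ h1 h2
    exact (norm_sub_le _ _).trans (add_le_add h1 h2)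
  have hd : MemLp (d n - combo x c) 2 μ := (h.memLp_signal n).sub hc
  rw [eLpNorm_two_sq_eq_ofReal hd, kernelNorm_sq, ← ofReal_integral_eq_lintegral_ofReal iq,
    ← ENNReal.ofReal_add (h.minErr_nonneg n)]
  · congr 1
    simp only [Pi.sub_apply]
    rw [integral_norm_sub_sq (h.memLp_signal n) hc, h.moment_signal,
      integral_mul_conj_combo (h.memLp_signal n) h.memLp_obs,
      integral_combo_mul_conj_combo h.memLp_obs h.integrable_obs h.moment_obs]
    simp only [h.moment_cross]
    rw [← integral_form_trigVec h.integrable_signal me be]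
    have e1 := integral_re i1
    have e2 := integral_re i2
    have e3 := integral_re i3
    have j1 := i1.re
    have j2 := i2.re
    have j3 := i3.re
    simp only [RCLike.re_to_complex] at e1 e2 e3 j1 j2 j3
    rw [← e1, ← e2, ← e3, integral_sub_two_mul_add j1 j2 j3, minErr,
      ← integral_add (h.integrable_quad_errMat n) iq]
    refine integral_congr_ae ?_
    filter_upwards [h.white] with σ hσ
    exact hσ.completing_square _ _
  · refine integral_nonneg_of_ae ?_
    filter_upwards [h.posSemidef_obs] with σ hσ using quad_nonneg hσ _
  · filter_upwards [h.posSemidef_obs] with σ hσ using quad_nonneg hσ _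

theorem tendsto_kernelNorm_of_lintegral {K : ℝ → Matrix (Fin P) (Fin P) ℂ}
    {u : ℕ → ℝ → Fin P → ℂ}
    (hu : Tendsto (fun k => ∫⁻ σ, ENNReal.ofReal (quad (K σ) (u k σ)) ∂(band P)) atTop (𝓝 0)) :
    Tendsto (fun k => kernelNorm K (u k)) atTop (𝓝 0) := by
  simp only [← kernelNorm_sq] at hu
  have h2 := (ENNReal.continuous_rpow_const (y := (1 / 2 : ℝ))).tendsto 0 |>.comp hu
  have e : ∀ a : ℝ≥0∞, (a ^ 2) ^ (1 / 2 : ℝ) = a := fun a => by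
    rw [← ENNReal.rpow_natCast, ← ENNReal.rpow_mul]
    norm_num
  simp only [Function.comp_def, e] at h2
  simpa using h2

/-- The error of a linear estimate with an infinite memory. -/
theorem eLpNorm_sub_sq (h : IsSpectralModel μ P p d x D X) (n : ℤ) {u : ℝ → Fin P → ℂ}
    {Y : Ω → ℂ} (hY : HasCLIntegral μ P x X u Y) :
    eLpNorm (d n - Y) 2 μ ^ 2 = ENNReal.ofReal (minErr D X n) +
      kernelNorm X (fun σ => u σ - wienerMat D X σ *ᵥ clBasis P n σ) ^ 2 := by
  obtain ⟨hu, hYm, c, hc1, hc2⟩ := hY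
  have hb := tendsto_kernelNorm_of_lintegral (K := X) (u := fun k σ => u σ - trigVec P (c k) σ) hc1
  have mX := fun i j => (h.integrable_obs i j).1
  have mg := h.aestronglyMeasurable_wiener n
  have mt := fun k => (continuous_trigVec P (c k)).aestronglyMeasurable (μ := band P)
  -- The same coefficients approximate `u` in the weighted seminorm and `Y` in mean square, so both
  -- sides of the identity for finite combinations converge. The limit in the weighted seminorm is
  -- taken in `ℝ≥0∞`, without assuming it finite.
  have l1 : Tendsto (fun k => kernelNorm X
      (fun σ => trigVec P (c k) σ - wienerMat D X σ *ᵥ clBasis P n σ)) atTop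
      (𝓝 (kernelNorm X (fun σ => u σ - wienerMat D X σ *ᵥ clBasis P n σ))) := by
    refine ENNReal.tendsto_of_le_add (fun k => ?_) (fun k => ?_) hb
    · have := kernelNorm_sub_le mX h.posSemidef_obs (mt k) hu mg
      rwa [kernelNorm_sub_comm X (trigVec P (c k)) u, add_comm] at this
    · have := kernelNorm_sub_le mX h.posSemidef_obs hu (mt k) mg
      rwa [add_comm] at this
  have mc := fun k => (memLp_combo h.memLp_obs (c k)).1
  have l2 : Tendsto (fun k => eLpNorm (d n - combo x (c k)) 2 μ) atTop
      (𝓝 (eLpNorm (d n - Y) 2 μ)) := by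
    refine ENNReal.tendsto_of_le_add (b := fun k => eLpNorm (Y - combo x (c k)) 2 μ)
      (fun k => ?_) (fun k => ?_) hc2
    · have := eLpNorm_add_le ((h.memLp_signal n).1.sub hYm.1) (hYm.1.sub (mc k)) one_le_two
      rwa [sub_add_sub_cancel] at this
    · have := eLpNorm_add_le ((h.memLp_signal n).1.sub (mc k)) ((mc k).sub hYm.1) one_le_two
      rwa [sub_add_sub_cancel, eLpNorm_sub_comm (combo x (c k))] at this
  have l3 := (ENNReal.Tendsto.pow (n := 2) l1).const_add (ENNReal.ofReal (minErr D X n))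
  have l4 := ENNReal.Tendsto.pow (n := 2) l2
  simp only [h.eLpNorm_sub_combo_sq] at l4
  exact tendsto_nhds_unique l4 l3

/-- Two sequences approximating `u` are close to each other in the weighted seminorm; by the
isometry the combinations of `x` are then close in mean square. -/
theorem ae_eq_of_hasCLIntegral (h : IsSpectralModel μ P p d x D X) {u : ℝ → Fin P → ℂ}
    {Y Y' : Ω → ℂ} (hY : HasCLIntegral μ P x X u Y) (hY' : HasCLIntegral μ P x X u Y') :
    Y =ᵐ[μ] Y' := by
  obtain ⟨hu, hYm, c, hc1, hc2⟩ := hY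
  obtain ⟨-, hYm', c', hc1', hc2'⟩ := hY'
  have hb := tendsto_kernelNorm_of_lintegral (K := X) (u := fun k σ => u σ - trigVec P (c k) σ) hc1
  have hb' := tendsto_kernelNorm_of_lintegral (K := X)
    (u := fun k σ => u σ - trigVec P (c' k) σ) hc1'
  have mX := fun i j => (h.integrable_obs i j).1
  have hlim := (hc2.add (hb.add hb')).add hc2'
  simp only [add_zero] at hlim
  have hle : ∀ k, eLpNorm (Y - Y') 2 μ ≤ eLpNorm (Y - combo x (c k)) 2 μ +
      (kernelNorm X (fun σ => u σ - trigVec P (c k) σ) +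
        kernelNorm X (fun σ => u σ - trigVec P (c' k) σ)) +
      eLpNorm (Y' - combo x (c' k)) 2 μ := fun k => by
    have m1 := (memLp_combo h.memLp_obs (c k)).1
    have m2 := (memLp_combo h.memLp_obs (c' k)).1
    have e : Y - Y' = (Y - combo x (c k)) + combo x (c k - c' k) + (combo x (c' k) - Y') := by
      rw [combo_sub]; abel
    rw [e]
    refine (eLpNorm_add_le ((hYm.1.sub m1).add (memLp_combo h.memLp_obs _).1) (m2.sub hYm'.1)
      one_le_two).trans ?_
    rw [eLpNorm_sub_comm (combo x (c' k))]
    gcongr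
    refine (eLpNorm_add_le (hYm.1.sub m1) (memLp_combo h.memLp_obs _).1 one_le_two).trans ?_
    gcongr
    rw [h.eLpNorm_combo]
    have := kernelNorm_sub_le mX h.posSemidef_obs
      (continuous_trigVec P (c k)).aestronglyMeasurable hu
      (continuous_trigVec P (c' k)).aestronglyMeasurable
    rw [kernelNorm_sub_comm X (trigVec P (c k)) u] at this
    simp only [← trigVec_sub] at this
    exact this
  have h0 : eLpNorm (Y - Y') 2 μ = 0 :=
    le_antisymm (ge_of_tendsto' hlim hle) zero_le
  have := (eLpNorm_eq_zero_iff (hYm.1.sub hYm'.1) two_ne_zero).1 h0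
  filter_upwards [this] with ω hω using sub_eq_zero.1 hω

/-- Every bounded measurable function has a spectral integral. -/
theorem exists_hasCLIntegral [NeZero P] (h : IsSpectralModel μ P p d x D X) {u : ℝ → Fin P → ℂ}
    (hu : AEStronglyMeasurable u (band P)) {C : ℝ} (hC : ∀ᵐ σ ∂(band P), ‖u σ‖ ≤ C) :
    ∃ Y, HasCLIntegral μ P x X u Y := by
  have mX := fun i j => (h.integrable_obs i j).1
  obtain ⟨v, hv, hvb, huv⟩ : ∃ v : ℝ → Fin P → ℂ, Measurable v ∧ (∀ σ, ‖v σ‖ ≤ |C|) ∧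
      u =ᵐ[band P] v := by
    -- Cutting a measurable version to zero where the bound fails gives a representative bounded
    -- everywhere, as the density lemma requires.
    let s : Set ℝ := {σ | ‖hu.mk u σ‖ ≤ |C|}
    have hs : MeasurableSet s := measurableSet_le hu.stronglyMeasurable_mk.measurable.norm
      measurable_const
    refine ⟨s.indicator (hu.mk u), hu.stronglyMeasurable_mk.measurable.indicator hs,
      fun σ => ?_, ?_⟩
    · by_cases hσ : σ ∈ s
      · rw [Set.indicator_of_mem hσ]; exact hσ
      · rw [Set.indicator_of_notMem hσ]; simp
    · filter_upwards [hu.ae_eq_mk, hC] with σ h1 h2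
      rw [Set.indicator_of_mem, h1]
      change ‖hu.mk u σ‖ ≤ |C|
      rw [← h1]
      exact h2.trans (le_abs_self C)
  obtain ⟨c, -, hc⟩ := exists_tendsto_trigVec P (integrable_entrySum h.integrable_obs) hv hvb
  have hlim : Tendsto (fun k => ∫⁻ σ, ENNReal.ofReal
      (quad (X σ) (u σ - trigVec P (c k) σ)) ∂(band P)) atTop (𝓝 0) := by
    refine tendsto_of_tendsto_of_tendsto_of_le_of_le tendsto_const_nhds hc (fun _ => zero_le)
      fun k => lintegral_mono_ae ?_
    filter_upwards [huv] with σ hσ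
    rw [hσ, ← ofReal_norm, ← ofReal_norm, Real.norm_of_nonneg (entrySum_nonneg _),
      ← ENNReal.ofReal_pow (norm_nonneg _), ← ENNReal.ofReal_mul (entrySum_nonneg _)]
    refine ENNReal.ofReal_le_ofReal ((Complex.re_le_norm _).trans ?_)
    rw [pow_two]
    exact norm_dotProduct_mulVec_le _ _ _
  have hb := tendsto_kernelNorm_of_lintegral hlim
  have hmem := fun k => memLp_combo h.memLp_obs (c k)
  have : Fact ((1 : ℝ≥0∞) ≤ 2) := ⟨one_le_two⟩
  -- The isometry transfers the Cauchy property from the integrands to the random variables, and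
  -- `L²` is complete.
  have hcau : CauchySeq fun k => (hmem k).toLp (combo x (c k)) := by
    rw [EMetric.cauchySeq_iff]
    intro ε hε
    obtain ⟨N, hN⟩ := eventually_atTop.1 (hb.eventually (gt_mem_nhds (ENNReal.half_pos hε.ne')))
    refine ⟨N, fun m hm l hl => ?_⟩
    rw [Lp.edist_toLp_toLp, ← combo_sub, h.eLpNorm_combo]
    have := kernelNorm_sub_le mX h.posSemidef_obs
      (continuous_trigVec P (c m)).aestronglyMeasurable hu
      (continuous_trigVec P (c l)).aestronglyMeasurable
    rw [kernelNorm_sub_comm X (trigVec P (c m)) u] at this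
    simp only [← trigVec_sub] at this
    refine this.trans_lt ?_
    rw [← ENNReal.add_halves ε]
    exact ENNReal.add_lt_add (hN m hm) (hN l hl)
  obtain ⟨Y, hY⟩ := cauchySeq_tendsto_of_complete hcau
  refine ⟨Y, hu, Lp.memLp Y, c, hlim, ?_⟩
  rw [Lp.tendsto_Lp_iff_tendsto_eLpNorm'] at hY
  refine hY.congr fun k => ?_
  rw [eLpNorm_congr_ae ((hmem k).coeFn_toLp.sub (EventuallyEq.refl _ (Y : Ω → ℂ))),
    eLpNorm_sub_comm]
  rfl

end IsSpectralModel

/-! ### Symmetric averages of periodic sequences -/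

section PeriodicAverages

variable {P : ℕ}

theorem sum_range_periodic_window {b : ℕ → ℝ} (hb : ∀ n, b (n + P) = b n) (K : ℕ) :
    ∑ j ∈ Finset.range P, b (K + j) = ∑ j ∈ Finset.range P, b j := by
  induction K with
  | zero => simp
  | succ K ih =>
    rw [← ih]
    have h1 := Finset.sum_range_succ (fun j => b (K + j)) P
    have h2 := Finset.sum_range_succ' (fun j => b (K + j)) P
    simp only [hb, add_zero] at h1 h2
    have h3 : ∀ j, K + 1 + j = K + (j + 1) := fun j => by ring
    simp only [h3]
    linarith

/-- The deviation of the partial sums from linear growth is itself `P`-periodic, so it takes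
finitely many values. -/
theorem exists_bound_sum_range_sub [NeZero P] {b : ℕ → ℝ} (hb : ∀ n, b (n + P) = b n) :
    ∃ C, ∀ K : ℕ, |∑ i ∈ Finset.range K, b i - K * (1 / P * ∑ i ∈ Finset.range P, b i)| ≤ C := by
  have hP : (P : ℝ) ≠ 0 := Nat.cast_ne_zero.2 (NeZero.ne P)
  set G : ℕ → ℝ := fun K => ∑ i ∈ Finset.range K, b i - K * (1 / P * ∑ i ∈ Finset.range P, b i)
  have hG : Function.Periodic G P := fun K => by
    simp only [G, Finset.sum_range_add, sum_range_periodic_window hb]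
    push_cast
    field_simp
    ring
  refine ⟨∑ i ∈ Finset.range P, |G i|, fun K => ?_⟩
  change |G K| ≤ _
  rw [← hG.map_mod_nat K]
  exact Finset.single_le_sum (f := fun i => |G i|) (fun _ _ => abs_nonneg _)
    (Finset.mem_range.2 (Nat.mod_lt _ (Nat.pos_of_ne_zero (NeZero.ne P))))

theorem sum_Icc_symm (a : ℤ → ℝ) (K : ℕ) :
    ∑ n ∈ Finset.Icc (-(K : ℤ)) ((K : ℤ) - 1), a n =
      ∑ i ∈ Finset.range K, a i + ∑ i ∈ Finset.range K, a (-1 - i) := by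
  induction K with
  | zero => simp
  | succ K ih =>
    have h : Finset.Icc (-((K + 1 : ℕ) : ℤ)) (((K + 1 : ℕ) : ℤ) - 1) =
        insert (-1 - (K : ℤ)) (insert (K : ℤ) (Finset.Icc (-(K : ℤ)) ((K : ℤ) - 1))) := by
      ext n
      simp only [Finset.mem_Icc, Finset.mem_insert]
      push_cast
      omega
    rw [h, Finset.sum_insert, Finset.sum_insert, ih, Finset.sum_range_succ, Finset.sum_range_succ]
    · ring
    · simp
    · simp only [Finset.mem_insert, Finset.mem_Icc]
      omega

/-- The symmetric averages of a periodic sequence tend to its average over a period. -/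
theorem tendsto_average_of_periodic [NeZero P] {a : ℤ → ℝ} (ha : ∀ n, a (n + P) = a n) :
    Tendsto (fun K : ℕ => 1 / ((((K : ℤ) - 1 : ℤ) : ℝ) - ((-(K : ℤ) : ℤ) : ℝ)) *
      ∑ n ∈ Finset.Icc (-(K : ℤ)) ((K : ℤ) - 1), a n) atTop
      (𝓝 (1 / P * ∑ n ∈ Finset.range P, a n)) := by
  set A := 1 / (P : ℝ) * ∑ n ∈ Finset.range P, a n with hA
  obtain ⟨C₁, h₁⟩ := exists_bound_sum_range_sub (b := fun i => a i) fun n => by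
    push_cast; exact ha n
  have ha' : ∀ n : ℕ, a (-1 - ((n + P : ℕ) : ℤ)) = a (-1 - n) := fun n => by
    rw [← ha (-1 - ((n + P : ℕ) : ℤ))]
    congr 1
    push_cast; ring
  obtain ⟨C₂, h₂⟩ := exists_bound_sum_range_sub (b := fun i => a (-1 - i)) ha'
  have hrefl : ∑ i ∈ Finset.range P, a (-1 - i) = ∑ n ∈ Finset.range P, a n := by
    rw [← Finset.sum_range_reflect]
    refine Finset.sum_congr rfl fun i hi => ?_
    rw [← ha]
    congr 1
    have := Finset.mem_range.1 hi
    omega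
  rw [hrefl] at h₂
  rw [← hA] at h₁ h₂
  -- The window has `2 K` terms but the normalization is `2 K - 1`; the extra `A` accounts for the
  -- difference and disappears in the limit.
  set G : ℕ → ℝ := fun K => (∑ i ∈ Finset.range K, a i - K * A) +
    (∑ i ∈ Finset.range K, a (-1 - i) - K * A) + A with hG
  have hbd : ∀ K, |G K| ≤ C₁ + C₂ + |A| := fun K =>
    (abs_add_le _ _).trans (add_le_add ((abs_add_le _ _).trans (add_le_add (h₁ K) (h₂ K))) le_rfl)
  have hden : Tendsto (fun K : ℕ => (2 * (K : ℝ) - 1)⁻¹) atTop (𝓝 0) := by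
    refine tendsto_inv_atTop_zero.comp ?_
    exact tendsto_atTop_add_const_right _ _ (tendsto_natCast_atTop_atTop.const_mul_atTop two_pos)
  have h0 : Tendsto (fun K : ℕ => (2 * (K : ℝ) - 1)⁻¹ * G K) atTop (𝓝 0) := by
    refine hden.zero_mul_isBoundedUnder_le ⟨C₁ + C₂ + |A|, ?_⟩
    simp only [eventually_map]
    exact Eventually.of_forall fun K => by simpa using hbd K
  have h3 := h0.add_const A
  rw [zero_add] at h3
  refine h3.congr' ?_
  filter_upwards [eventually_ge_atTop 1] with K hK
  have hK' : (1 : ℝ) ≤ K := by exact_mod_cast hK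
  have hne : (2 * (K : ℝ) - 1) ≠ 0 := by linarith
  rw [sum_Icc_symm]
  push_cast
  have e : ((K : ℝ) - 1 - -(K : ℝ)) = 2 * K - 1 := by ring
  rw [e, hG]
  field_simp
  ring

end PeriodicAverages

/-! ### The split Fourier basis over one period -/

section Orthogonality

variable (P : ℕ) [NeZero P]

/-- The phases in `σ` cancel and leave the character of `ℤ / P` of index `j - q`. Thus the vectors
`clBasis P n σ`, `0 ≤ n < P`, are orthogonal of squared length `P`; the next two results use this,
once to recover a matrix and once to compute a trace. -/
theorem sum_clBasis_mul_conj (σ : ℝ) (j q : Fin P) :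
    ∑ n ∈ Finset.range P, clBasis P n σ j * conj (clBasis P n σ q) =
      if j = q then (P : ℂ) else 0 := by
  have h : ∀ n : ℕ, clBasis P n σ j * conj (clBasis P n σ q) =
      cexp2pi (n * ((((j.val : ℤ) - (q.val : ℤ) : ℤ) : ℝ) / P)) := fun n => by
    rw [clBasis, clBasis, conj_cexp2pi, ← cexp2pi_add]
    congr 1
    push_cast
    ring
  simp only [h]
  rw [sum_range_cexp2pi]
  refine if_congr ⟨fun hd => ?_, fun hd => by simp [hd]⟩ rfl rfl
  have h1 := j.2
  have h2 := q.2
  have := Int.eq_zero_of_abs_lt_dvd hd (by rw [abs_lt]; omega)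
  ext
  omega

variable {P}

theorem eq_zero_of_mulVec_clBasis {N : Matrix (Fin P) (Fin P) ℂ} {σ : ℝ}
    (h : ∀ n ∈ Finset.range P, N *ᵥ clBasis P n σ = 0) : N = 0 := by
  ext i q
  have h1 : ∑ n ∈ Finset.range P, (N *ᵥ clBasis P n σ) i * conj (clBasis P n σ q) = 0 :=
    Finset.sum_eq_zero fun n hn => by rw [h n hn]; simp
  simp only [Matrix.mulVec, dotProduct, Finset.sum_mul, mul_assoc] at h1
  rw [Finset.sum_comm] at h1
  simp only [← Finset.mul_sum, sum_clBasis_mul_conj] at h1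
  simpa [NeZero.ne P] using h1

theorem sum_quad_clBasis (K : Matrix (Fin P) (Fin P) ℂ) (σ : ℝ) :
    ∑ n ∈ Finset.range P, quad K (clBasis P n σ) = P * K.trace.re := by
  simp only [quad, ← Complex.re_sum, dotProduct, Matrix.mulVec, Finset.mul_sum, Pi.star_apply]
  rw [Finset.sum_comm]
  have : ∀ i : Fin P, ∑ n ∈ Finset.range P, ∑ j, clBasis P n σ i * (K i j * star (clBasis P n σ j))
      = P * K i i := fun i => by
    rw [Finset.sum_comm]
    have e : ∀ (j : Fin P) (n : ℕ), clBasis P n σ i * (K i j * star (clBasis P n σ j)) =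
        K i j * (clBasis P n σ i * conj (clBasis P n σ j)) := fun j n => by
      rw [starRingEnd_apply]; ring
    simp only [e, ← Finset.mul_sum, sum_clBasis_mul_conj]
    simp [mul_comm]
  rw [Finset.sum_congr rfl fun i _ => this i, ← Finset.mul_sum, ← Complex.ofReal_natCast,
    Complex.re_ofReal_mul]
  rfl

/-- The phases `exp(2πi q)` equal 1, so the factor does not depend on the sub-band, and Hermitian
forms do not see it. This makes all the errors periodic. -/
theorem clBasis_add_period (n : ℤ) (σ : ℝ) :
    clBasis P (n + P) σ = cexp2pi (σ * P) • clBasis P n σ := by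
  have hP : (P : ℝ) ≠ 0 := Nat.cast_ne_zero.2 (NeZero.ne P)
  ext q
  rw [Pi.smul_apply, smul_eq_mul, clBasis, clBasis, ← cexp2pi_add,
    ← cexp2pi_add_intCast (σ * P + _) q.val]
  congr 1
  push_cast
  field_simp
  ring

theorem quad_mulVec_clBasis_add_period (K N : Matrix (Fin P) (Fin P) ℂ) (n : ℤ) (σ : ℝ) :
    quad K (N *ᵥ clBasis P (n + P) σ) = quad K (N *ᵥ clBasis P n σ) := by
  rw [clBasis_add_period, Matrix.mulVec_smul, quad_smul, norm_cexp2pi, one_pow, one_mul]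

end Orthogonality

/-! ### Error power and optimality of matrix filters -/

/-- The process `dhat` is the output, for input `x`, of the filter with the matrix response `M`. -/
def IsMatOutput {Ω : Type*} [MeasurableSpace Ω] (μ : Measure Ω) (P : ℕ) (x : ℤ → Ω → ℂ)
    (X M : ℝ → Matrix (Fin P) (Fin P) ℂ) (dhat : ℤ → Ω → ℂ) : Prop :=
  ∀ n, HasCLIntegral μ P x X (fun σ => M σ *ᵥ clBasis P n σ) (dhat n)

theorem HasSpectralIntegral.congr {Ω : Type*} [MeasurableSpace Ω] {μ : Measure Ω} {P : ℕ}
    {x : ℤ → Ω → ℂ} {e : ℤ → ℝ → Fin P → ℂ} {K : ℝ → Matrix (Fin P) (Fin P) ℂ}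
    {u v : ℝ → Fin P → ℂ} {Y : Ω → ℂ} (h : HasSpectralIntegral μ P x e K u Y)
    (huv : u =ᵐ[band P] v) : HasSpectralIntegral μ P x e K v Y := by
  obtain ⟨hu, hY, c, h1, h2⟩ := h
  refine ⟨hu.congr huv, hY, c, h1.congr fun k => lintegral_congr_ae ?_, h2⟩
  filter_upwards [huv] with σ hσ
  rw [hσ]

theorem IsMatOutput.congr {Ω : Type*} [MeasurableSpace Ω] {μ : Measure Ω} {P : ℕ}
    {x : ℤ → Ω → ℂ} {X M M' : ℝ → Matrix (Fin P) (Fin P) ℂ} {dhat : ℤ → Ω → ℂ}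
    (h : IsMatOutput μ P x X M dhat) (hM : ∀ᵐ σ ∂(band P), M σ = M' σ) :
    IsMatOutput μ P x X M' dhat := fun n =>
  HasSpectralIntegral.congr (h n) (by filter_upwards [hM] with σ hσ; rw [hσ])

namespace IsSpectralModel

variable {Ω : Type*} [MeasurableSpace Ω] {μ : Measure Ω} {P : ℕ} {p : ℝ}
  {d x dhat : ℤ → Ω → ℂ} {D X M : ℝ → Matrix (Fin P) (Fin P) ℂ}

/-- The least error power. -/
def minPower (D X : ℝ → Matrix (Fin P) (Fin P) ℂ) : ℝ :=
  1 / P * ∑ n ∈ Finset.range P, minErr D X n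

/-- The excess error at time `n` of the filter with the matrix response `M`. -/
def excess (D X M : ℝ → Matrix (Fin P) (Fin P) ℂ) (n : ℤ) : ℝ≥0∞ :=
  kernelNorm X (fun σ => (M σ - wienerMat D X σ) *ᵥ clBasis P n σ)

/-- Nothing bounds the response `M`; finiteness comes from the finite power of `d n` and `dhat n`
through the error identity. -/
theorem excess_ne_top (h : IsSpectralModel μ P p d x D X) (hM : IsMatOutput μ P x X M dhat)
    (n : ℤ) : excess D X M n ≠ ∞ := by
  have h1 := h.eLpNorm_sub_sq n (hM n)
  simp only [← Matrix.sub_mulVec] at h1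
  change _ = _ + excess D X M n ^ 2 at h1
  intro htop
  rw [htop] at h1
  have h2 := ((h.memLp_signal n).sub (hM n).2.1).2.ne
  simp only [ENNReal.top_pow two_ne_zero, add_top] at h1
  rw [ENNReal.pow_eq_top_iff] at h1
  exact h2 h1.1

theorem integral_norm_sub_sq_eq (h : IsSpectralModel μ P p d x D X)
    (hM : IsMatOutput μ P x X M dhat) (n : ℤ) :
    ∫ ω, ‖d n ω - dhat n ω‖ ^ 2 ∂μ = minErr D X n + (excess D X M n).toReal ^ 2 := by
  have h1 := h.eLpNorm_sub_sq n (hM n)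
  simp only [← Matrix.sub_mulVec] at h1
  change _ = _ + excess D X M n ^ 2 at h1
  rw [eLpNorm_two_sq_eq_ofReal ((h.memLp_signal n).sub (hM n).2.1)] at h1
  have h2 := congrArg ENNReal.toReal h1
  rw [ENNReal.toReal_ofReal (integral_nonneg fun _ => by positivity),
    ENNReal.toReal_add ENNReal.ofReal_ne_top
      (ENNReal.pow_ne_top (h.excess_ne_top hM n)),
    ENNReal.toReal_ofReal (h.minErr_nonneg n), ENNReal.toReal_pow] at h2
  exact h2

theorem minErr_add_period [NeZero P] (D X : ℝ → Matrix (Fin P) (Fin P) ℂ) (n : ℤ) :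
    minErr D X (n + P) = minErr D X n := by
  unfold minErr
  congr 1 with σ
  simpa using quad_mulVec_clBasis_add_period (errMat D X σ) 1 n σ

theorem excess_add_period [NeZero P] (D X M : ℝ → Matrix (Fin P) (Fin P) ℂ) (n : ℤ) :
    excess D X M (n + P) = excess D X M n := by
  unfold excess kernelNorm
  congr 1 with σ
  rw [quad_mulVec_clBasis_add_period]

theorem hasMSE [NeZero P] (h : IsSpectralModel μ P p d x D X) (hM : IsMatOutput μ P x X M dhat) :
    HasMSE μ d dhat (minPower D X + 1 / P * ∑ n ∈ Finset.range P,
      (excess D X M n).toReal ^ 2) := by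
  have := tendsto_average_of_periodic (P := P)
    (a := fun n => minErr D X n + (excess D X M n).toReal ^ 2) fun n => by
      simp only [minErr_add_period, excess_add_period]
  rw [Finset.sum_add_distrib, mul_add] at this
  refine this.congr fun K => ?_
  simp only [mse, h.integral_norm_sub_sq_eq hM]

theorem minPower_le [NeZero P] (h : IsSpectralModel μ P p d x D X)
    (hM : IsMatOutput μ P x X M dhat) {L : ℝ} (hL : HasMSE μ d dhat L) : minPower D X ≤ L := by
  rw [tendsto_nhds_unique hL (h.hasMSE hM)]
  exact le_add_of_nonneg_right (by positivity)

/-- Attaining the least power forces zero excess at each time of one period. As `X σ` is positive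
definite, `M - wienerMat` kills the `P` basis vectors of that period, hence vanishes. -/
theorem ae_eq_wienerMat [NeZero P] (h : IsSpectralModel μ P p d x D X)
    (hM : IsMatOutput μ P x X M dhat) (hL : HasMSE μ d dhat (minPower D X)) :
    ∀ᵐ σ ∂(band P), M σ = wienerMat D X σ := by
  have hP : (P : ℝ) ≠ 0 := Nat.cast_ne_zero.2 (NeZero.ne P)
  have h1 := tendsto_nhds_unique hL (h.hasMSE hM)
  have h2 : ∑ n ∈ Finset.range P, (excess D X M n).toReal ^ 2 = 0 := by
    have h3 : 1 / (P : ℝ) * ∑ n ∈ Finset.range P, (excess D X M n).toReal ^ 2 = 0 := by linarith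
    rcases mul_eq_zero.1 h3 with h4 | h4
    · exact absurd h4 (one_div_ne_zero hP)
    · exact h4
  have h3 : ∀ n ∈ Finset.range P, ∀ᵐ σ ∂(band P),
      (M σ - wienerMat D X σ) *ᵥ clBasis P n σ = 0 := fun n hn => by
    have h4 := (Finset.sum_eq_zero_iff_of_nonneg fun _ _ => by positivity).1 h2 n hn
    have h5 : excess D X M n = 0 :=
      ((ENNReal.toReal_eq_zero_iff _).1 (pow_eq_zero_iff two_ne_zero |>.1 h4)).resolve_right
        (h.excess_ne_top hM n)
    have hm : AEStronglyMeasurable (fun σ => (M σ - wienerMat D X σ) *ᵥ clBasis P n σ)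
        (band P) := by
      simp only [Matrix.sub_mulVec]
      exact (hM n).1.sub (h.aestronglyMeasurable_wiener n)
    have h6 := (eLpNorm_eq_zero_iff (Real.continuous_sqrt.comp_aestronglyMeasurable
      (aestronglyMeasurable_quad (fun i j => (h.integrable_obs i j).1) hm)) two_ne_zero).1 h5
    filter_upwards [h6, h.white] with σ h7 h8
    exact quad_eq_zero h8.posDef
      ((Real.sqrt_eq_zero (quad_nonneg h8.posDef.posSemidef _)).1 h7)
  have h4 := (Finset.eventually_all (Finset.range P)).2 h3
  filter_upwards [h4] with σ hσ
  exact sub_eq_zero.1 (eq_zero_of_mulVec_clBasis hσ)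

theorem exists_isMatOutput_wienerMat [NeZero P] (h : IsSpectralModel μ P p d x D X) :
    ∃ dhat, IsMatOutput μ P x X (wienerMat D X) dhat := by
  have : ∀ n, ∃ Y, HasCLIntegral μ P x X (fun σ => wienerMat D X σ *ᵥ clBasis P n σ) Y :=
    fun n => h.exists_hasCLIntegral (h.aestronglyMeasurable_wiener n) (h.norm_wiener_le n)
  choose Y hY using this
  exact ⟨Y, hY⟩

theorem excess_wienerMat (D X : ℝ → Matrix (Fin P) (Fin P) ℂ) (n : ℤ) :
    excess D X (wienerMat D X) n = 0 := by
  simp [excess, kernelNorm, quad_zero]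

theorem hasMSE_wienerMat [NeZero P] (h : IsSpectralModel μ P p d x D X)
    (hM : IsMatOutput μ P x X (wienerMat D X) dhat) : HasMSE μ d dhat (minPower D X) := by
  simpa [excess_wienerMat] using h.hasMSE hM

/-- The Wiener filter minimizes the error over all finite linear estimates. -/
theorem integral_norm_sub_sq_le (h : IsSpectralModel μ P p d x D X)
    (hM : IsMatOutput μ P x X (wienerMat D X) dhat) (n : ℤ) (c : ℤ →₀ ℂ) :
    ∫ ω, ‖d n ω - dhat n ω‖ ^ 2 ∂μ ≤ ∫ ω, ‖d n ω - combo x c ω‖ ^ 2 ∂μ := by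
  rw [h.integral_norm_sub_sq_eq hM, excess_wienerMat]
  have h1 := h.eLpNorm_sub_combo_sq n c
  rw [eLpNorm_two_sq_eq_ofReal ((h.memLp_signal n).sub (memLp_combo h.memLp_obs c))] at h1
  have h2 : ENNReal.ofReal (minErr D X n) ≤
      ENNReal.ofReal (∫ ω, ‖(d n - combo x c) ω‖ ^ 2 ∂μ) := by
    rw [h1]; exact le_self_add
  have h3 := (ENNReal.ofReal_le_ofReal_iff (integral_nonneg fun _ => by positivity)).1 h2
  simpa using h3

variable {ι : Type*} {Out : ι → (ℤ → Ω → ℂ) → Prop}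
  {F : ι → ℝ → Matrix (Fin P) (Fin P) ℂ}

/-- The least error power of a class of filters that contains the Wiener filter. -/
theorem isLeast_minPower [NeZero P] (h : IsSpectralModel μ P p d x D X)
    (hOut : ∀ W dhat, Out W dhat ↔ IsMatOutput μ P x X (F W) dhat)
    (hW : ∃ W, ∀ᵐ σ ∂(band P), F W σ = wienerMat D X σ) :
    IsLeast {L | ∃ W dhat, Out W dhat ∧ HasMSE μ d dhat L} (minPower D X) := by
  constructor
  · obtain ⟨W, hW⟩ := hW
    obtain ⟨dhat, hd⟩ := h.exists_isMatOutput_wienerMat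
    exact ⟨W, dhat, (hOut _ _).2 (hd.congr (by filter_upwards [hW] with σ hσ using hσ.symm)),
      h.hasMSE_wienerMat hd⟩
  · rintro L ⟨W, dhat, h1, h2⟩
    exact h.minPower_le ((hOut _ _).1 h1) h2

/-- In a class of filters that contains the Wiener filter, it is the only optimal filter. -/
theorem isOptimal_iff [NeZero P] (h : IsSpectralModel μ P p d x D X)
    (hOut : ∀ W dhat, Out W dhat ↔ IsMatOutput μ P x X (F W) dhat)
    (hW : ∃ W, ∀ᵐ σ ∂(band P), F W σ = wienerMat D X σ) (W : ι) :
    (∃ dhat L, Out W dhat ∧ HasMSE μ d dhat L ∧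
      IsLeast {L | ∃ W dhat, Out W dhat ∧ HasMSE μ d dhat L} L) ↔
      ∀ᵐ σ ∂(band P), F W σ = wienerMat D X σ := by
  have hleast := h.isLeast_minPower hOut hW
  constructor
  · rintro ⟨dhat, L, h1, h2, h3⟩
    rw [h3.unique hleast] at h2
    exact h.ae_eq_wienerMat ((hOut _ _).1 h1) h2
  · intro hF
    obtain ⟨dhat, hd⟩ := h.exists_isMatOutput_wienerMat
    exact ⟨dhat, _, (hOut _ _).2 (hd.congr (by filter_upwards [hF] with σ hσ using hσ.symm)),
      h.hasMSE_wienerMat hd, hleast⟩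

theorem integrable_trace_errMat (h : IsSpectralModel μ P p d x D X) :
    Integrable (fun σ => (errMat D X σ).trace) (band P) :=
  integrable_finsetSum _ fun i _ => h.integrable_errMat i i

theorem minPower_eq [NeZero P] (h : IsSpectralModel μ P p d x D X) :
    minPower D X = ∫ σ, (errMat D X σ).trace.re ∂(band P) := by
  have hP : (P : ℝ) ≠ 0 := Nat.cast_ne_zero.2 (NeZero.ne P)
  simp only [minPower, minErr]
  rw [← integral_finsetSum (Finset.range P) (f := fun (n : ℕ) σ =>
    quad (errMat D X σ) (clBasis P n σ)) fun n _ => h.integrable_quad_errMat n]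
  simp only [sum_quad_clBasis]
  rw [integral_const_mul, one_div, inv_mul_cancel_left₀ hP]

theorem ofReal_minPower_eq [NeZero P] (h : IsSpectralModel μ P p d x D X) :
    (minPower D X : ℂ) = ∫ σ, (errMat D X σ).trace ∂(band P) := by
  rw [h.minPower_eq, ← integral_complex_ofReal]
  refine integral_congr_ae ?_
  filter_upwards [h.white] with σ hσ
  have := hσ.sub_mul_inv_mul_posSemidef.trace_nonneg
  exact (Complex.eq_re_of_ofReal_le this).symm

end IsSpectralModel

/-- `X` is Hermitian, so `X⁻¹ Aᴴ` is the conjugate transpose of `A X⁻¹`. This links the transposed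
response to the formula for the filter coefficients, which enter conjugated. -/
theorem IsWhitePair.transpose_mul_inv_apply {P : ℕ} {p : ℝ}
    {A X : Matrix (Fin P) (Fin P) ℂ} (h : IsWhitePair p A X) (i j : Fin P) : (A * X⁻¹)ᵀ i j = conj ((X⁻¹ * Aᴴ) i j) := by
  have : X⁻¹ * Aᴴ = (A * X⁻¹)ᴴ := by
    rw [Matrix.conjTranspose_mul, Matrix.conjTranspose_nonsing_inv, h.posDef.isHermitian.eq]
  rw [this, Matrix.conjTranspose_apply, Matrix.transpose_apply, starRingEnd_apply, star_star]

/-! ### FRESH filters as matrix responses -/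

section Fresh

variable {Ω : Type*} [MeasurableSpace Ω] {μ : Measure Ω} {P : ℕ} [NeZero P] {p : ℝ}
  {d x : ℤ → Ω → ℂ} {D X DX : ℝ → Matrix (Fin P) (Fin P) ℂ}

/-- The matrix response of a FRESH filter. -/
def freshMat (P : ℕ) [NeZero P] (W : Fin P → ℝ → ℂ) (σ : ℝ) : Matrix (Fin P) (Fin P) ℂ :=
  Matrix.of fun j p => conj (W (j - p) (σ + (p.val : ℝ) / (P : ℝ)))

theorem isFreshOutput_iff (W : Fin P → ℝ → ℂ) (dhat : ℤ → Ω → ℂ) :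
    IsFreshOutput μ P x X W dhat ↔ IsMatOutput μ P x X (freshMat P W) dhat := by
  have h : ∀ n : ℤ, (fun (σ : ℝ) (j : Fin P) => ∑ p : Fin P,
      clBasis P n σ p * conj (W (j - p) (σ + (p.val : ℝ) / (P : ℝ)))) =
      fun σ => freshMat P W σ *ᵥ clBasis P n σ := fun n => by
    funext σ j
    simp only [Matrix.mulVec, dotProduct, freshMat, Matrix.of_apply]
    exact Finset.sum_congr rfl fun _ _ => mul_comm _ _
  unfold IsFreshOutput IsMatOutput
  simp only [h]

theorem IsSpectralModel.freshMat_ae_eq_iff (h : IsSpectralModel μ P p d x D X)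
    (hDX : ∀ᵐ σ ∂(band P), DX σ = D σ) (W : Fin P → ℝ → ℂ) :
    (∀ᵐ σ ∂(band P), freshMat P W σ = IsSpectralModel.wienerMat D X σ) ↔
      ∀ p q : Fin P, ∀ᵐ σ ∂(band P),
        W q (σ + (p.val : ℝ) / (P : ℝ)) = ((X σ)⁻¹ * (DX σ)ᴴ) (p + q) p := by
  simp only [← ae_all_iff]
  refine eventually_congr ?_
  filter_upwards [h.white, hDX] with σ h1 h2
  rw [h2]
  constructor
  · intro hW r q
    have := congrFun (congrFun hW (r + q)) r
    rw [IsSpectralModel.wienerMat, h1.transpose_mul_inv_apply, freshMat, Matrix.of_apply,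
      add_sub_cancel_left] at this
    exact star_injective this
  · intro hW
    ext j r
    rw [IsSpectralModel.wienerMat, h1.transpose_mul_inv_apply, freshMat, Matrix.of_apply, hW,
      add_sub_cancel]

/-- The restrictions of the `W_q` to the `P` sub-bands are `P²` independent functions, one for each
matrix entry; the witness glues them along the band. -/
theorem exists_freshMat_eq (M : ℝ → Matrix (Fin P) (Fin P) ℂ) :
    ∃ W, ∀ᵐ σ ∂(band P), freshMat P W σ = M σ := by
  refine ⟨fun q f => ∑ j : Fin P, (Set.Ico (0 : ℝ) (1 / P)).indicator
    (fun s => conj (M s (j + q) j)) (f - (j.val : ℝ) / P), ?_⟩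
  filter_upwards [ae_restrict_mem measurableSet_Ico] with σ hσ
  ext j r
  rw [freshMat, Matrix.of_apply]
  have := sum_indicator_subband (fun s i => conj (M s (i + (j - r)) i)) hσ r
  rw [this, add_sub_cancel, Complex.conj_conj]

end Fresh

/-! ### Diagonalization in a common eigenbasis -/

section Eigenbasis

variable {P : ℕ} {p : ℝ} {A X U DX : Matrix (Fin P) (Fin P) ℂ} {ev : Fin P → ℝ}

theorem conjTranspose_mul_mul_eq_diagonal (hU : U ∈ Matrix.unitaryGroup (Fin P) ℂ)
    (h : ∀ p, X *ᵥ Uᵀ p = (ev p : ℂ) • Uᵀ p) :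
    Uᴴ * X * U = Matrix.diagonal fun p => (ev p : ℂ) := by
  have h1 : X * U = U * Matrix.diagonal fun p => (ev p : ℂ) := by
    ext i q
    rw [Matrix.mul_diagonal]
    have := congrFun (h q) i
    rw [Pi.smul_apply, smul_eq_mul, Matrix.transpose_apply, mul_comm] at this
    exact this
  rw [mul_assoc, h1, ← mul_assoc]
  have h2 : Uᴴ * U = 1 := Matrix.mem_unitaryGroup_iff'.1 hU
  rw [h2, one_mul]

theorem eq_conj_of_conjTranspose_mul_mul_eq (hU : U ∈ Matrix.unitaryGroup (Fin P) ℂ)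
    {L : Matrix (Fin P) (Fin P) ℂ} (h : Uᴴ * X * U = L) : X = U * L * Uᴴ := by
  have h1 : U * Uᴴ = 1 := Matrix.mem_unitaryGroup_iff.1 hU
  rw [← h]
  calc X = (U * Uᴴ) * X * (U * Uᴴ) := by rw [h1, one_mul, mul_one]
    _ = _ := by noncomm_ring

theorem conjTranspose_mul_mul_eq_of_eq_conj (hU : U ∈ Matrix.unitaryGroup (Fin P) ℂ)
    {L : Matrix (Fin P) (Fin P) ℂ} (h : X = U * L * Uᴴ) : Uᴴ * X * U = L := by
  have h1 : Uᴴ * U = 1 := Matrix.mem_unitaryGroup_iff'.1 hU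
  rw [h]
  calc Uᴴ * (U * L * Uᴴ) * U = (Uᴴ * U) * L * (Uᴴ * U) := by noncomm_ring
    _ = _ := by rw [h1, one_mul, mul_one]

/-- The spectra of signal and observation in a common eigenbasis. -/
structure IsCommonEigenbasis (A X U : Matrix (Fin P) (Fin P) ℂ) (dv ev : Fin P → ℝ) : Prop where
  unitary : U ∈ Matrix.unitaryGroup (Fin P) ℂ
  signal : Uᴴ * A * U = Matrix.diagonal fun p => (dv p : ℂ)
  obs : Uᴴ * X * U = Matrix.diagonal fun p => (ev p : ℂ)
  obs_pos : ∀ p, 0 < ev p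

/-- `A` is scalar or differs from `X` by a scalar, so every eigenvector of `X` is one of `A`.
Commutation alone would not suffice for an arbitrary eigenbasis when `X` has repeated eigenvalues.
-/
theorem IsWhitePair.exists_eigenvalue (h : IsWhitePair p A X)
    (hev : ∀ p, X *ᵥ Uᵀ p = (ev p : ℂ) • Uᵀ p) :
    ∃ dv : Fin P → ℝ, ∀ p, A *ᵥ Uᵀ p = (dv p : ℂ) • Uᵀ p := by
  rcases h.white with hw | hw
  · refine ⟨fun _ => p, fun q => ?_⟩
    rw [hw, Matrix.smul_mulVec, Matrix.one_mulVec]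
  · refine ⟨fun q => ev q - p, fun q => ?_⟩
    have : A = X - (p : ℂ) • 1 := by rw [← hw]; abel
    rw [this, Matrix.sub_mulVec, hev, Matrix.smul_mulVec, Matrix.one_mulVec, ← sub_smul]
    push_cast
    rfl

theorem IsWhitePair.exists_isCommonEigenbasis (h : IsWhitePair p A X)
    (hU : U ∈ Matrix.unitaryGroup (Fin P) ℂ) (hev : ∀ p, X *ᵥ Uᵀ p = (ev p : ℂ) • Uᵀ p) :
    ∃ dv : Fin P → ℝ, IsCommonEigenbasis A X U dv ev := by
  obtain ⟨dv, hdv⟩ := h.exists_eigenvalue hev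
  refine ⟨dv, hU, conjTranspose_mul_mul_eq_diagonal hU hdv,
    conjTranspose_mul_mul_eq_diagonal hU hev, ?_⟩
  have hUu : IsUnit U := ⟨⟨U, Uᴴ, Matrix.mem_unitaryGroup_iff.1 hU,
    Matrix.mem_unitaryGroup_iff'.1 hU⟩, rfl⟩
  have h1 := (Matrix.IsUnit.posDef_star_left_conjugate_iff hUu).2 h.posDef
  rw [Matrix.star_eq_conjTranspose, conjTranspose_mul_mul_eq_diagonal hU hev,
    Matrix.posDef_diagonal_iff] at h1
  intro q
  exact_mod_cast h1 q

namespace IsCommonEigenbasis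

variable {dv : Fin P → ℝ}

theorem inv_eq (h : IsCommonEigenbasis A X U dv ev) :
    X⁻¹ = U * (Matrix.diagonal fun p => ((ev p : ℂ))⁻¹) * Uᴴ := by
  refine Matrix.inv_eq_right_inv ?_
  have h1 : Uᴴ * U = 1 := Matrix.mem_unitaryGroup_iff'.1 h.unitary
  have h2 : U * Uᴴ = 1 := Matrix.mem_unitaryGroup_iff.1 h.unitary
  have h3 : (Matrix.diagonal fun p => (ev p : ℂ)) * (Matrix.diagonal fun p => ((ev p : ℂ))⁻¹) =
      1 := by
    rw [Matrix.diagonal_mul_diagonal, ← Matrix.diagonal_one]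
    congr 1 with q
    exact mul_inv_cancel₀ (by exact_mod_cast (h.obs_pos q).ne')
  rw [eq_conj_of_conjTranspose_mul_mul_eq h.unitary h.obs]
  calc _ = U * ((Matrix.diagonal fun p => (ev p : ℂ)) * (Uᴴ * U) *
        (Matrix.diagonal fun p => ((ev p : ℂ))⁻¹)) * Uᴴ := by noncomm_ring
    _ = 1 := by rw [h1, mul_one, h3, mul_one, h2]

theorem mul_inv_eq (h : IsCommonEigenbasis A X U dv ev) :
    A * X⁻¹ = U * (Matrix.diagonal fun p => ((dv p : ℂ) / ev p)) * Uᴴ := by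
  have h1 : Uᴴ * U = 1 := Matrix.mem_unitaryGroup_iff'.1 h.unitary
  rw [h.inv_eq, eq_conj_of_conjTranspose_mul_mul_eq h.unitary h.signal]
  calc _ = U * ((Matrix.diagonal fun p => (dv p : ℂ)) * (Uᴴ * U) *
        (Matrix.diagonal fun p => ((ev p : ℂ))⁻¹)) * Uᴴ := by noncomm_ring
    _ = _ := by rw [h1, mul_one, Matrix.diagonal_mul_diagonal]; rfl

theorem conj_errMat (h : IsCommonEigenbasis A X U dv ev) :
    Uᴴ * (A - A * X⁻¹ * A) * U =
      Matrix.diagonal fun p => ((dv p - dv p ^ 2 / ev p : ℝ) : ℂ) := by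
  refine conjTranspose_mul_mul_eq_of_eq_conj h.unitary ?_
  have h1 : Uᴴ * U = 1 := Matrix.mem_unitaryGroup_iff'.1 h.unitary
  rw [h.mul_inv_eq, eq_conj_of_conjTranspose_mul_mul_eq h.unitary h.signal]
  calc _ = U * ((Matrix.diagonal fun p => (dv p : ℂ)) - (Matrix.diagonal fun p => ((dv p : ℂ) / ev p))
        * (Uᴴ * U) * (Matrix.diagonal fun p => (dv p : ℂ))) * Uᴴ := by noncomm_ring
    _ = _ := by
      rw [h1, mul_one, Matrix.diagonal_mul_diagonal, Matrix.diagonal_sub]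
      congr 3 with q
      push_cast
      ring

/-- The transposed product is the optimal response exactly when two diagonal matrices agree after
conjugation by `U`. The entries of the second are the real ratios `dv / ev`. -/
theorem response_eq_iff (h : IsCommonEigenbasis A X U dv ev) (w : Fin P → ℂ) :
    Uᴴᵀ * (Matrix.diagonal fun p => conj (w p)) * Uᵀ = (A * X⁻¹)ᵀ ↔
      ∀ p, w p = conj ((Uᴴ * A * U) p p) / (Uᴴ * X * U) p p := by
  have e1 : Uᴴᵀ * (Matrix.diagonal fun p => conj (w p)) * Uᵀ =
      (U * (Matrix.diagonal fun p => conj (w p)) * Uᴴ)ᵀ := by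
    rw [Matrix.transpose_mul, Matrix.transpose_mul, Matrix.diagonal_transpose, mul_assoc]
  rw [e1, Matrix.transpose_inj, h.mul_inv_eq, h.signal, h.obs]
  constructor
  · intro h2 q
    have h3 := (conjTranspose_mul_mul_eq_of_eq_conj h.unitary h2).symm.trans
      (conjTranspose_mul_mul_eq_of_eq_conj h.unitary rfl)
    have h4 := Matrix.diagonal_eq_diagonal_iff.1 h3 q
    rw [Matrix.diagonal_apply_eq, Matrix.diagonal_apply_eq, Complex.conj_ofReal,
      ← Complex.conj_conj (w q), ← h4]
    simp
  · intro h2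
    congr 3 with q
    rw [h2, Matrix.diagonal_apply_eq, Matrix.diagonal_apply_eq]
    simp

/-- Both sides equal `dv - dv² / ev`. Where `dv = 0` the coherence is a division by zero with value
zero, and both sides vanish. -/
theorem mul_one_sub_coherence (h : IsCommonEigenbasis A X U dv ev) (q : Fin P) :
    ((Uᴴ * A * U) q q).re * (1 - ‖(Uᴴ * A * U) q q‖ ^ 2 /
      (((Uᴴ * X * U) q q).re * ((Uᴴ * A * U) q q).re)) =
      ((Uᴴ * (A - A * X⁻¹ * A) * U) q q).re := by
  have hpos := h.obs_pos q
  rw [h.conj_errMat, h.signal, h.obs]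
  simp only [Matrix.diagonal_apply_eq, Complex.ofReal_re, Complex.norm_real, Real.norm_eq_abs,
    sq_abs]
  rcases eq_or_ne (dv q) 0 with h0 | h0
  · simp [h0]
  · field_simp

end IsCommonEigenbasis

end Eigenbasis

/-! ### Scalar filters in the KL domain -/

section KL

variable {Ω : Type*} [MeasurableSpace Ω] {μ : Measure Ω} {P : ℕ} {p : ℝ}
  {d x : ℤ → Ω → ℂ} {D X DX B : ℝ → Matrix (Fin P) (Fin P) ℂ}

theorem klBasis_eq (B : ℝ → Matrix (Fin P) (Fin P) ℂ) (n : ℤ) (σ : ℝ) :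
    klBasis P B n σ = (B σ)ᵀ *ᵥ clBasis P n σ := rfl

/-- The coordinate change by `Bᵀ`, with inverse `Bᴴᵀ`, carries the split Fourier basis to the KL
eigenfunctions and the form of `X` to the diagonal one. Hence the same coefficients `c` witness both
integrals. -/
theorem hasKLIntegral_iff (hB : IsKLBasis P X B) (u : ℝ → Fin P → ℂ) (Y : Ω → ℂ) :
    HasKLIntegral μ P x X B u Y ↔ HasCLIntegral μ P x X (fun σ => (B σ)ᴴᵀ *ᵥ u σ) Y := by
  obtain ⟨hBm, hB⟩ := hB
  have hBt : ∀ i j, AEMeasurable (fun σ => (B σ)ᵀ i j) (band P) := fun i j => hBm j i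
  have hBc : ∀ i j, AEMeasurable (fun σ => (B σ)ᴴᵀ i j) (band P) := fun i j =>
    continuous_star.measurable.comp_aemeasurable (hBm i j)
  have hm : AEStronglyMeasurable u (band P) ↔
      AEStronglyMeasurable (fun σ => (B σ)ᴴᵀ *ᵥ u σ) (band P) := by
    refine ⟨aestronglyMeasurable_mulVec hBc, fun h => ?_⟩
    refine (aestronglyMeasurable_mulVec hBt h).congr ?_
    filter_upwards [hB] with σ hσ
    have h1 : (B σ)ᴴ * B σ = 1 := Matrix.mem_unitaryGroup_iff'.1 hσ.1
    rw [Matrix.mulVec_mulVec, ← Matrix.transpose_mul, h1, Matrix.transpose_one, Matrix.one_mulVec]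
  have hq : ∀ c : ℤ →₀ ℂ, ∫⁻ σ, ENNReal.ofReal
      ((u σ - c.sum fun n a => a • klBasis P B n σ) ⬝ᵥ
        ((Matrix.diagonal fun p => klSpec P X B p σ) *ᵥ
          star (u σ - c.sum fun n a => a • klBasis P B n σ))).re ∂(band P) =
      ∫⁻ σ, ENNReal.ofReal
      (((B σ)ᴴᵀ *ᵥ u σ - c.sum fun n a => a • clBasis P n σ) ⬝ᵥ
        (X σ *ᵥ star ((B σ)ᴴᵀ *ᵥ u σ - c.sum fun n a => a • clBasis P n σ))).re ∂(band P) := by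
    intro c
    refine lintegral_congr_ae ?_
    filter_upwards [hB] with σ ⟨hU, ev, hev⟩
    have h1 : (B σ)ᴴ * B σ = 1 := Matrix.mem_unitaryGroup_iff'.1 hU
    have hdiag := conjTranspose_mul_mul_eq_diagonal hU hev
    have hL : (Matrix.diagonal fun p => klSpec P X B p σ) = (B σ)ᴴ * X σ * B σ := by
      unfold klSpec
      rw [hdiag]
      simp
    have hX : X σ = B σ * (Matrix.diagonal fun p => klSpec P X B p σ) * (B σ)ᴴ :=
      eq_conj_of_conjTranspose_mul_mul_eq hU hL.symm
    set v := (B σ)ᴴᵀ *ᵥ u σ - c.sum fun n a => a • clBasis P n σ with hv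
    have hBv : u σ - c.sum (fun n a => a • klBasis P B n σ) = (B σ)ᵀ *ᵥ v := by
      rw [hv, Matrix.mulVec_sub, Matrix.mulVec_mulVec, ← Matrix.transpose_mul, h1,
        Matrix.transpose_one, Matrix.one_mulVec]
      congr 1
      simp only [Finsupp.sum, Matrix.mulVec_sum, Matrix.mulVec_smul, klBasis_eq]
    congr 2
    rw [hBv, Matrix.star_mulVec, Matrix.mulVec_transpose, ← Matrix.dotProduct_mulVec]
    conv_rhs => rw [hX]
    rw [← Matrix.mulVec_mulVec, ← Matrix.mulVec_mulVec]
    congr 3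
    rw [← Matrix.mulVec_transpose]
    rfl
  unfold HasKLIntegral HasCLIntegral HasSpectralIntegral
  simp only [hq, hm]

/-- The matrix response of a scalar filter in the KL domain. -/
def klMat (P : ℕ) (B : ℝ → Matrix (Fin P) (Fin P) ℂ) (W : Fin P → ℝ → ℂ) (σ : ℝ) :
    Matrix (Fin P) (Fin P) ℂ :=
  (B σ)ᴴᵀ * (Matrix.diagonal fun p => conj (W p σ)) * (B σ)ᵀ

theorem isKLOutput_iff (hB : IsKLBasis P X B) (W : Fin P → ℝ → ℂ) (dhat : ℤ → Ω → ℂ) :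
    IsKLOutput μ P x X B W dhat ↔ IsMatOutput μ P x X (klMat P B W) dhat := by
  have h : ∀ (n : ℤ) (σ : ℝ), (B σ)ᴴᵀ *ᵥ (fun p => klBasis P B n σ p * conj (W p σ)) =
      klMat P B W σ *ᵥ clBasis P n σ := fun n σ => by
    rw [klMat, ← Matrix.mulVec_mulVec, ← Matrix.mulVec_mulVec, ← klBasis_eq]
    congr 1
    funext q
    rw [Matrix.mulVec_diagonal, mul_comm]
  unfold IsKLOutput IsMatOutput
  simp only [hasKLIntegral_iff hB, h]

namespace IsSpectralModel

theorem exists_isCommonEigenbasis (h : IsSpectralModel μ P p d x D X) (hB : IsKLBasis P X B) :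
    ∀ᵐ σ ∂(band P), ∃ dv ev, IsCommonEigenbasis (D σ) (X σ) (B σ) dv ev := by
  filter_upwards [h.white, hB.2] with σ h1 ⟨hU, ev, hev⟩
  obtain ⟨dv, hdv⟩ := h1.exists_isCommonEigenbasis hU hev
  exact ⟨dv, ev, hdv⟩

theorem isKLBasis_signal (h : IsSpectralModel μ P p d x D X) (hB : IsKLBasis P X B) :
    IsKLBasis P D B := by
  refine ⟨hB.1, ?_⟩
  filter_upwards [h.white, hB.2] with σ h1 ⟨hU, ev, hev⟩
  exact ⟨hU, h1.exists_eigenvalue hev⟩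

theorem klMat_ae_eq_iff (h : IsSpectralModel μ P p d x D X) (hB : IsKLBasis P X B)
    (hDX : ∀ᵐ σ ∂(band P), DX σ = D σ) (W : Fin P → ℝ → ℂ) :
    (∀ᵐ σ ∂(band P), klMat P B W σ = wienerMat D X σ) ↔
      ∀ p : Fin P, ∀ᵐ σ ∂(band P), W p σ = conj (klSpec P DX B p σ) / klSpec P X B p σ := by
  rw [← ae_all_iff]
  refine eventually_congr ?_
  filter_upwards [h.exists_isCommonEigenbasis hB, hDX] with σ ⟨dv, ev, h1⟩ h2
  unfold klSpec
  rw [h2]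
  exact h1.response_eq_iff _

theorem exists_klMat_ae_eq (h : IsSpectralModel μ P p d x D X) (hB : IsKLBasis P X B) :
    ∃ W, ∀ᵐ σ ∂(band P), klMat P B W σ = wienerMat D X σ :=
  ⟨fun p σ => conj (klSpec P D B p σ) / klSpec P X B p σ,
    (h.klMat_ae_eq_iff hB (DX := D) (Eventually.of_forall fun _ => rfl) _).2 fun _ =>
      Eventually.of_forall fun _ => rfl⟩

theorem kl_error_ae_eq (h : IsSpectralModel μ P p d x D X) (hB : IsKLBasis P X B)
    (hDX : ∀ᵐ σ ∂(band P), DX σ = D σ) (q : Fin P) :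
    (fun σ => (klSpec P D B q σ).re * (1 - klCohSq P D X DX B q σ)) =ᵐ[band P]
      fun σ => (klSpec P (errMat D X) B q σ).re := by
  filter_upwards [h.exists_isCommonEigenbasis hB, hDX] with σ ⟨dv, ev, h1⟩ h2
  unfold klCohSq klSpec
  rw [h2]
  exact h1.mul_one_sub_coherence q

end IsSpectralModel

theorem integrable_klSpec {K : ℝ → Matrix (Fin P) (Fin P) ℂ}
    (hK : ∀ i j, Integrable (fun σ => K σ i j) (band P)) (hB : IsKLBasis P X B) (q : Fin P) :
    Integrable (klSpec P K B q) (band P) := by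
  have hb : ∀ i j, ∀ᵐ σ ∂(band P), ‖B σ i j‖ ≤ 1 := fun i j => by
    filter_upwards [hB.2] with σ hσ using entry_norm_bound_of_unitary hσ.1 i j
  have hm := fun i j => (hB.1 i j).aestronglyMeasurable
  unfold klSpec
  simp only [Matrix.mul_apply, Matrix.conjTranspose_apply]
  refine integrable_finsetSum _ fun j _ => Integrable.mul_bdd (c := 1) ?_ (hm j q) (hb j q)
  refine integrable_finsetSum _ fun i _ => Integrable.bdd_mul (c := 1) (hK i j)
    (continuous_star.comp_aestronglyMeasurable (hm i q)) ?_
  filter_upwards [hb i q] with σ hσ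
  simpa using hσ

theorem sum_klSpec {K : ℝ → Matrix (Fin P) (Fin P) ℂ} {σ : ℝ}
    (hU : B σ ∈ Matrix.unitaryGroup (Fin P) ℂ) : ∑ q, klSpec P K B q σ = (K σ).trace := by
  have h2 : B σ * (B σ)ᴴ = 1 := Matrix.mem_unitaryGroup_iff.1 hU
  change ((B σ)ᴴ * K σ * B σ).trace = _
  rw [Matrix.trace_mul_comm, ← mul_assoc, h2, one_mul]

theorem IsSpectralModel.minPower_eq_sum_kl [NeZero P] (h : IsSpectralModel μ P p d x D X)
    (hB : IsKLBasis P X B) (hDX : ∀ᵐ σ ∂(band P), DX σ = D σ) :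
    IsSpectralModel.minPower D X = ∑ q : Fin P,
      ∫ σ, (klSpec P D B q σ).re * (1 - klCohSq P D X DX B q σ) ∂(band P) := by
  simp only [integral_congr_ae (h.kl_error_ae_eq hB hDX _)]
  rw [h.minPower_eq, ← integral_finsetSum Finset.univ
    (f := fun q σ => (klSpec P (errMat D X) B q σ).re) fun q _ =>
    (integrable_klSpec h.integrable_errMat hB q).re]
  refine integral_congr_ae ?_
  filter_upwards [hB.2] with σ hσ
  rw [← Complex.re_sum, sum_klSpec hσ.1]

end KL

/-! ### Trace formulas through coherence and for white noise -/

section Coherence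

variable {P : ℕ} {p : ℝ} {A X : Matrix (Fin P) (Fin P) ℂ}

/-- The spectrum is finite, so the functional calculus applies to `(√t)⁻¹` even when 0 is an
eigenvalue. -/
theorem continuousOn_spectrum (A : Matrix (Fin P) (Fin P) ℂ) (f : ℝ → ℝ) :
    ContinuousOn f (spectrum ℝ A) :=
  (Matrix.finite_real_spectrum (A := A)).continuousOn f

theorem conjTranspose_invSqrt (A : Matrix (Fin P) (Fin P) ℂ) : (invSqrt A)ᴴ = invSqrt A :=
  (cfc_predicate (p := IsSelfAdjoint) (fun t : ℝ => (√t)⁻¹) A).star_eq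

theorem spectrum_nonneg_of_posSemidef (hA : A.PosSemidef) : ∀ t ∈ spectrum ℝ A, 0 ≤ t := by
  intro t ht
  rw [hA.isHermitian.spectrum_real_eq_range_eigenvalues] at ht
  obtain ⟨i, rfl⟩ := ht
  exact hA.eigenvalues_nonneg i

/-- On the spectrum this is `t (t^(-1/2) t t^(-1/2)) = t`, which also holds at `t = 0`. The inner
product is only the projection onto the range of `A`, and `A` absorbs it. -/
theorem mul_invSqrt_mul_invSqrt_mul (hA : A.PosSemidef) :
    A * (invSqrt A * A * invSqrt A) = A := by
  have hsa : IsSelfAdjoint A := hA.isHermitian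
  have h0 : cfc (fun t : ℝ => t * ((√t)⁻¹ * t * (√t)⁻¹)) A = A := by
    conv_rhs => rw [← cfc_id' ℝ A hsa]
    refine cfc_congr fun t ht => ?_
    have := spectrum_nonneg_of_posSemidef hA t ht
    rcases eq_or_lt_of_le this with h | h
    · simp [← h]
    · have h2 := Real.sq_sqrt this
      have h3 := Real.sqrt_ne_zero'.2 h
      field_simp
      rw [h2]
  have hc := continuousOn_spectrum A
  conv_rhs => rw [← h0]
  rw [cfc_mul _ _ A (hc _) (hc _), cfc_mul _ _ A (hc _) (hc _), cfc_mul _ _ A (hc _) (hc _),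
    cfc_id' ℝ A hsa]
  rfl

theorem invSqrt_mul_invSqrt (hX : X.PosDef) : invSqrt X * invSqrt X = X⁻¹ := by
  symm
  refine Matrix.inv_eq_right_inv ?_
  have hsa : IsSelfAdjoint X := hX.isHermitian
  have hc := continuousOn_spectrum X
  have h0 : cfc (fun t : ℝ => t * ((√t)⁻¹ * (√t)⁻¹)) X = 1 := by
    rw [← cfc_const_one ℝ X hsa]
    refine cfc_congr fun t ht => ?_
    rw [hX.isHermitian.spectrum_real_eq_range_eigenvalues] at ht
    obtain ⟨i, rfl⟩ := ht
    have h1 := hX.eigenvalues_pos i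
    rw [← mul_inv, Real.mul_self_sqrt h1.le]
    exact mul_inv_cancel₀ h1.ne'
  rw [cfc_mul _ _ X (hc _) (hc _), cfc_mul _ _ X (hc _) (hc _), cfc_id' ℝ X hsa] at h0
  exact h0

/-- Cyclicity of the trace brings the two inverse roots of `A` to the sides of one `A`, where `A`
absorbs the resulting projection. Then `A` and `X⁻¹` commute. -/
theorem IsWhitePair.trace_mul_one_sub_cohMat (h : IsWhitePair p A X) :
    (A * (1 - cohMat A A X * (cohMat A A X)ᴴ)).trace = (A - A * X⁻¹ * A).trace := by
  have hA := h.posSemidef.isHermitian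
  rw [Matrix.mul_sub, mul_one, Matrix.trace_sub, Matrix.trace_sub]
  congr 1
  have e1 : A * (cohMat A A X * (cohMat A A X)ᴴ) =
      (A * invSqrt A * A) * (X⁻¹ * A * invSqrt A) := by
    rw [cohMat, Matrix.conjTranspose_mul, Matrix.conjTranspose_mul, conjTranspose_invSqrt,
      conjTranspose_invSqrt, hA.eq, ← invSqrt_mul_invSqrt h.posDef]
    noncomm_ring
  rw [e1, Matrix.trace_mul_comm]
  have e2 : X⁻¹ * A * invSqrt A * (A * invSqrt A * A) =
      X⁻¹ * (A * (invSqrt A * A * invSqrt A)) * A := by noncomm_ring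
  rw [e2, mul_invSqrt_mul_invSqrt_mul h.posSemidef, h.mul_inv_comm]

/-- Expand `A = A X⁻¹ X` with `X = A + r`. -/
theorem IsWhitePair.sub_mul_inv_mul_eq (h : IsWhitePair p A X) {r : ℝ}
    (hr : X = A + (r : ℂ) • 1) :
    (A - A * X⁻¹ * A).trace = (r : ℂ) * (A * (A + (r : ℂ) • 1)⁻¹).trace := by
  rw [← hr]
  have e : A - A * X⁻¹ * A = (r : ℂ) • (A * X⁻¹) := by
    have h1 : A * X⁻¹ * X = A := by rw [mul_assoc, Matrix.nonsing_inv_mul _ h.isUnit_det, mul_one]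
    have h2 : A * X⁻¹ * X = A * X⁻¹ * A + (r : ℂ) • (A * X⁻¹) := by
      rw [← mul_one (A * X⁻¹), ← Matrix.mul_smul, mul_one, ← mul_add, ← hr]
    rw [h1] at h2
    nth_rewrite 1 [h2]
    abel
  rw [e, Matrix.trace_smul, smul_eq_mul]

end Coherence

/-! ### From the processes to the spectral model -/

section Model

variable {Ω : Type*} [MeasurableSpace Ω] {μ : Measure Ω} {P : ℕ} [NeZero P]

theorem cycMat_white (P : ℕ) [NeZero P] (p : ℝ) (σ : ℝ) :
    cycMat P (fun k _ => if (P : ℤ) ∣ k then (p : ℂ) else 0) σ = (p : ℂ) • 1 := by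
  ext i j
  rw [cycMat, Matrix.of_apply, Matrix.smul_apply, Matrix.one_apply]
  have h : (P : ℤ) ∣ (i.val : ℤ) - (j.val : ℤ) ↔ i = j := by
    refine ⟨fun hd => ?_, fun hd => by simp [hd]⟩
    have h1 := i.2
    have h2 := j.2
    have := Int.eq_zero_of_abs_lt_dvd hd (by rw [abs_lt]; omega)
    ext
    omega
  by_cases hij : i = j
  · rw [if_pos (h.2 hij), if_pos hij]; simp
  · rw [if_neg (mt h.1 hij), if_neg hij]; simp

/-- The cyclic spectrum of white noise. -/
theorem isCyclicSpectrum_white (P : ℕ) [NeZero P] (p : ℝ) :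
    IsCyclicSpectrum P (fun _ m => if m = 0 then (p : ℂ) else 0)
      (fun k _ => if (P : ℤ) ∣ k then (p : ℂ) else 0) := by
  have hP : (P : ℂ) ≠ 0 := Nat.cast_ne_zero.2 (NeZero.ne P)
  refine ⟨fun k => integrableOn_const (by simp), fun k m => ?_⟩
  have h1 : ∑ n ∈ Finset.range P, cexp2pi (-((k : ℝ) * n / P)) =
      if (P : ℤ) ∣ k then (P : ℂ) else 0 := by
    have := sum_range_cexp2pi P (-k)
    simp only [dvd_neg] at this
    rw [← this]
    refine Finset.sum_congr rfl fun n _ => ?_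
    congr 1
    push_cast
    ring
  have h2 : ∫ f in Set.Ico (0 : ℝ) 1, cexp2pi (f * m) = if m = 0 then 1 else 0 := by
    split_ifs with hm
    · simp [hm, cexp2pi_zero]
    · have hc : (2 * Real.pi * Complex.I * m : ℂ) ≠ 0 := by
        simp [Real.pi_ne_zero, hm]
      have e : ∀ f : ℝ, cexp2pi (f * m) = Complex.exp (2 * Real.pi * Complex.I * m * f) :=
        fun f => by
          rw [cexp2pi]
          push_cast
          ring_nf
      have e1 := e 1
      rw [one_mul, cexp2pi_intCast] at e1
      simp only [e]
      rw [integral_Ico_eq_integral_Ioc, ← intervalIntegral.integral_of_le zero_le_one,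
        integral_exp_mul_complex hc, ← e1]
      simp
  rw [← Finset.mul_sum, h1, integral_const_mul, h2]
  split_ifs <;> field_simp <;> simp

theorem corr_sub_eq (x y : ℤ → Ω → ℂ) (n m : ℤ) :
    corr μ x y m (n - m) = ∫ ω, x n ω * conj (y m ω) ∂μ := by
  rw [corr, add_sub_cancel]

/-- The cyclic spectral matrix of a process is positive semidefinite. -/
theorem ae_posSemidef_cycMat {x : ℤ → Ω → ℂ} (hx : IsCyclostationary μ P x) {r : ℤ → ℤ → ℂ}
    {S : ℤ → ℝ → ℂ} (hS : IsCyclicSpectrum P r S) (hr : ∀ n m, r n m = corr μ x x n m) :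
    ∀ᵐ σ ∂(band P), (cycMat P S σ).PosSemidef := by
  have hr' : r = corr μ x x := by
    funext n m
    exact hr n m
  subst hr'
  refine ae_posSemidef_of_moments hS.integrable_cycMat fun c => ?_
  -- The moment against a trigonometric polynomial is the power `E|∑ cₙ x(n)|²`.
  rw [← integral_combo_mul_conj_combo hx.1 hS.integrable_cycMat fun n m => by
    rw [← hS.moment (fun n m l => hx.2 n m l), corr_sub_eq]]
  simp only [Complex.mul_conj]
  rw [integral_complex_ofReal]
  exact ⟨integral_nonneg fun ω => Complex.normSq_nonneg _, Complex.ofReal_im _⟩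

variable {d z x : ℤ → Ω → ℂ}

theorem corr_signal_obs (hd : ∀ n, MemLp (d n) 2 μ) (hz : ∀ n, MemLp (z n) 2 μ)
    (hunc : ∀ n n' : ℤ, ∫ ω, d n ω * conj (z n' ω) ∂μ = 0)
    (hx : ∀ n ω, x n ω = d n ω + z n ω) (n m : ℤ) : corr μ d x n m = corr μ d d n m := by
  simp only [corr, hx, map_add, mul_add]
  rw [integral_add (integrable_mul_conj (hd _) (hd _)) (integrable_mul_conj (hd _) (hz _)), hunc,
    add_zero]

theorem corr_obs_obs (hd : ∀ n, MemLp (d n) 2 μ) (hz : ∀ n, MemLp (z n) 2 μ)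
    (hunc : ∀ n n' : ℤ, ∫ ω, d n ω * conj (z n' ω) ∂μ = 0)
    (hx : ∀ n ω, x n ω = d n ω + z n ω) (n m : ℤ) :
    corr μ x x n m = corr μ d d n m + corr μ z z n m := by
  have hunc' : ∫ ω, z (n + m) ω * conj (d n ω) ∂μ = 0 := by
    have := congrArg conj (hunc n (n + m))
    rw [← integral_conj, map_zero] at this
    rw [← this]
    congr 1 with ω
    simp [mul_comm]
  have hxm : ∀ n, MemLp (x n) 2 μ := fun n => by
    have : x n = d n + z n := funext fun ω => hx n ω
    rw [this]
    exact (hd n).add (hz n)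
  have h1 := corr_signal_obs hd hz hunc hx n m
  rw [← h1]
  simp only [corr] at h1 ⊢
  have e : ∀ ω, x (n + m) ω * conj (x n ω) = d (n + m) ω * conj (x n ω) +
      (z (n + m) ω * conj (d n ω) + z (n + m) ω * conj (z n ω)) := fun ω => by
    rw [hx (n + m), hx n, map_add]
    ring
  simp only [e]
  have i1 := integrable_mul_conj (hz (n + m)) (hd n)
  have i2 := integrable_mul_conj (hz (n + m)) (hz n)
  have i12 : Integrable (fun ω => z (n + m) ω * conj (d n ω) + z (n + m) ω * conj (z n ω)) μ :=
    i1.add i2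
  rw [integral_add (integrable_mul_conj (hd _) (hxm _)) i12,
    integral_add i1 i2, hunc',
    zero_add]

theorem cycMat_cross_ae_eq (hd : ∀ n, MemLp (d n) 2 μ) (hz : ∀ n, MemLp (z n) 2 μ)
    (hunc : ∀ n n' : ℤ, ∫ ω, d n ω * conj (z n' ω) ∂μ = 0)
    (hx : ∀ n ω, x n ω = d n ω + z n ω) {sD sDX : ℤ → ℝ → ℂ}
    (hsD : IsCyclicSpectrum P (corr μ d d) sD) (hsDX : IsCyclicSpectrum P (corr μ d x) sDX) :
    ∀ᵐ σ ∂(band P), cycMat P sDX σ = cycMat P sD σ :=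
  hsDX.cycMat_ae_eq hsD fun n m _ => corr_signal_obs hd hz hunc hx n m

/-- The difference of the spectra has the correlations of `z` as its Fourier data; uniqueness
compares it with the constant spectrum of white noise. -/
theorem cycMat_noise_white (hd : ∀ n, MemLp (d n) 2 μ)
    (hunc : ∀ n n' : ℤ, ∫ ω, d n ω * conj (z n' ω) ∂μ = 0)
    (hx : ∀ n ω, x n ω = d n ω + z n ω) {sD sX : ℤ → ℝ → ℂ}
    (hsD : IsCyclicSpectrum P (corr μ d d) sD) (hsX : IsCyclicSpectrum P (corr μ x x) sX)
    {p : ℝ} (hw : IsWhite μ p z) :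
    ∀ᵐ σ ∂(band P), cycMat P sX σ - cycMat P sD σ = (p : ℂ) • 1 := by
  have h := (hsX.sub hsD).cycMat_ae_eq (isCyclicSpectrum_white P p) fun n m _ => by
    simp only [corr_obs_obs hd hw.1 hunc hx, hw.2]
    ring
  filter_upwards [h] with σ hσ
  rw [← cycMat_white P p σ, ← hσ]
  rfl

theorem isSpectralModel_cycMat {p : ℝ} (hd : IsCyclostationary μ P d)
    (hz : IsCyclostationary μ P z) (hp : 0 < p) (hwhite : IsWhite μ p z ∨ IsWhite μ p d)
    (hunc : ∀ n n' : ℤ, ∫ ω, d n ω * conj (z n' ω) ∂μ = 0)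
    (hx : ∀ n ω, x n ω = d n ω + z n ω) {sD sX : ℤ → ℝ → ℂ}
    (hsD : IsCyclicSpectrum P (corr μ d d) sD) (hsX : IsCyclicSpectrum P (corr μ x x) sX) :
    IsSpectralModel μ P p d x (cycMat P sD) (cycMat P sX) where
  memLp_signal := hd.1
  memLp_obs n := by
    have : x n = d n + z n := funext fun ω => hx n ω
    rw [this]
    exact (hd.1 n).add (hz.1 n)
  integrable_signal := hsD.integrable_cycMat
  integrable_obs := hsX.integrable_cycMat
  moment_signal n := by rw [← hsD.moment (fun n m l => hd.2 n m l), corr_sub_eq]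
  moment_cross n m := by
    rw [← hsD.moment (fun n m l => hd.2 n m l), ← corr_signal_obs hd.1 hz.1 hunc hx, corr_sub_eq]
  moment_obs n m := by
    rw [← hsX.moment (fun n m l => by
      simp only [corr_obs_obs hd.1 hz.1 hunc hx, hd.2, hz.2]), corr_sub_eq]
  white := by
    have h1 := ae_posSemidef_cycMat hd hsD fun _ _ => rfl
    -- The noise has no spectrum of its own among the data; the difference of the spectra of `x` and
    -- `d` plays that role.
    have h2 := ae_posSemidef_cycMat hz (hsX.sub hsD) fun n m => by
      rw [corr_obs_obs hd.1 hz.1 hunc hx, add_sub_cancel_left]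
    have h3 : ∀ᵐ σ ∂(band P), cycMat P sD σ = (p : ℂ) • 1 ∨
        cycMat P sX σ - cycMat P sD σ = (p : ℂ) • 1 := by
      rcases hwhite with hw | hw
      · filter_upwards [cycMat_noise_white hd.1 hunc hx hsD hsX hw] with σ hσ using Or.inr hσ
      · have h := hsD.cycMat_ae_eq (isCyclicSpectrum_white P p) fun n m _ => hw.2 n m
        filter_upwards [h] with σ hσ
        left
        rw [hσ, cycMat_white]
    filter_upwards [h1, h2, h3] with σ a b c using ⟨hp, a, b, c⟩

end Model

end

/-! ### The theorem -/

theorem theorem2 {Ω : Type*} [MeasurableSpace Ω] (μ : Measure Ω) [IsProbabilityMeasure μ]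
    (P : ℕ) [NeZero P] (d z x : ℤ → Ω → ℂ)
    (hd : IsCyclostationary μ P d) (hz : IsCyclostationary μ P z)
    (hwhite : ∃ p : ℝ, 0 < p ∧ (IsWhite μ p z ∨ IsWhite μ p d))
    (hunc : ∀ n n' : ℤ, ∫ ω, d n ω * conj (z n' ω) ∂μ = 0)
    (hx : ∀ n ω, x n ω = d n ω + z n ω)
    (sD sX sDX : ℤ → ℝ → ℂ)
    (hsD : IsCyclicSpectrum P (corr μ d d) sD)
    (hsX : IsCyclicSpectrum P (corr μ x x) sX)
    (hsDX : IsCyclicSpectrum P (corr μ d x) sDX)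
    (SD SX SDX : ℝ → Matrix (Fin P) (Fin P) ℂ)
    (hSD : SD = cycMat P sD) (hSX : SX = cycMat P sX) (hSDX : SDX = cycMat P sDX) :
    ∃ mmse : ℝ,
      -- the least error power of FRESH filters, and the cyclic Wiener filter attaining it
      IsLeast (freshMSEs μ P d x SX) mmse ∧
      (∀ W : Fin P → ℝ → ℂ, IsCyclicWiener μ P d x SX W ↔
        ∀ p q : Fin P, ∀ᵐ σ ∂(band P),
          W q (σ + (p.val : ℝ) / (P : ℝ)) = ((SX σ)⁻¹ * (SDX σ)ᴴ) (p + q) p) ∧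
      -- its output is the best linear estimate of the signal from all the observations
      (∀ (W : Fin P → ℝ → ℂ) (dhat : ℤ → Ω → ℂ), IsCyclicWiener μ P d x SX W →
        IsFreshOutput μ P x SX W dhat → ∀ (n : ℤ) (c : ℤ →₀ ℂ),
          ∫ ω, ‖d n ω - dhat n ω‖ ^ 2 ∂μ
            ≤ ∫ ω, ‖d n ω - c.sum fun m a => a * x m ω‖ ^ 2 ∂μ) ∧
      -- in any KL basis of the observation
      (∀ B : ℝ → Matrix (Fin P) (Fin P) ℂ, IsKLBasis P SX B →
        IsKLBasis P SD B ∧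
        -- the scalar Wiener filter is the optimal filter in the KL domain
        IsLeast (klMSEs μ P d x SX B) mmse ∧
        (∀ W : Fin P → ℝ → ℂ, IsKLWiener μ P d x SX B W ↔
          ∀ p : Fin P, ∀ᵐ σ ∂(band P),
            W p σ = conj (klSpec P SDX B p σ) / klSpec P SX B p σ) ∧
        -- it is equivalent to the cyclic Wiener filter: both have the same output process
        (∀ (W W' : Fin P → ℝ → ℂ), IsCyclicWiener μ P d x SX W → IsKLWiener μ P d x SX B W' →
          ∀ dhat : ℤ → Ω → ℂ, IsFreshOutput μ P x SX W dhat ↔ IsKLOutput μ P x SX B W' dhat) ∧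
        (∀ (W W' : Fin P → ℝ → ℂ), IsCyclicWiener μ P d x SX W → IsKLWiener μ P d x SX B W' →
          ∀ dhat dhat' : ℤ → Ω → ℂ, IsFreshOutput μ P x SX W dhat →
            IsKLOutput μ P x SX B W' dhat' → ∀ n, dhat n =ᵐ[μ] dhat' n) ∧
        (∀ p, Integrable
          (fun σ => (klSpec P SD B p σ).re * (1 - klCohSq P SD SX SDX B p σ)) (band P)) ∧
        mmse = ∑ p : Fin P,
          ∫ σ, (klSpec P SD B p σ).re * (1 - klCohSq P SD SX SDX B p σ) ∂(band P)) ∧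
      -- the error power through the coherence matrix
      Integrable (fun σ => (SD σ * (1 - cohMat (SD σ) (SDX σ) (SX σ) *
        (cohMat (SD σ) (SDX σ) (SX σ))ᴴ)).trace) (band P) ∧
      (mmse : ℂ) = ∫ σ, (SD σ * (1 - cohMat (SD σ) (SDX σ) (SX σ) *
        (cohMat (SD σ) (SDX σ) (SX σ))ᴴ)).trace ∂(band P) ∧
      -- the error power for white noise
      (∀ Pz : ℝ, 0 < Pz → IsWhite μ Pz z →
        Integrable (fun σ => (SD σ * (SD σ + (Pz : ℂ) • 1)⁻¹).trace) (band P) ∧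
        (mmse : ℂ) = (Pz : ℂ) * ∫ σ, (SD σ * (SD σ + (Pz : ℂ) • 1)⁻¹).trace ∂(band P)) := by
  subst hSD hSX hSDX
  obtain ⟨p, hp, hw⟩ := hwhite
  have h := isSpectralModel_cycMat hd hz hp hw hunc hx hsD hsX
  have hDX := cycMat_cross_ae_eq hd.1 hz.1 hunc hx hsD hsDX
  have hfresh := exists_freshMat_eq (P := P)
    (IsSpectralModel.wienerMat (cycMat P sD) (cycMat P sX))
  have hCW := fun W => h.isOptimal_iff isFreshOutput_iff hfresh W
  -- Responses that agree almost everywhere have the same outputs. Optimality in either class forces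
  -- this one response, so the equivalence of the two filters goes through it.
  have hout : ∀ {M dhat}, (∀ᵐ σ ∂(band P), M σ =
      IsSpectralModel.wienerMat (cycMat P sD) (cycMat P sX) σ) →
      (IsMatOutput μ P x (cycMat P sX) M dhat ↔ IsMatOutput μ P x (cycMat P sX)
        (IsSpectralModel.wienerMat (cycMat P sD) (cycMat P sX)) dhat) := fun hM =>
    ⟨fun hd => hd.congr hM, fun hd => hd.congr (hM.mono fun _ hσ => hσ.symm)⟩
  have hcoh : ∀ᵐ σ ∂(band P), (IsSpectralModel.errMat (cycMat P sD) (cycMat P sX) σ).trace =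
      (cycMat P sD σ * (1 - cohMat (cycMat P sD σ) (cycMat P sDX σ) (cycMat P sX σ) *
        (cohMat (cycMat P sD σ) (cycMat P sDX σ) (cycMat P sX σ))ᴴ)).trace := by
    filter_upwards [h.white, hDX] with σ h1 h2
    rw [h2, h1.trace_mul_one_sub_cohMat]
    rfl
  refine ⟨IsSpectralModel.minPower (cycMat P sD) (cycMat P sX),
    h.isLeast_minPower isFreshOutput_iff hfresh,
    fun W => (hCW W).trans (h.freshMat_ae_eq_iff hDX W), ?_, ?_,
    h.integrable_trace_errMat.congr hcoh,
    h.ofReal_minPower_eq.trans (integral_congr_ae hcoh), ?_⟩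
  · intro W dhat hW hdhat n c
    have := h.integral_norm_sub_sq_le
      ((hout ((hCW W).1 hW)).1 ((isFreshOutput_iff W dhat).1 hdhat)) n c
    simpa only [combo_apply] using this
  · intro B hB
    have hkl := h.exists_klMat_ae_eq hB
    have hKW := fun W => h.isOptimal_iff (isKLOutput_iff hB) hkl W
    refine ⟨h.isKLBasis_signal hB, h.isLeast_minPower (isKLOutput_iff hB) hkl,
      fun W => (hKW W).trans (h.klMat_ae_eq_iff hB hDX W), ?_, ?_, fun q => ?_,
      h.minPower_eq_sum_kl hB hDX⟩
    · intro W W' hW hW' dhat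
      rw [isFreshOutput_iff, isKLOutput_iff hB, hout ((hCW W).1 hW), hout ((hKW W').1 hW')]
    · intro W W' hW hW' dhat dhat' h1 h2 n
      rw [isFreshOutput_iff, hout ((hCW W).1 hW)] at h1
      rw [isKLOutput_iff hB, hout ((hKW W').1 hW')] at h2
      exact h.ae_eq_of_hasCLIntegral (h1 n) (h2 n)
    · exact (integrable_klSpec h.integrable_errMat hB q).re.congr (h.kl_error_ae_eq hB hDX q).symm
  · intro Pz hPz hwz
    have hnz : ∀ᵐ σ ∂(band P), (IsSpectralModel.errMat (cycMat P sD) (cycMat P sX) σ).trace =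
        (Pz : ℂ) * (cycMat P sD σ * (cycMat P sD σ + (Pz : ℂ) • 1)⁻¹).trace := by
      filter_upwards [h.white, cycMat_noise_white hd.1 hunc hx hsD hsX hwz] with σ h1 h2
      exact h1.sub_mul_inv_mul_eq (by rw [← h2]; abel)
    have hPz' : (Pz : ℂ) ≠ 0 := by exact_mod_cast hPz.ne'
    constructor
    · refine (h.integrable_trace_errMat.const_mul (Pz : ℂ)⁻¹).congr ?_
      filter_upwards [hnz] with σ hσ
      rw [hσ, inv_mul_cancel_left₀ hPz']
    · rw [h.ofReal_minPower_eq, integral_congr_ae hnz, integral_const_mul]
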